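/- Let $d\ge 1$, and let $M=\mathbb T^d=\mathbb R^d/2\pi\mathbb Z^d$ or $M=\mathbb R^d$. Consider the control system $$i\partial_t\psi=\Big(-\Delta+V+\sum_{j=1}^m u_j(t)W_j\Big)\psi,\qquad \psi(0,\cdot)=\psi_0\in L^2(M,\mathbb C),\qquad\qquad(\ast)$$ in one of the following two cases. (T) $M=\mathbb T^d$, $V\in L^\infty(\mathbb T^d,\mathbb R)$, $m=2d$, $W_{2j-1}(x)=\sin\langle b_j,x\rangle$ and $W_{2j}(x)=\cos\langle b_j,x\rangle$ for $1\le j\le d$, where $b_j$ is the $j$-th canonical vector of $\mathbb R^d$ for $j\le d-1$ and $b_d=(1,\dots,1)$. (R) $M=\mathbb R^d$, $V\in L^2_{\rm loc}(\mathbb R^d,\mathbb R)$ with $V(x)\ge -a|x|^2-b$ for some $a,b\ge 0$, $m=d+1$, $W_j(x)=x_j$ for $1\le j\le d$ and $W_{d+1}(x)=e^{-|x|^2/2}$. For a constant $c\in\mathbb R^m$, let $A_c$ be the closure of $-\Delta+V+\sum_j c_jW_j$ with domain $C_c^\infty(M,\mathbb C)$. For a control $u$ equal to the constant $c^k\in\mathbb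 R^m$ on $(t_{k-1},t_k)$, where $0=t_0<\dots<t_N=T$, the solution of $(\ast)$ is $\psi(t;u,\psi_0)=e^{-i(t-t_{k-1})A_{c^k}}e^{-i(t_{k-1}-t_{k-2})A_{c^{k-1}}}\cdots e^{-it_1A_{c^1}}\psi_0$ for $t\in[t_{k-1},t_k]$. A unitary operator $L$ on $L^2(M,\mathbb C)$ is called $L^2$-STAR (small-time approximately reachable) if for every $\psi_0\in L^2(M,\mathbb C)$ with $\|\psi_0\|_{L^2}=1$ and every $\epsilon>0$ there exist $T\in[0,\epsilon]$, $\theta\in[0,2\pi)$ and a piecewise constant control $u$ on $[0,T]$ such that $\|\psi(T;u,\psi_0)-e^{i\theta}L\psi_0\|_{L^2}<\epsilon$. Then: 1. In case (T), for every $\varphi\in L^2(\mathbb T^d,\mathbb R)$, the multiplication operator $e^{i\varphi}$ is $L^2$-STAR. 2. In case (R), for every $j\in\{1,\dots,d\}$ and $u\in\mathbb R$, the translation $e^{u\partial_{x_j}}:\psi\mapsto\psi(\cdot+ue_j)$ is $L^2$-STAR, where $e_j$ is the $j$-th canonical vector. 3. In case (R), for every $\varphi\in L^2(\mathbb R^d,\mathbb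 R)$, the multiplication operator $e^{i\varphi}$ is $L^2$-STAR. -/

import Mathlib

open MeasureTheory Filter Topology
open scoped ContDiff ENNReal

noncomputable section

namespace SchrodingerControl

/-! ### Unitary groups and piecewise constant controls -/

section Abstract

variable {E : Type*} [NormedAddCommGroup E] [InnerProductSpace ℂ E]

/-- `U` is the strongly continuous one-parameter unitary group `t ↦ e^{-itA}`, where `A` is the
closure of the operator with graph `G`: the infinitesimal generator of `U`, with its maximal
domain, is exactly `-iA`. -/
structure IsPropagator (G : Set (E × E)) (U : ℝ → (E ≃ₗᵢ[ℂ] E)) : Prop where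
  map_zero : ∀ x, U 0 x = x
  map_add : ∀ s t x, U (s + t) x = U s (U t x)
  continuous : ∀ x, Continuous fun t => U t x
  generator : ∀ x y, (x, y) ∈ closure G ↔ HasDerivAt (fun t => U t x) (-(Complex.I • y)) 0

/-- A piecewise constant control on `[0, T]` with values in `ℝ^ι`: a subdivision
`0 = t₀ < t₁ < ⋯ < t_N = T` and the value taken on each interval `(t_k, t_{k+1})`
(`time k` for `k > N` and `value k` for `k ≥ N` are irrelevant). -/
structure PWControl (ι : Type*) (T : ℝ) where
  N : ℕ
  time : ℕ → ℝ
  value : ℕ → ι → ℝ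
  time_zero : time 0 = 0
  time_last : time N = T
  time_lt : ∀ k < N, time k < time (k + 1)

variable {ι : Type*}

/-- `ψ` is, on `[0, T]`, the solution of `i ∂ₜψ = A(u(t)) ψ`, `ψ(0) = ψ₀`, for the piecewise
constant control `u`, where `A(c)` is the closure of the operator with graph `G c`: on each
interval of the subdivision, `ψ` is propagated by the unitary group `e^{-itA(c)}` of the
corresponding value `c`. -/
def IsSolution (G : (ι → ℝ) → Set (E × E)) {T : ℝ} (u : PWControl ι T) (ψ₀ : E) (ψ : ℝ → E) :
    Prop :=
  ψ 0 = ψ₀ ∧ ∀ k < u.N, ∃ U, IsPropagator (G (u.value k)) U ∧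
    ∀ t ∈ Set.Icc (u.time k) (u.time (k + 1)), ψ t = U (t - u.time k) (ψ (u.time k))

/-- The unitary operator `L` is small-time approximately reachable (`L²`-STAR) for the control
system `i ∂ₜψ = A(u(t)) ψ`. -/
def IsSTAR (G : (ι → ℝ) → Set (E × E)) (L : E ≃ₗᵢ[ℂ] E) : Prop :=
  ∀ ψ₀ : E, ‖ψ₀‖ = 1 → ∀ ε > (0 : ℝ), ∃ T ∈ Set.Icc 0 ε, ∃ θ ∈ Set.Ico 0 (2 * Real.pi),
    ∃ (u : PWControl ι T) (ψ : ℝ → E), IsSolution G u ψ₀ ψ ∧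
      ‖ψ T - Complex.exp (Complex.I * (θ : ℂ)) • L ψ₀‖ < ε

end Abstract

/-! ### Phase operators -/

section Phase

variable {X : Type*} [MeasurableSpace X] {μ : Measure X}

theorem memLp_phase {φ : X → ℝ} (hφ : AEStronglyMeasurable φ μ) (ψ : Lp ℂ 2 μ) :
    MemLp (fun x => Complex.exp (Complex.I * (φ x : ℂ)) * ψ x) 2 μ := by
  have hm : AEStronglyMeasurable (fun x => Complex.exp (Complex.I * (φ x : ℂ))) μ := by
    have hc : Continuous fun r : ℝ => Complex.exp (Complex.I * (r : ℂ)) := by fun_prop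
    exact hc.comp_aestronglyMeasurable hφ
  refine (Lp.memLp ψ).of_le (hm.mul (Lp.aestronglyMeasurable ψ)) (ae_of_all _ fun x => ?_)
  rw [norm_mul, Complex.norm_exp_I_mul_ofReal, one_mul]

/-- The function `x ↦ e^{iφ(x)} ψ(x)`, as an element of `L²`. -/
def phaseFun {φ : X → ℝ} (hφ : AEStronglyMeasurable φ μ) (ψ : Lp ℂ 2 μ) : Lp ℂ 2 μ :=
  (memLp_phase hφ ψ).toLp _

theorem coeFn_phaseFun {φ : X → ℝ} (hφ : AEStronglyMeasurable φ μ) (ψ : Lp ℂ 2 μ) :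
    phaseFun hφ ψ =ᵐ[μ] fun x => Complex.exp (Complex.I * (φ x : ℂ)) * ψ x :=
  MemLp.coeFn_toLp _

theorem phaseFun_phaseFun_neg {φ χ : X → ℝ} (hφ : AEStronglyMeasurable φ μ)
    (hχ : AEStronglyMeasurable χ μ) (h : ∀ x, φ x + χ x = 0) (ψ : Lp ℂ 2 μ) :
    phaseFun hφ (phaseFun hχ ψ) = ψ := by
  apply Lp.ext
  filter_upwards [coeFn_phaseFun hφ (phaseFun hχ ψ), coeFn_phaseFun hχ ψ] with x h1 h2
  rw [h1, h2, ← mul_assoc, ← Complex.exp_add, ← mul_add, ← Complex.ofReal_add, h x]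
  simp

/-- The unitary multiplication operator `e^{iφ}` on `L²(X, ℂ)`, for `φ ∈ L²(X, ℝ)`. -/
def phase (φ : Lp ℝ 2 μ) : Lp ℂ 2 μ ≃ₗᵢ[ℂ] Lp ℂ 2 μ where
  toFun := phaseFun (Lp.aestronglyMeasurable φ)
  invFun := phaseFun (Lp.aestronglyMeasurable φ).neg
  map_add' ψ₁ ψ₂ := by
    apply Lp.ext
    filter_upwards [coeFn_phaseFun (Lp.aestronglyMeasurable φ) (ψ₁ + ψ₂),
      coeFn_phaseFun (Lp.aestronglyMeasurable φ) ψ₁,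
      coeFn_phaseFun (Lp.aestronglyMeasurable φ) ψ₂, Lp.coeFn_add ψ₁ ψ₂,
      Lp.coeFn_add (phaseFun (Lp.aestronglyMeasurable φ) ψ₁)
        (phaseFun (Lp.aestronglyMeasurable φ) ψ₂)] with x h h1 h2 h3 h4
    rw [h, h4, Pi.add_apply, h1, h2, h3, Pi.add_apply, mul_add]
  map_smul' c ψ := by
    apply Lp.ext
    filter_upwards [coeFn_phaseFun (Lp.aestronglyMeasurable φ) (c • ψ),
      coeFn_phaseFun (Lp.aestronglyMeasurable φ) ψ, Lp.coeFn_smul c ψ,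
      Lp.coeFn_smul c (phaseFun (Lp.aestronglyMeasurable φ) ψ)] with x h h1 h2 h3
    rw [RingHom.id_apply, h, h3, Pi.smul_apply, h1, h2, Pi.smul_apply, smul_eq_mul, smul_eq_mul]
    ring
  left_inv ψ := phaseFun_phaseFun_neg _ _ (fun x => by simp) ψ
  right_inv ψ := phaseFun_phaseFun_neg _ _ (fun x => by simp) ψ
  norm_map' ψ := by
    apply le_antisymm <;> refine Lp.norm_le_norm_of_ae_le ?_ <;>
    · filter_upwards [coeFn_phaseFun (Lp.aestronglyMeasurable φ) ψ] with x h
      simp only [LinearEquiv.coe_mk, LinearMap.coe_mk, AddHom.coe_mk]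
      rw [h, norm_mul, Complex.norm_exp_I_mul_ofReal, one_mul]

end Phase

/-! ### The system on the torus -/

instance instFactTwoPiPos : Fact (0 < 2 * Real.pi) := ⟨Real.two_pi_pos⟩

/-- The torus `𝕋^d = ℝ^d / 2πℤ^d`, with the Lebesgue measure of total mass `(2π)^d`. -/
abbrev Torus (d : ℕ) : Type := Fin d → AddCircle (2 * Real.pi)

/-- `f` is a `C^∞` function on the torus: its lift to `ℝ^d` is `C^∞`. -/
def TorusSmooth {d : ℕ} (f : Torus d → ℂ) : Prop :=
  ContDiff ℝ ∞ fun x : EuclideanSpace ℝ (Fin d) => f fun i => (x i : AddCircle (2 * Real.pi))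

/-- The Laplacian `Δf = ∑ⱼ ∂ⱼ²f` on the torus. -/
def torusLaplacian {d : ℕ} (f : Torus d → ℂ) (p : Torus d) : ℂ :=
  ∑ j : Fin d, iteratedDeriv 2
    (fun t : ℝ => f (p + Pi.single j (t : AddCircle (2 * Real.pi)))) 0

/-- The vectors `b₁ = (1,0,…,0)`, …, `b_{d-1} = (0,…,0,1,0)`, `b_d = (1,…,1)`. -/
def bVec {d : ℕ} (j : Fin d) : Fin d → ℤ :=
  if (j : ℕ) + 1 = d then fun _ => 1 else Pi.single j 1

/-- `⟨bⱼ, x⟩`, modulo `2π`. -/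
def bInner {d : ℕ} (j : Fin d) (p : Torus d) : AddCircle (2 * Real.pi) :=
  ∑ i, bVec j i • p i

/-- The potential `V + ∑ⱼ (u_{2j-1} sin⟨bⱼ, x⟩ + u_{2j} cos⟨bⱼ, x⟩)`, the control `u_{2j-1}`
being indexed by `(j, 0)` and `u_{2j}` by `(j, 1)`. -/
def torusPotential {d : ℕ} (V : Torus d → ℝ) (u : Fin d × Fin 2 → ℝ) (p : Torus d) : ℝ :=
  V p + ∑ j, (u (j, 0) * Real.sin_periodic.lift (bInner j p) +
    u (j, 1) * Real.cos_periodic.lift (bInner j p))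

/-- The graph, in `L²(𝕋^d, ℂ) × L²(𝕋^d, ℂ)`, of the operator
`-Δ + V + ∑ⱼ (u_{2j-1} sin + u_{2j} cos)⟨bⱼ, x⟩` with domain `C^∞(𝕋^d, ℂ)`. -/
def torusSystem {d : ℕ} (V : Torus d → ℝ) (u : Fin d × Fin 2 → ℝ) :
    Set (Lp ℂ 2 (volume : Measure (Torus d)) × Lp ℂ 2 (volume : Measure (Torus d))) :=
  {q | ∃ f : Torus d → ℂ, TorusSmooth f ∧ q.1 =ᵐ[volume] f ∧
    q.2 =ᵐ[volume] fun p => -torusLaplacian f p + (torusPotential V u p : ℂ) * f p}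

/-! ### The system on the Euclidean space -/

/-- The Laplacian `Δf` on `ℝ^d` (Mathlib's). -/
def lineLaplacian {d : ℕ} (f : EuclideanSpace ℝ (Fin d) → ℂ) (x : EuclideanSpace ℝ (Fin d)) : ℂ :=
  Laplacian.laplacian f x

/-- The potential `V + ∑ⱼ uⱼ xⱼ + u_{d+1} e^{-|x|²/2}`. -/
def linePotential {d : ℕ} (V : EuclideanSpace ℝ (Fin d) → ℝ) (u : Fin (d + 1) → ℝ)
    (x : EuclideanSpace ℝ (Fin d)) : ℝ :=
  V x + ∑ j : Fin d, u j.castSucc * x j + u (Fin.last d) * Real.exp (-‖x‖ ^ 2 / 2)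

/-- The graph, in `L²(ℝ^d, ℂ) × L²(ℝ^d, ℂ)`, of the operator
`-Δ + V + ∑ⱼ uⱼ xⱼ + u_{d+1} e^{-|x|²/2}` with domain `C_c^∞(ℝ^d, ℂ)`. -/
def lineSystem {d : ℕ} (V : EuclideanSpace ℝ (Fin d) → ℝ) (u : Fin (d + 1) → ℝ) :
    Set (Lp ℂ 2 (volume : Measure (EuclideanSpace ℝ (Fin d))) ×
      Lp ℂ 2 (volume : Measure (EuclideanSpace ℝ (Fin d)))) :=
  {q | ∃ f : EuclideanSpace ℝ (Fin d) → ℂ, ContDiff ℝ ∞ f ∧ HasCompactSupport f ∧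
    q.1 =ᵐ[volume] f ∧
    q.2 =ᵐ[volume] fun x => -lineLaplacian f x + (linePotential V u x : ℂ) * f x}

/-- `V ∈ L²_loc(ℝ^d, ℝ)` and `V(x) ≥ -a|x|² - b` for some `a, b ≥ 0`. -/
def AdmissiblePotential {d : ℕ} (V : EuclideanSpace ℝ (Fin d) → ℝ) : Prop :=
  (∀ K, IsCompact K → MemLp V 2 (volume.restrict K)) ∧
    ∃ a b : ℝ, 0 ≤ a ∧ 0 ≤ b ∧ ∀ᵐ x, -a * ‖x‖ ^ 2 - b ≤ V x

theorem compMeasurePreserving_add_right_cancel {d : ℕ} {v w : EuclideanSpace ℝ (Fin d)}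
    (h : v + w = 0) (ψ : Lp ℂ 2 (volume : Measure (EuclideanSpace ℝ (Fin d)))) :
    Lp.compMeasurePreserving (fun x => x + v) (measurePreserving_add_right volume v)
      (Lp.compMeasurePreserving (fun x => x + w) (measurePreserving_add_right volume w) ψ)
        = ψ := by
  apply Lp.ext
  have h1 := Lp.coeFn_compMeasurePreserving
    (Lp.compMeasurePreserving (fun x => x + w) (measurePreserving_add_right volume w) ψ)
    (measurePreserving_add_right volume v)
  have h2 := (measurePreserving_add_right volume v).quasiMeasurePreserving.ae_eq_comp
    (Lp.coeFn_compMeasurePreserving ψ (measurePreserving_add_right volume w))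
  filter_upwards [h1, h2] with x hx hy
  rw [hx, hy]
  simp [add_assoc, h]

/-- The unitary translation operator `(e^{v·∇} ψ)(x) = ψ(x + v)` on `L²(ℝ^d, ℂ)`. -/
def translation {d : ℕ} (v : EuclideanSpace ℝ (Fin d)) :
    Lp ℂ 2 (volume : Measure (EuclideanSpace ℝ (Fin d))) ≃ₗᵢ[ℂ]
      Lp ℂ 2 (volume : Measure (EuclideanSpace ℝ (Fin d))) where
  toLinearEquiv := LinearEquiv.ofLinearMap
    (Lp.compMeasurePreservingₗ ℂ (fun x => x + v) (measurePreserving_add_right volume v))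
    (Lp.compMeasurePreservingₗ ℂ (fun x => x + -v) (measurePreserving_add_right volume (-v)))
    (LinearMap.ext fun ψ => compMeasurePreserving_add_right_cancel (by simp) ψ)
    (LinearMap.ext fun ψ => compMeasurePreserving_add_right_cancel (by simp) ψ)
  norm_map' ψ := Lp.norm_compMeasurePreserving ψ (measurePreserving_add_right volume v)

end SchrodingerControl

end

/-! Two things are needed: the propagators must exist for every constant control, and three
small-time limits must be reachable.

Existence. Stone's theorem is proved from the density of the range of `A + il`, through commuting
bounded approximations `l²A(A² + l²)⁻¹` (`exists_isPropagator`). On the torus the characters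
diagonalise `-Δ`, and the potential is a bounded perturbation. On `ℝ^d` a vector orthogonal to the
range of `-Δ + P + z` is tested against solutions cut off at radius `R`. The commutator with the
cutoff stays bounded in `L²` if the gradient of the solution grows at most like `R`, and it sits in
the region `‖x‖ ≥ R`, where the vector has little mass (`dense_range_of_local_solutions`). The bound
`P ≥ -a|x|² - b` gives exactly this growth (`dense_range_lineGraph`).

Limits. Reachability is studied vector by vector, up to a global phase and up to small errors; in
this form it is transitive and closed under limits. Each limit is proved by Duhamel's estimate
`IsPropagator.norm_sub_le`: an explicit curve from the initial vector to the expected target is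
inserted in the equation, and its residual is bounded. (a) The potential `V + τ⁻¹w` acting for the
time `τ` gives the phase `e^{-iw}` as `τ → 0`. (b) The free evolution for the time `r⁻²`, conjugated
by `e^{irφ}`, gives `e^{-i|∇φ|²}` as `r → ∞`, because `-Δ` conjugated by this phase has leading term
`r²|∇φ|²` and remainder `O(r)`. (c) On `ℝ^d`, conjugation by a plane wave of frequency of order
`τ⁻¹` turns the free evolution for the time `τ` into a translation, up to a global phase.

Conclusion on the torus. By (a) the modes `Re(c e^{i⟨b_j, x⟩})` are reachable. Expanding `|∇φ|²` for
a sum `φ` of two modes `k`, `l` and cancelling the other terms, (b) yields the mode `k + l` when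
`⟨k, l⟩ ≠ 0`. As `(1,…,1)` is orthogonal to no canonical vector, every mode is obtained, hence every
real trigonometric polynomial.

Conclusion on `ℝ^d`. By (a) the linear phases and the gaussian are reachable, by (c) so are the
translates of the gaussian. These are the multiples of `e^{-|x|²/2} e^{⟨v, x⟩}`, and the
exponentials `e^{⟨v, x⟩}` span an algebra that separates points. Stone–Weierstrass on growing balls
then gives every continuous phase.

In both cases a phase in `L²` is an almost everywhere limit of phases already reached, and dominated
convergence closes the argument (`PhaseReach.of_tendsto`). -/

noncomputable section

namespace SchrodingerControl

/-! ### Unitary groups generated by bounded self-adjoint operators -/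

section BoundedGroup

variable {E : Type*} [NormedAddCommGroup E] [InnerProductSpace ℂ E] [CompleteSpace E]

/-- The unitary operator `e^{-iB}`. -/
def expNegI (B : E →L[ℂ] E) : E →L[ℂ] E := NormedSpace.exp (-(Complex.I • B))

theorem hasDerivAt_expNegI_smul (B : E →L[ℂ] E) (x : E) (s : ℝ) :
    HasDerivAt (fun t : ℝ => expNegI (t • B) x) (expNegI (s • B) (-(Complex.I • B x))) s := by
  have h := (hasDerivAt_exp_smul_const (𝕂 := ℝ) (𝔸 := E →L[ℂ] E) (-(Complex.I • B)) s)
  have h2 := ((ContinuousLinearMap.apply ℂ E x).restrictScalars ℝ).hasFDerivAt.comp_hasDerivAt s h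
  have e : ∀ t : ℝ, expNegI (t • B) = NormedSpace.exp (t • (-(Complex.I • B))) := by
    intro t
    rw [expNegI, smul_neg, smul_comm]
  simp only [e]
  simpa [Function.comp_def] using h2

theorem norm_expNegI_apply {B : E →L[ℂ] E} (hB : IsSelfAdjoint B) (x : E) :
    ‖expNegI B x‖ = ‖x‖ := by
  have h : expNegI B ∈ unitary (E →L[ℂ] E) := by
    have := (selfAdjoint.expUnitary (⟨-B, hB.neg⟩ : selfAdjoint (E →L[ℂ] E))).2
    rw [selfAdjoint.expUnitary_coe] at this
    simpa [expNegI] using this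
  have h2 := ContinuousLinearMap.norm_map_of_mem_unitary h x
  exact h2

theorem IsSelfAdjoint.real_smul' {B : E →L[ℂ] E} (hB : IsSelfAdjoint B) (t : ℝ) :
    IsSelfAdjoint (t • B) := by
  exact IsSelfAdjoint.smul (by simp [isSelfAdjoint_iff]) hB

/-- Mean value inequality: `t ↦ e^{-itB}x` has a derivative of constant norm `‖Bx‖`. -/
theorem norm_expNegI_apply_sub_le {B : E →L[ℂ] E} (hB : IsSelfAdjoint B) (x : E) :
    ‖expNegI B x - x‖ ≤ ‖B x‖ := by
  have h := norm_image_sub_le_of_norm_deriv_le_segment_01' (f := fun t : ℝ => expNegI (t • B) x)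
    (f' := fun s => expNegI (s • B) (-(Complex.I • B x))) (C := ‖B x‖)
    (fun s _ => (hasDerivAt_expNegI_smul B x s).hasDerivWithinAt)
    (fun s _ => by
      rw [norm_expNegI_apply (IsSelfAdjoint.real_smul' hB s), norm_neg, norm_smul]; simp)
  simpa [expNegI] using h

theorem expNegI_add {B C : E →L[ℂ] E} (h : Commute B C) (x : E) :
    expNegI (B + C) x = expNegI B (expNegI C x) := by
  have hc : Commute (-(Complex.I • B)) (-(Complex.I • C)) :=
    ((h.smul_left _).smul_right _).neg_left.neg_right
  let _ : NormedAlgebra ℚ (E →L[ℂ] E) := NormedAlgebra.restrictScalars ℚ ℂ _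
  rw [expNegI, smul_add, neg_add, NormedSpace.exp_add_of_commute hc]
  rfl

/-- Commutation gives `e^{-iB} = e^{-iC} e^{-i(B - C)}`, and `e^{-iC}` is an isometry. -/
theorem norm_expNegI_sub_le {B C : E →L[ℂ] E} (hB : IsSelfAdjoint B) (hC : IsSelfAdjoint C)
    (h : Commute B C) (x : E) : ‖expNegI B x - expNegI C x‖ ≤ ‖B x - C x‖ := by
  have e : expNegI B x = expNegI C (expNegI (B - C) x) := by
    rw [← expNegI_add]
    · simp
    · exact (h.symm.sub_right (Commute.refl C))
  rw [e, ← map_sub, norm_expNegI_apply hC]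
  exact norm_expNegI_apply_sub_le (hB.sub hC) x

/-- The left side is a first-order Taylor remainder; its derivative along `tB` involves `e^{-isB}Bx
- Bx`, estimated by replacing `Bx` by an approximation `y`. No operator norm of `B` enters, so the
bound survives along a sequence of operators whose norms blow up. -/
theorem norm_expNegI_apply_sub_add_le {B : E →L[ℂ] E} (hB : IsSelfAdjoint B) (x y : E) :
    ‖expNegI B x - x + Complex.I • B x‖ ≤ 2 * ‖B x - y‖ + ‖B y‖ := by
  have h := norm_image_sub_le_of_norm_deriv_le_segment_01'
    (f := fun t : ℝ => expNegI (t • B) x + t • (Complex.I • B x))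
    (f' := fun s => expNegI (s • B) (-(Complex.I • B x)) + (1 : ℝ) • (Complex.I • B x))
    (C := 2 * ‖B x - y‖ + ‖B y‖)
    (fun s _ => ((hasDerivAt_expNegI_smul B x s).add
      ((hasDerivAt_id s).smul_const _)).hasDerivWithinAt)
    (fun s hs => by
      have hsB := IsSelfAdjoint.real_smul' hB s
      have e : expNegI (s • B) (-(Complex.I • B x)) + (1 : ℝ) • (Complex.I • B x) =
          -(Complex.I • (expNegI (s • B) (B x - y) - (B x - y) + (expNegI (s • B) y - y))) := by
        simp only [map_neg, map_smul, map_sub, one_smul, smul_add, smul_sub]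
        abel
      rw [e, norm_neg, norm_smul, Complex.norm_I, one_mul]
      refine (norm_add_le _ _).trans (add_le_add ?_ ?_)
      · refine (norm_sub_le _ _).trans ?_
        rw [norm_expNegI_apply hsB]; linarith
      · refine (norm_expNegI_apply_sub_le hsB y).trans ?_
        rw [smul_apply, norm_smul, Real.norm_eq_abs, abs_of_nonneg hs.1]
        exact mul_le_of_le_one_left (norm_nonneg _) hs.2.le)
  refine le_trans (le_of_eq ?_) h
  congr 1
  simp [expNegI]
  abel

end BoundedGroup

/-! ### Symmetric operators given by their graphs -/

section Graph

variable {E : Type*} [NormedAddCommGroup E] [InnerProductSpace ℂ E]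

local notation "⟪" x ", " y "⟫" => inner ℂ x y

/-- The operator with graph `S` is symmetric. -/
def IsSymmetricGraph (S : Submodule ℂ (E × E)) : Prop :=
  ∀ p ∈ S, ∀ q ∈ S, ⟪p.2, q.1⟫ = ⟪p.1, q.2⟫

theorem IsSymmetricGraph.closure {S : Submodule ℂ (E × E)} (hS : IsSymmetricGraph S) :
    IsSymmetricGraph S.topologicalClosure := by
  have h1 : ∀ p ∈ S, ∀ q ∈ S.topologicalClosure, ⟪p.2, q.1⟫ = ⟪p.1, q.2⟫ := by
    intro p hp q hq
    have hc : IsClosed {q : E × E | ⟪p.2, q.1⟫ = ⟪p.1, q.2⟫} :=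
      isClosed_eq (by fun_prop) (by fun_prop)
    exact closure_minimal (fun q hq => hS p hp q hq) hc hq
  intro p hp q hq
  have hc : IsClosed {p : E × E | ⟪p.2, q.1⟫ = ⟪p.1, q.2⟫} :=
    isClosed_eq (by fun_prop) (by fun_prop)
  exact closure_minimal (fun p hp => h1 p hp q hq) hc hp

/-- Symmetry makes `⟪x, Ax⟫` real, so the cross term is the real part of an imaginary number. Both
lower bounds on `A + il` below come from this identity. -/
theorem IsSymmetricGraph.norm_sq_add {S : Submodule ℂ (E × E)} (hS : IsSymmetricGraph S)
    {p : E × E} (hp : p ∈ S) (l : ℝ) :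
    ‖p.2 + (Complex.I * l) • p.1‖ ^ 2 = ‖p.2‖ ^ 2 + l ^ 2 * ‖p.1‖ ^ 2 := by
  have h := hS p hp p hp
  have h2 : (⟪p.1, p.2⟫).im = 0 := by
    have h3 := inner_conj_symm (𝕜 := ℂ) p.1 p.2
    rw [h] at h3
    exact Complex.conj_eq_iff_im.1 h3
  rw [@norm_add_sq ℂ, inner_smul_right, h, norm_smul]
  simp [h2, mul_pow]

theorem IsSymmetricGraph.mul_norm_fst_le {S : Submodule ℂ (E × E)} (hS : IsSymmetricGraph S)
    {p : E × E} (hp : p ∈ S) (l : ℝ) : |l| * ‖p.1‖ ≤ ‖p.2 + (Complex.I * l) • p.1‖ := by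
  refine abs_le_of_sq_le_sq' ?_ (norm_nonneg _) |>.2
  rw [hS.norm_sq_add hp, mul_pow, sq_abs]
  nlinarith [sq_nonneg ‖p.2‖]

theorem IsSymmetricGraph.norm_snd_le {S : Submodule ℂ (E × E)} (hS : IsSymmetricGraph S)
    {p : E × E} (hp : p ∈ S) (l : ℝ) : ‖p.2‖ ≤ ‖p.2 + (Complex.I * l) • p.1‖ := by
  refine abs_le_of_sq_le_sq' ?_ (norm_nonneg _) |>.2
  rw [hS.norm_sq_add hp]
  nlinarith [mul_nonneg (sq_nonneg l) (sq_nonneg ‖p.1‖)]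

variable [CompleteSpace E]

/-- If the range of `A + il` is dense, that of its closure is the whole space. -/
theorem IsSymmetricGraph.exists_mem_closure {S : Submodule ℂ (E × E)} (hS : IsSymmetricGraph S)
    {l : ℝ} (hl : l ≠ 0)
    (hd : Dense {z : E | ∃ p ∈ S, p.2 + (Complex.I * l) • p.1 = z}) (z : E) :
    ∃ p ∈ S.topologicalClosure, p.2 + (Complex.I * l) • p.1 = z := by
  obtain ⟨w, hw, hwz⟩ := mem_closure_iff_seq_limit.1 (hd z)
  choose p hpS hpw using hw
  have hlp : 0 < |l| := abs_pos.2 hl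
  have hsub : ∀ m n, w m - w n = (p m - p n).2 + (Complex.I * l) • (p m - p n).1 := by
    intro m n
    rw [← hpw, ← hpw]
    simp only [Prod.snd_sub, Prod.fst_sub, smul_sub]
    abel
  have hcw := hwz.cauchySeq
  -- The lower bounds on `A + il` control both components of `p m - p n` by `w m - w n`.
  have hcp : CauchySeq p := by
    rw [Metric.cauchySeq_iff'] at hcw ⊢
    intro ε hε
    obtain ⟨N, hN⟩ := hcw (min ε (|l| * ε)) (by positivity)
    refine ⟨N, fun n hn => ?_⟩
    have h := hN n hn
    have hm := S.sub_mem (hpS n) (hpS N)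
    rw [dist_eq_norm, hsub] at h
    rw [dist_eq_norm, Prod.norm_def, max_lt_iff]
    constructor
    · have := (hS.mul_norm_fst_le hm l).trans_lt (h.trans_le (min_le_right _ _))
      exact lt_of_mul_lt_mul_left this hlp.le
    · exact (hS.norm_snd_le hm l).trans_lt (h.trans_le (min_le_left _ _))
  obtain ⟨q, hq⟩ := cauchySeq_tendsto_of_complete hcp
  refine ⟨q, ?_, ?_⟩
  · exact mem_closure_of_tendsto hq (Eventually.of_forall hpS)
  · have h1 : Tendsto (fun n => (p n).2 + (Complex.I * l) • (p n).1) atTop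
        (𝓝 (q.2 + (Complex.I * l) • q.1)) := by
      have : Continuous fun q : E × E => q.2 + (Complex.I * (l : ℂ)) • q.1 := by fun_prop
      exact (this.tendsto q).comp hq
    simp only [hpw] at h1
    exact tendsto_nhds_unique h1 hwz

end Graph

/-! ### Stone's theorem: the unitary group of a self-adjoint operator -/

section Stone

variable {E : Type*} [NormedAddCommGroup E] [InnerProductSpace ℂ E]

local notation "⟪" x ", " y "⟫" => inner ℂ x y

/-- `A + il` is onto, where `A` is the operator with graph `T`. -/
def FullRange (T : Submodule ℂ (E × E)) (l : ℝ) : Prop :=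
  ∀ z : E, ∃ p ∈ T, p.2 + (Complex.I * l) • p.1 = z

variable {T : Submodule ℂ (E × E)}

theorem IsSymmetricGraph.eq_of_add_eq (hT : IsSymmetricGraph T) {l : ℝ} (hl : l ≠ 0)
    {p q : E × E} (hp : p ∈ T) (hq : q ∈ T)
    (h : p.2 + (Complex.I * l) • p.1 = q.2 + (Complex.I * l) • q.1) : p = q := by
  have h0 : (p - q).2 + (Complex.I * l) • (p - q).1 = 0 := by
    simp only [Prod.snd_sub, Prod.fst_sub, smul_sub]
    rw [sub_add_sub_comm, h, sub_self]
  have hm := T.sub_mem hp hq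
  have h1 := hT.mul_norm_fst_le hm l
  have h2 := hT.norm_snd_le hm l
  rw [h0, norm_zero] at h1 h2
  have hlp : 0 < |l| := abs_pos.2 hl
  have h3 : ‖(p - q).1‖ ≤ 0 := by
    by_contra hc
    push Not at hc
    have := mul_pos hlp hc
    linarith
  rw [norm_le_zero_iff] at h2 h3
  exact sub_eq_zero.1 (Prod.ext h3 h2)

/-- The resolvent `(A + il)⁻¹`. -/
def resolventOp (hT : IsSymmetricGraph T) {l : ℝ} (hl : l ≠ 0) (hr : FullRange T l) :
    E →L[ℂ] E :=
  LinearMap.mkContinuous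
    { toFun := fun z => (hr z).choose.1
      map_add' := fun z w => by
        have hz := (hr z).choose_spec
        have hw := (hr w).choose_spec
        have hzw := (hr (z + w)).choose_spec
        rw [← Prod.fst_add]
        congr 1
        refine hT.eq_of_add_eq hl hzw.1 (T.add_mem hz.1 hw.1) ?_
        rw [hzw.2, Prod.fst_add, Prod.snd_add, smul_add, add_add_add_comm, hz.2, hw.2]
      map_smul' := fun c z => by
        have hz := (hr z).choose_spec
        have hzw := (hr (c • z)).choose_spec
        rw [RingHom.id_apply, ← Prod.smul_fst]
        congr 1
        refine hT.eq_of_add_eq hl hzw.1 (T.smul_mem c hz.1) ?_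
        rw [hzw.2, Prod.smul_fst, Prod.smul_snd, smul_comm, ← smul_add, hz.2] }
    |l|⁻¹ (fun z => by
      have hz := (hr z).choose_spec
      have h := hT.mul_norm_fst_le hz.1 l
      rw [hz.2] at h
      rw [inv_mul_eq_div, le_div_iff₀' (abs_pos.2 hl)]
      exact h)

theorem resolventOp_apply (hT : IsSymmetricGraph T) {l : ℝ} (hl : l ≠ 0) (hr : FullRange T l)
    {p : E × E} (hp : p ∈ T) :
    resolventOp hT hl hr (p.2 + (Complex.I * l) • p.1) = p.1 := by
  have hz := (hr (p.2 + (Complex.I * l) • p.1)).choose_spec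
  have := hT.eq_of_add_eq hl hz.1 hp hz.2
  exact congrArg Prod.fst this

theorem norm_resolventOp_apply_le (hT : IsSymmetricGraph T) {l : ℝ} (hl : l ≠ 0)
    (hr : FullRange T l) (z : E) : |l| * ‖resolventOp hT hl hr z‖ ≤ ‖z‖ := by
  obtain ⟨p, hp, rfl⟩ := hr z
  rw [resolventOp_apply hT hl hr hp]
  exact hT.mul_norm_fst_le hp l

/-- On the domain `A + il = (A + im) + i(l - m)`; apply the resolvent at `m`. -/
theorem resolventOp_identity (hT : IsSymmetricGraph T) {l m : ℝ} (hl : l ≠ 0) (hm : m ≠ 0)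
    (hrl : FullRange T l) (hrm : FullRange T m) (z : E) :
    resolventOp hT hm hrm z = resolventOp hT hl hrl z +
      (Complex.I * (l - m)) • resolventOp hT hm hrm (resolventOp hT hl hrl z) := by
  obtain ⟨p, hp, rfl⟩ := hrl z
  rw [resolventOp_apply hT hl hrl hp]
  have e : p.2 + (Complex.I * l) • p.1 =
      (p.2 + (Complex.I * m) • p.1) + (Complex.I * (l - m)) • p.1 := by
    rw [mul_sub, sub_smul]
    abel
  rw [e, map_add, resolventOp_apply hT hm hrm hp, map_smul]

/-- Compare the resolvent identity with the one obtained by exchanging `l` and `m`: the factor `i(l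
- m)` multiplies the commutator and can be cancelled. -/
theorem commute_resolventOp (hT : IsSymmetricGraph T) {l m : ℝ} (hl : l ≠ 0) (hm : m ≠ 0)
    (hrl : FullRange T l) (hrm : FullRange T m) :
    Commute (resolventOp hT hl hrl) (resolventOp hT hm hrm) := by
  by_cases hlm : l = m
  · subst hlm
    exact Commute.refl _
  ext z
  have h1 := resolventOp_identity hT hl hm hrl hrm z
  have h2 := resolventOp_identity hT hm hl hrm hrl z
  have h3 : (Complex.I * ((l : ℂ) - m)) • (resolventOp hT hm hrm (resolventOp hT hl hrl z) -
      resolventOp hT hl hrl (resolventOp hT hm hrm z)) = 0 := by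
    have e : (Complex.I * ((m : ℂ) - l)) = -(Complex.I * ((l : ℂ) - m)) := by ring
    rw [e, neg_smul] at h2
    rw [smul_sub, ← sub_eq_iff_eq_add'.2 h1]
    generalize (Complex.I * ((l : ℂ) - m)) • resolventOp hT hl hrl (resolventOp hT hm hrm z) = c at *
    rw [h2]
    abel
  have hc : (Complex.I * ((l : ℂ) - m)) ≠ 0 := by
    refine mul_ne_zero Complex.I_ne_zero (sub_ne_zero.2 ?_)
    exact_mod_cast hlm
  exact (sub_eq_zero.1 ((smul_eq_zero.1 h3).resolve_left hc)).symm

theorem inner_resolventOp (hT : IsSymmetricGraph T) {l : ℝ} (hl : l ≠ 0)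
    (hrl : FullRange T l) (hl' : -l ≠ 0) (hrl' : FullRange T (-l)) (z w : E) :
    ⟪resolventOp hT hl hrl z, w⟫ = ⟪z, resolventOp hT hl' hrl' w⟫ := by
  obtain ⟨p, hp, rfl⟩ := hrl z
  obtain ⟨q, hq, rfl⟩ := hrl' w
  rw [resolventOp_apply hT hl hrl hp, resolventOp_apply hT hl' hrl' hq]
  rw [inner_add_right, inner_add_left, inner_smul_left, inner_smul_right, hT p hp q hq]
  simp

/-- The bounded self-adjoint approximation `l² A (A² + l²)⁻¹` of the operator with graph `T`. -/
def yosida (hT : IsSymmetricGraph T) {l : ℝ} (hl : l ≠ 0) (hr : FullRange T l)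
    (hr' : FullRange T (-l)) : E →L[ℂ] E :=
  -- The sum of the two resolvents is `2A(A² + l²)⁻¹`, whence the factor `l²/2`.
  ((l : ℂ) ^ 2 / 2) • (resolventOp hT hl hr + resolventOp hT (neg_ne_zero.2 hl) hr')

theorem isSelfAdjoint_yosida [CompleteSpace E] (hT : IsSymmetricGraph T) {l : ℝ} (hl : l ≠ 0) (hr : FullRange T l)
    (hr' : FullRange T (-l)) : IsSelfAdjoint (yosida hT hl hr hr') := by
  rw [ContinuousLinearMap.isSelfAdjoint_iff_isSymmetric]
  intro z w
  have hr'' : FullRange T (-(-l)) := by rwa [neg_neg]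
  have h1 := inner_resolventOp hT hl hr (neg_ne_zero.2 hl) hr' z w
  have h2 := inner_resolventOp hT hl hr (neg_ne_zero.2 hl) hr' w z
  have h3 : ⟪resolventOp hT (neg_ne_zero.2 hl) hr' z, w⟫ = ⟪z, resolventOp hT hl hr w⟫ := by
    rw [← inner_conj_symm, ← h2, inner_conj_symm]
  simp only [yosida, ContinuousLinearMap.coe_coe, smul_apply, add_apply, inner_smul_left,
    inner_smul_right, inner_add_left, inner_add_right, h1, h3]
  have : (starRingEnd ℂ) ((l : ℂ) ^ 2 / 2) = (l : ℂ) ^ 2 / 2 := by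
    rw [← Complex.ofReal_pow, show ((2 : ℂ)) = ((2 : ℝ) : ℂ) by simp, ← Complex.ofReal_div,
      Complex.conj_ofReal]
  rw [this, add_comm]

theorem commute_yosida (hT : IsSymmetricGraph T) {l m : ℝ} (hl : l ≠ 0) (hm : m ≠ 0)
    (hr : FullRange T l) (hr' : FullRange T (-l)) (hs : FullRange T m) (hs' : FullRange T (-m)) :
    Commute (yosida hT hl hr hr') (yosida hT hm hs hs') := by
  refine (Commute.smul_left (Commute.smul_right ?_ _) _)
  refine Commute.add_left (Commute.add_right ?_ ?_) (Commute.add_right ?_ ?_) <;>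
  exact commute_resolventOp _ _ _ _ _

/-- From `(A + il)⁻¹Ax = x - il(A + il)⁻¹x` for `±l`, the terms `±il x` cancel in the sum. The right
side is a mean of two approximations of `Ax`, which is what makes the limit visible. -/
theorem yosida_apply (hT : IsSymmetricGraph T) {l : ℝ} (hl : l ≠ 0) (hr : FullRange T l)
    (hr' : FullRange T (-l)) {p : E × E} (hp : p ∈ T) :
    yosida hT hl hr hr' p.1 = (1 / 2 : ℂ) •
      ((Complex.I * l) • resolventOp hT hl hr p.2 +
        (Complex.I * (-l : ℝ)) • resolventOp hT (neg_ne_zero.2 hl) hr' p.2) := by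
  have key : ∀ (m : ℝ) (hm : m ≠ 0) (hs : FullRange T m),
      resolventOp hT hm hs p.2 = p.1 - (Complex.I * m) • resolventOp hT hm hs p.1 := by
    intro m hm hs
    have h := resolventOp_apply hT hm hs hp
    rw [map_add, map_smul] at h
    exact eq_sub_of_add_eq h
  rw [key l hl hr, key (-l) (neg_ne_zero.2 hl) hr', yosida]
  simp only [smul_apply, add_apply, smul_add, smul_sub, smul_smul, Complex.ofReal_neg]
  match_scalars
  · ring_nf
    simp
    ring
  · ring_nf
    simp
    ring
  · ring

end Stone

/-! ### Convergence of the bounded approximations and of their unitary groups. -/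

section StoneLimit

variable {E : Type*} [NormedAddCommGroup E] [InnerProductSpace ℂ E]
variable {T : Submodule ℂ (E × E)}

/-- The operators `il(A + il)⁻¹` are contractions, and on the domain they differ from the identity
by `(A + il)⁻¹Ax`, of norm at most `‖Ax‖/|l|`. Density of the domain does the rest. -/
theorem tendsto_mul_resolventOp (hT : IsSymmetricGraph T)
    (hd : Dense {x : E | ∃ y, (x, y) ∈ T}) {l : ℕ → ℝ} (hl : ∀ n, l n ≠ 0)
    (hr : ∀ n, FullRange T (l n)) (hlim : Tendsto (fun n => |l n|) atTop atTop) (y : E) :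
    Tendsto (fun n => (Complex.I * l n) • resolventOp hT (hl n) (hr n) y) atTop (𝓝 y) := by
  rw [Metric.tendsto_atTop]
  intro ε hε
  obtain ⟨x, ⟨w, hxw⟩, hxy⟩ := Metric.mem_closure_iff.1 (hd y) (ε / 3) (by positivity)
  obtain ⟨N, hN⟩ := (hlim.eventually_gt_atTop (3 * ‖w‖ / ε)).exists_forall_of_atTop
  refine ⟨N, fun n hn => ?_⟩
  have hln : 0 < |l n| := abs_pos.2 (hl n)
  have h1 : (Complex.I * l n) • resolventOp hT (hl n) (hr n) x =
      x - resolventOp hT (hl n) (hr n) w := by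
    have h := resolventOp_apply hT (hl n) (hr n) hxw
    rw [map_add, map_smul] at h
    exact eq_sub_of_add_eq' h
  have hnorm : ∀ z, ‖(Complex.I * l n) • resolventOp hT (hl n) (hr n) z‖ ≤ ‖z‖ := by
    intro z
    rw [norm_smul]
    simpa using norm_resolventOp_apply_le hT (hl n) (hr n) z
  have h2 : ‖resolventOp hT (hl n) (hr n) w‖ < ε / 3 := by
    have h3 := norm_resolventOp_apply_le hT (hl n) (hr n) w
    have h4 := hN n hn
    rw [div_lt_iff₀ hε] at h4
    by_contra hc
    push Not at hc
    nlinarith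
  rw [dist_eq_norm]
  have e : (Complex.I * l n) • resolventOp hT (hl n) (hr n) y - y =
      (Complex.I * l n) • resolventOp hT (hl n) (hr n) (y - x) + (x - y)
        - resolventOp hT (hl n) (hr n) w := by
    rw [map_sub, smul_sub, h1]
    abel
  rw [e]
  rw [dist_eq_norm] at hxy
  calc _ ≤ ‖(Complex.I * l n) • resolventOp hT (hl n) (hr n) (y - x)‖ + ‖x - y‖
        + ‖resolventOp hT (hl n) (hr n) w‖ :=
        (norm_sub_le _ _).trans (add_le_add_left (norm_add_le _ _) _)
    _ ≤ ‖y - x‖ + ‖x - y‖ + ‖resolventOp hT (hl n) (hr n) w‖ := by gcongr; exact hnorm _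
    _ < ε := by rw [norm_sub_rev x y]; linarith

theorem tendsto_yosida_apply (hT : IsSymmetricGraph T)
    (hd : Dense {x : E | ∃ y, (x, y) ∈ T}) {l : ℕ → ℝ} (hl : ∀ n, l n ≠ 0)
    (hr : ∀ n, FullRange T (l n)) (hr' : ∀ n, FullRange T (-(l n)))
    (hlim : Tendsto (fun n => |l n|) atTop atTop) {p : E × E} (hp : p ∈ T) :
    Tendsto (fun n => yosida hT (hl n) (hr n) (hr' n) p.1) atTop (𝓝 p.2) := by
  have h1 := tendsto_mul_resolventOp hT hd hl hr hlim p.2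
  have h2 := tendsto_mul_resolventOp hT hd (fun n => neg_ne_zero.2 (hl n)) hr'
    (by simpa using hlim) p.2
  have h3 := (h1.add h2).const_smul (1 / 2 : ℂ)
  have e : (1 / 2 : ℂ) • (p.2 + p.2) = p.2 := by
    rw [← two_smul ℂ p.2, smul_smul]; norm_num
  rw [e] at h3
  exact h3.congr fun n => (yosida_apply hT (hl n) (hr n) (hr' n) hp).symm

variable [CompleteSpace E]

/-- Bounded self-adjoint commuting operators `B n` converging strongly on the domain of `A`
generate unitary groups that converge strongly, to the group generated by `A`. -/
theorem exists_isPropagator_of_tendsto {B : ℕ → E →L[ℂ] E} (hB : ∀ n, IsSelfAdjoint (B n))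
    (hc : ∀ m n, Commute (B m) (B n))
    (hTc : IsClosed (T : Set (E × E))) (hd : Dense {x : E | ∃ y, (x, y) ∈ T})
    {l : ℝ} (hl : l ≠ 0) (hr : FullRange T l)
    (hlim : ∀ p ∈ T, Tendsto (fun n => B n p.1) atTop (𝓝 p.2)) :
    ∃ U, IsPropagator (T : Set (E × E)) U := by
  have hsa : ∀ n (t : ℝ), IsSelfAdjoint (t • B n) := fun n t => IsSelfAdjoint.real_smul' (hB n) t
  have hco : ∀ m n (t : ℝ), Commute (t • B m) (t • B n) := fun m n t =>
    ((hc m n).smul_left t).smul_right t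
  have hdiff : ∀ m n (t : ℝ) x, ‖expNegI (t • B m) x - expNegI (t • B n) x‖ ≤
      |t| * ‖B m x - B n x‖ := by
    intro m n t x
    have h := norm_expNegI_sub_le (hsa m t) (hsa n t) (hco m n t) x
    rwa [smul_apply, smul_apply, ← smul_sub, norm_smul, Real.norm_eq_abs] at h
  -- On the domain this follows from `hdiff`; the operators are isometries, so an approximation by
  -- vectors of the domain costs a fixed error.
  have hcauchy : ∀ (t : ℝ) x, CauchySeq fun n => expNegI (t • B n) x := by
    intro t x
    rw [Metric.cauchySeq_iff']
    intro ε hε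
    obtain ⟨x', ⟨y', hp⟩, hx'⟩ := Metric.mem_closure_iff.1 (hd x) (ε / 4) (by positivity)
    obtain ⟨N, hN⟩ := Metric.cauchySeq_iff'.1 (hlim _ hp).cauchySeq (ε / (4 * (|t| + 1)))
      (by positivity)
    refine ⟨N, fun n hn => ?_⟩
    have h1 := hN n hn
    rw [dist_eq_norm] at h1 hx' ⊢
    have h2 := hdiff n N t x'
    have h3 : |t| * ‖B n x' - B N x'‖ ≤ ε / 4 := by
      rw [lt_div_iff₀ (by positivity)] at h1
      simp only at h1
      nlinarith [abs_nonneg t, norm_nonneg (B n x' - B N x')]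
    have e : expNegI (t • B n) x - expNegI (t • B N) x =
        expNegI (t • B n) (x - x') + (expNegI (t • B n) x' - expNegI (t • B N) x')
          - expNegI (t • B N) (x - x') := by
      rw [map_sub, map_sub]; abel
    rw [e]
    have h4 := norm_expNegI_apply (hsa n t) (x - x')
    have h5 := norm_expNegI_apply (hsa N t) (x - x')
    have h6 := norm_sub_le (expNegI (t • B n) (x - x') +
      (expNegI (t • B n) x' - expNegI (t • B N) x')) (expNegI (t • B N) (x - x'))
    have h7 := norm_add_le (expNegI (t • B n) (x - x'))
      (expNegI (t • B n) x' - expNegI (t • B N) x')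
    linarith
  choose V hV using fun t x => cauchySeq_tendsto_of_complete (hcauchy t x)
  have hVadd : ∀ t x y, V t (x + y) = V t x + V t y := fun t x y =>
    tendsto_nhds_unique (hV t (x + y)) (by simpa using (hV t x).add (hV t y))
  have hVsmul : ∀ t (c : ℂ) x, V t (c • x) = c • V t x := fun t c x =>
    tendsto_nhds_unique (hV t (c • x)) (by simpa using (hV t x).const_smul c)
  have hVnorm : ∀ t x, ‖V t x‖ = ‖x‖ := fun t x =>
    tendsto_nhds_unique (hV t x).norm (by simp [norm_expNegI_apply (hsa _ t)])
  have hVzero : ∀ x, V 0 x = x := fun x =>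
    tendsto_nhds_unique (hV 0 x) (by simp [expNegI])
  have hVcomp : ∀ s t x, V (s + t) x = V s (V t x) := by
    intro s t x
    refine tendsto_nhds_unique (hV (s + t) x) ?_
    have h1 := hV s (V t x)
    have h2 : Tendsto (fun n => expNegI (s • B n) (expNegI (t • B n) x - V t x)) atTop (𝓝 0) := by
      rw [tendsto_zero_iff_norm_tendsto_zero]
      simp only [norm_expNegI_apply (hsa _ s)]
      rw [← tendsto_zero_iff_norm_tendsto_zero]
      simpa using (hV t x).sub_const (V t x)
    have h3 := h1.add h2
    rw [add_zero] at h3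
    refine h3.congr fun n => ?_
    rw [add_smul, expNegI_add (((Commute.refl (B n)).smul_left s).smul_right t), ← map_add]
    simp
  let U : ℝ → (E ≃ₗᵢ[ℂ] E) := fun t =>
    { toFun := V t
      invFun := V (-t)
      map_add' := hVadd t
      map_smul' := hVsmul t
      left_inv := fun x => by rw [← hVcomp, neg_add_cancel, hVzero]
      right_inv := fun x => by rw [← hVcomp, add_neg_cancel, hVzero]
      norm_map' := hVnorm t }
  have hUV : ∀ t x, U t x = V t x := fun t x => rfl
  have hVsub : ∀ t x y, V t (x - y) = V t x - V t y := fun t x y => by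
    rw [← hUV, ← hUV, ← hUV, map_sub]
  -- The Taylor bound for `B n` passes to the limit. The vector `q.1` will be an element of the
  -- domain close to `p.2 = Ax`, which makes the right side `o(t)`.
  have hest : ∀ p ∈ T, ∀ q ∈ T, ∀ t : ℝ,
      ‖V t p.1 - p.1 + t • (Complex.I • p.2)‖ ≤ |t| * (2 * ‖p.2 - q.1‖ + |t| * ‖q.2‖) := by
    intro p hp q hq t
    have h1 : Tendsto (fun n => ‖expNegI (t • B n) p.1 - p.1 + t • (Complex.I • B n p.1)‖) atTop
        (𝓝 ‖V t p.1 - p.1 + t • (Complex.I • p.2)‖) :=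
      (((hV t p.1).sub_const p.1).add (((hlim p hp).const_smul _).const_smul _)).norm
    have h2 : Tendsto (fun n => |t| * (2 * ‖B n p.1 - q.1‖ + |t| * ‖B n q.1‖)) atTop
        (𝓝 (|t| * (2 * ‖p.2 - q.1‖ + |t| * ‖q.2‖))) :=
      ((((hlim p hp).sub_const q.1).norm.const_mul 2).add ((hlim q hq).norm.const_mul _)).const_mul _
    refine le_of_tendsto_of_tendsto' h1 h2 fun n => ?_
    have h := norm_expNegI_apply_sub_add_le (hsa n t) p.1 (t • q.1)
    rw [smul_apply, smul_apply, ← smul_sub, (B n).map_smul_of_tower, smul_smul, norm_smul,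
      norm_smul, smul_comm] at h
    simp only [norm_mul, Real.norm_eq_abs] at h
    linarith
  have hderiv : ∀ p ∈ T, HasDerivAt (fun t => U t p.1) (-(Complex.I • p.2)) 0 := by
    intro p hp
    rw [hasDerivAt_iff_isLittleO, Asymptotics.isLittleO_iff]
    intro c hc0
    obtain ⟨x', ⟨y', hq⟩, hx'⟩ := Metric.mem_closure_iff.1 (hd p.2) (c / 4) (by positivity)
    have hev : ∀ᶠ t : ℝ in 𝓝 0, |t| * ‖y'‖ < c / 2 := by
      have : Tendsto (fun t : ℝ => |t| * ‖y'‖) (𝓝 0) (𝓝 (|0| * ‖y'‖)) := by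
        apply Continuous.tendsto; fun_prop
      rw [abs_zero, zero_mul] at this
      exact this.eventually_lt_const (by positivity)
    filter_upwards [hev] with t ht
    have h := hest p hp _ hq t
    rw [dist_eq_norm] at hx'
    simp only [hUV, hVzero, sub_zero, smul_neg, sub_neg_eq_add, Real.norm_eq_abs]
    simp only at h
    calc _ ≤ |t| * (2 * ‖p.2 - x'‖ + |t| * ‖y'‖) := h
      _ ≤ |t| * c := by gcongr; linarith
      _ = c * |t| := mul_comm _ _
  have hcont0 : ∀ x, Tendsto (fun t => V t x) (𝓝 0) (𝓝 x) := by
    intro x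
    rw [Metric.tendsto_nhds]
    intro ε hε
    obtain ⟨x', ⟨y', hp⟩, hx'⟩ := Metric.mem_closure_iff.1 (hd x) (ε / 3) (by positivity)
    have hev := Metric.tendsto_nhds.1 (hderiv _ hp).continuousAt (ε / 3) (by positivity)
    filter_upwards [hev] with t ht
    simp only [hUV, hVzero] at ht
    rw [dist_eq_norm] at *
    have e : V t x - x = V t (x - x') + (V t x' - x') - (x - x') := by rw [hVsub]; abel
    rw [e]
    have h6 := norm_sub_le (V t (x - x') + (V t x' - x')) (x - x')
    have h7 := norm_add_le (V t (x - x')) (V t x' - x')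
    rw [hVnorm] at h7
    linarith
  refine ⟨U, fun x => hVzero x, hVcomp, ?_, ?_⟩
  · intro x
    rw [continuous_iff_continuousAt]
    intro s
    have h1 : Tendsto (fun t => V s (V (t - s) x)) (𝓝 s) (𝓝 (V s x)) := by
      have h2 : Tendsto (fun t : ℝ => t - s) (𝓝 s) (𝓝 0) := by
        have : Tendsto (fun t : ℝ => t - s) (𝓝 s) (𝓝 (s - s)) := by
          apply Continuous.tendsto; fun_prop
        rwa [sub_self] at this
      exact ((U s).continuous.tendsto x).comp ((hcont0 x).comp h2)
    refine h1.congr fun t => ?_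
    rw [← hVcomp]
    simp [hUV]
  · intro x y
    rw [hTc.closure_eq]
    refine ⟨fun h => hderiv _ h, fun h => ?_⟩
    -- The generator is symmetric, so that it has no proper symmetric extension.
    obtain ⟨q, hq, hqe⟩ := hr (y + (Complex.I * l) • x)
    have h1 : HasDerivAt (fun t => U t (x - q.1)) (-(Complex.I • (y - q.2))) 0 := by
      have := h.sub (hderiv q hq)
      refine (this.congr_deriv ?_).congr_of_eventuallyEq ?_
      · rw [smul_sub]; abel
      · exact Eventually.of_forall fun t => by simp [map_sub]
    have h2 : y - q.2 = -((Complex.I * l) • (x - q.1)) := by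
      rw [eq_neg_iff_add_eq_zero, smul_sub, ← sub_eq_zero.2 hqe.symm]
      abel
    rw [h2] at h1
    -- The derivative of `U t z` at `0` is `-l z`, so that of `‖U t z‖²` is `-2l‖z‖²`. The norm
    -- being constant, `z = 0`.
    set z := x - q.1 with hz
    have h6 : -(Complex.I • -((Complex.I * (l : ℂ)) • z)) = (-l : ℂ) • z := by
      rw [smul_neg, neg_neg, smul_smul, ← mul_assoc, Complex.I_mul_I]; simp
    rw [h6] at h1
    have h3 := h1.inner ℂ h1
    have h4 : HasDerivAt (fun t => inner ℂ (U t z) (U t z)) 0 0 := by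
      simp only [LinearIsometryEquiv.inner_map_map]
      exact hasDerivAt_const _ _
    have h5 := h3.unique h4
    have hz0 : z = 0 := by
      rw [hUV, hVzero, inner_smul_left, inner_smul_right] at h5
      simp only [map_neg, Complex.conj_ofReal, ← add_mul, mul_eq_zero] at h5
      rcases h5 with h5 | h5
      · refine absurd h5 ?_
        rw [← neg_add, neg_eq_zero, ← two_mul]
        simp [hl]
      · exact inner_self_eq_zero.1 h5
    have hxq : x = q.1 := sub_eq_zero.1 hz0
    have hyq : y = q.2 := by
      rw [hz0, smul_zero, neg_zero] at h2
      exact sub_eq_zero.1 h2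
    rw [hxq, hyq]
    exact hq

/-- **Stone's theorem**: a symmetric operator with dense domain, such that the range of `A + il`
is dense for all real `l` large in absolute value, is the restriction to a core of the generator
of a unitary group. -/
theorem exists_isPropagator {S : Submodule ℂ (E × E)} (hS : IsSymmetricGraph S)
    (hd : Dense {x : E | ∃ y, (x, y) ∈ S}) (Λ : ℝ)
    (hr : ∀ l : ℝ, Λ ≤ |l| → Dense {z : E | ∃ p ∈ S, p.2 + (Complex.I * l) • p.1 = z}) :
    ∃ U, IsPropagator (S : Set (E × E)) U := by
  have hTd : Dense {x : E | ∃ y, (x, y) ∈ S.topologicalClosure} :=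
    hd.mono (by rintro x ⟨y, hy⟩; exact ⟨y, S.le_topologicalClosure hy⟩)
  -- Positive, tending to infinity, and such that `l n` and `-(l n)` both satisfy the range
  -- hypothesis, as the approximation uses the two resolvents.
  let l : ℕ → ℝ := fun n => |Λ| + 1 + n
  have hlpos : ∀ n, 0 < l n := fun n => by positivity
  have hlΛ : ∀ n, Λ ≤ |l n| := fun n => by
    rw [abs_of_pos (hlpos n)]
    have := le_abs_self Λ
    have h2 : (0 : ℝ) ≤ n := n.cast_nonneg
    simp only [l]
    linarith
  have hfr : ∀ n, FullRange S.topologicalClosure (l n) := fun n =>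
    hS.exists_mem_closure (hlpos n).ne' (hr _ (hlΛ n))
  have hfr' : ∀ n, FullRange S.topologicalClosure (-(l n)) := fun n =>
    hS.exists_mem_closure (neg_ne_zero.2 (hlpos n).ne') (hr _ (by rw [abs_neg]; exact hlΛ n))
  have hlim : Tendsto (fun n => |l n|) atTop atTop := by
    refine tendsto_atTop_mono (fun n => ?_) tendsto_natCast_atTop_atTop
    rw [abs_of_pos (hlpos n)]
    have := abs_nonneg Λ
    simp only [l]
    linarith
  obtain ⟨U, hU⟩ := exists_isPropagator_of_tendsto
    (B := fun n => yosida hS.closure (hlpos n).ne' (hfr n) (hfr' n))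
    (fun n => isSelfAdjoint_yosida _ _ _ _) (fun m n => commute_yosida _ _ _ _ _ _ _)
    S.isClosed_topologicalClosure hTd (hlpos 0).ne' (hfr 0)
    (fun p hp => tendsto_yosida_apply hS.closure hTd _ _ _ hlim hp)
  refine ⟨U, hU.map_zero, hU.map_add, hU.continuous, fun x y => ?_⟩
  have h := hU.generator x y
  rwa [S.isClosed_topologicalClosure.closure_eq, Submodule.topologicalClosure_coe] at h

end StoneLimit

/-! ### Small-time approximate reachability of vectors -/

section Reach

variable {E : Type*} [NormedAddCommGroup E] [InnerProductSpace ℂ E]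

theorem IsPropagator.hasDerivAt {G : Set (E × E)} {U : ℝ → (E ≃ₗᵢ[ℂ] E)} (hU : IsPropagator G U)
    {x y : E} (h : (x, y) ∈ closure G) (s : ℝ) :
    HasDerivAt (fun t => U t x) (U s (-(Complex.I • y))) s := by
  have h0 := (hU.generator x y).1 h
  have h1 : HasDerivAt (fun t => U (t - s) x) (-(Complex.I • y)) s := by
    have : HasDerivAt (fun t => U t x) (-(Complex.I • y)) (s - s) := by rwa [sub_self]
    exact this.comp_sub_const s s
  have h2 := ((U s).toContinuousLinearEquiv.toContinuousLinearMap.restrictScalars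
    ℝ).hasFDerivAt.comp_hasDerivAt s h1
  refine HasDerivAt.congr_of_eventuallyEq h2 (Eventually.of_forall fun t => ?_)
  simp [← hU.map_add]

/-- A product rule without norm differentiability of `U`. The increment of `g` is carried by
isometries, for which strong continuity is enough; only the term with `g s` frozen needs the domain
of the generator. -/
theorem IsPropagator.hasDerivAt_comp {G : Set (E × E)} {U : ℝ → (E ≃ₗᵢ[ℂ] E)}
    (hU : IsPropagator G U) {g : ℝ → E} {g' y : E} {a : ℝ → ℝ} {a' s : ℝ}
    (hg : HasDerivAt g g' s) (ha : HasDerivAt a a' s) (h : (g s, y) ∈ closure G) :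
    HasDerivAt (fun t => U (a t) (g t)) (U (a s) (g' - (a' : ℂ) • Complex.I • y)) s := by
  have h1 : HasDerivAt (fun t => U (a t) (g s)) (U (a s) (-((a' : ℂ) • Complex.I • y))) s := by
    refine (HasDerivAt.scomp s (hU.hasDerivAt h (a s)) ha).congr_deriv ?_
    rw [← Complex.coe_smul]
    simp only [map_neg, map_smul, smul_neg]
  have h2 : HasDerivAt (fun t => U (a t) (g t - g s)) (U (a s) g') s := by
    rw [hasDerivAt_iff_tendsto_slope] at hg ⊢
    have hc : Tendsto (fun t => U (a t) g') (𝓝[≠] s) (𝓝 (U (a s) g')) :=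
      (((hU.continuous g').tendsto (a s)).comp ha.continuousAt).mono_left nhdsWithin_le_nhds
    have hz : Tendsto (fun t => U (a t) (slope g s t - g')) (𝓝[≠] s) (𝓝 0) := by
      rw [tendsto_zero_iff_norm_tendsto_zero]
      simp only [LinearIsometryEquiv.norm_map]
      rw [← tendsto_zero_iff_norm_tendsto_zero]
      simpa using hg.sub_const g'
    have := hz.add hc
    rw [zero_add] at this
    refine this.congr fun t => ?_
    rw [← _root_.map_add, sub_add_cancel, slope_def_module, slope_def_module, sub_self, _root_.map_zero, sub_zero,
      ← Complex.coe_smul, ← Complex.coe_smul, map_smul]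
  refine (h2.add h1).congr_deriv ?_ |>.congr_of_eventuallyEq ?_
  · rw [← _root_.map_add, sub_eq_add_neg]
  · exact Eventually.of_forall fun t => by simp [map_sub]

/-- **Duhamel's estimate**: a curve that almost solves the equation is close to the solution. -/
theorem IsPropagator.norm_sub_le {G : Set (E × E)} {U : ℝ → (E ≃ₗᵢ[ℂ] E)}
    (hU : IsPropagator G U) {g g' y : ℝ → E} {τ C : ℝ}
    (hg : ∀ s ∈ Set.Icc (0 : ℝ) 1, HasDerivAt g (g' s) s)
    (hy : ∀ s ∈ Set.Icc (0 : ℝ) 1, (g s, y s) ∈ closure G)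
    (hC : ∀ s ∈ Set.Icc (0 : ℝ) 1, ‖g' s + (τ : ℂ) • Complex.I • y s‖ ≤ C) :
    ‖g 1 - U τ (g 0)‖ ≤ C := by
  -- This curve goes from `U τ (g 0)` to `g 1`, and its speed is the norm of the residual of `g` in
  -- the equation with time rescaled to `[0, 1]`.
  have hd : ∀ s ∈ Set.Icc (0 : ℝ) 1, HasDerivAt (fun t => U ((1 - t) * τ) (g t))
      (U ((1 - s) * τ) (g' s - ((-τ : ℝ) : ℂ) • Complex.I • y s)) s := by
    intro s hs
    refine hU.hasDerivAt_comp (a := fun t => (1 - t) * τ) (hg s hs) ?_ (hy s hs)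
    simpa using ((hasDerivAt_id s).const_sub 1).mul_const τ
  have h := norm_image_sub_le_of_norm_deriv_le_segment_01'
    (f := fun t => U ((1 - t) * τ) (g t)) (C := C)
    (fun s hs => (hd s hs).hasDerivWithinAt)
    (fun s hs => by
      have := hC s ⟨hs.1, hs.2.le⟩
      rw [LinearIsometryEquiv.norm_map]
      simpa using this)
  simpa [hU.map_zero] using h

variable {ι : Type*}

/-- The unitary operator `L` is the propagator over a time `T` of the system with some piecewise
constant control. -/
inductive Steers (G : (ι → ℝ) → Set (E × E)) : ℝ → (E ≃ₗᵢ[ℂ] E) → Prop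
  | refl : Steers G 0 (LinearIsometryEquiv.refl ℂ E)
  | step {T : ℝ} {L : E ≃ₗᵢ[ℂ] E} {c : ι → ℝ} {U : ℝ → (E ≃ₗᵢ[ℂ] E)} {t : ℝ} :
      Steers G T L → IsPropagator (G c) U → 0 < t → Steers G (T + t) (L.trans (U t))

variable {G : (ι → ℝ) → Set (E × E)}

theorem Steers.nonneg {T : ℝ} {L : E ≃ₗᵢ[ℂ] E} (h : Steers G T L) : 0 ≤ T := by
  induction h with
  | refl => exact le_rfl
  | step _ _ ht ih => linarith

theorem Steers.trans {T T' : ℝ} {L L' : E ≃ₗᵢ[ℂ] E} (h : Steers G T L) (h' : Steers G T' L') :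
    Steers G (T + T') (L.trans L') := by
  induction h' with
  | refl => simpa using h
  | step _ hU ht ih =>
    rw [← add_assoc]
    exact ih.step hU ht

theorem PWControl.time_le {T : ℝ} (u : PWControl ι T) {k : ℕ} (hk : k ≤ u.N) : u.time k ≤ T := by
  refine le_of_le_of_eq ?_ u.time_last
  induction hk using Nat.decreasingInduction with
  | self => exact le_rfl
  | of_succ j hj ih => exact (u.time_lt j hj).le.trans ih

theorem Steers.exists_isSolution {T : ℝ} {L : E ≃ₗᵢ[ℂ] E} (h : Steers G T L) (x : E) :
    ∃ (u : PWControl ι T) (ψ : ℝ → E), IsSolution G u x ψ ∧ ψ T = L x := by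
  induction h with
  | refl =>
    exact ⟨⟨0, fun _ => 0, fun _ _ => 0, rfl, rfl, fun k hk => absurd hk (Nat.not_lt_zero k)⟩,
      fun _ => x, ⟨rfl, fun k hk => absurd hk (Nat.not_lt_zero k)⟩, rfl⟩
  | @step T L c U t hL hU ht ih =>
    obtain ⟨u, ψ, ⟨hψ0, hψ⟩, hψT⟩ := ih
    have hT := hL.nonneg
    -- The new interval has index `u.N`: the old nodes are kept up to and including `u.N`, the old
    -- values only strictly before it.
    refine ⟨⟨u.N + 1, fun k => if k ≤ u.N then u.time k else T + t,
      fun k => if k < u.N then u.value k else c, ?_, ?_, ?_⟩,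
      fun s => if s ≤ T then ψ s else U (s - T) (ψ T), ⟨?_, ?_⟩, ?_⟩
    · simp [u.time_zero]
    · simp
    · intro k hk
      rcases (Nat.lt_succ_iff.1 hk).lt_or_eq with hk | hk
      · simp only [hk.le, Nat.succ_le_of_lt hk, if_true]
        exact u.time_lt k hk
      · subst hk
        simp [u.time_last, ht]
    · simp [hT, hψ0]
    · intro k hk
      rcases (Nat.lt_succ_iff.1 hk).lt_or_eq with hk | hk
      · obtain ⟨W, hW, hWψ⟩ := hψ k hk
        simp only [hk, hk.le, Nat.succ_le_of_lt hk, if_true]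
        refine ⟨W, hW, fun s hs => ?_⟩
        rw [if_pos (hs.2.trans (u.time_le hk)), if_pos (u.time_le hk.le)]
        exact hWψ s hs
      · subst hk
        simp only [le_refl, lt_irrefl, if_true, if_false, u.time_last]
        refine ⟨U, hU, fun s hs => ?_⟩
        split_ifs with h
        · rw [le_antisymm h hs.1, sub_self, hU.map_zero]
        · rfl
    · have : ¬ T + t ≤ T := by linarith
      simp [this, hψT]

/-- The system can be steered from `x` to every neighbourhood of `y`, up to a global phase, in any
time larger than `δ`. -/
def ApproxReach (G : (ι → ℝ) → Set (E × E)) (δ : ℝ) (x y : E) : Prop :=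
  ∀ ε > (0 : ℝ), ∃ T L, Steers G T L ∧ T ≤ δ + ε ∧
    ∃ θ : ℝ, ‖L x - Complex.exp (Complex.I * θ) • y‖ < ε

theorem isSTAR_of_approxReach {L : E ≃ₗᵢ[ℂ] E} (h : ∀ x, ApproxReach G 0 x (L x)) :
    IsSTAR G L := by
  intro x _ ε hε
  obtain ⟨T, L', hL', hT, θ, hθ⟩ := h x ε hε
  obtain ⟨u, ψ, hsol, hψ⟩ := hL'.exists_isSolution x
  refine ⟨T, ⟨hL'.nonneg, by simpa using hT⟩, toIcoMod Real.two_pi_pos 0 θ,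
    by simpa using toIcoMod_mem_Ico Real.two_pi_pos 0 θ, u, ψ, hsol, ?_⟩
  have e : Complex.exp (Complex.I * (toIcoMod Real.two_pi_pos 0 θ : ℝ)) =
      Complex.exp (Complex.I * θ) := by
    rw [toIcoMod, zsmul_eq_mul]
    rw [Complex.exp_eq_exp_iff_exists_int]
    refine ⟨-(toIcoDiv Real.two_pi_pos 0 θ), ?_⟩
    push_cast
    ring
  rwa [e, hψ]

theorem norm_exp_I_smul (θ : ℝ) (y : E) : ‖Complex.exp (Complex.I * θ) • y‖ = ‖y‖ := by
  rw [norm_smul, Complex.norm_exp_I_mul_ofReal, one_mul]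

theorem ApproxReach.refl (x : E) : ApproxReach G 0 x x := fun ε hε =>
  ⟨0, _, Steers.refl, by linarith, 0, by simpa using hε⟩

theorem IsPropagator.approxReach {c : ι → ℝ} {U : ℝ → (E ≃ₗᵢ[ℂ] E)} (hU : IsPropagator (G c) U)
    {t : ℝ} (ht : 0 < t) (x : E) : ApproxReach G t x (U t x) := fun ε hε =>
  ⟨0 + t, _, Steers.refl.step hU ht, by linarith, 0, by simpa using hε⟩

/-- The second propagator is a linear isometry, so it transports the first error unchanged and
commutes with the first global phase; phases and times add up. -/
theorem ApproxReach.trans {δ δ' : ℝ} {x y z : E} (h : ApproxReach G δ x y)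
    (h' : ApproxReach G δ' y z) : ApproxReach G (δ + δ') x z := by
  intro ε hε
  obtain ⟨T, L, hL, hT, θ, hθ⟩ := h (ε / 2) (by positivity)
  obtain ⟨T', L', hL', hT', θ', hθ'⟩ := h' (ε / 2) (by positivity)
  refine ⟨T + T', L.trans L', hL.trans hL', by linarith, θ + θ', ?_⟩
  have e : (L.trans L') x - Complex.exp (Complex.I * (θ + θ' : ℝ)) • z =
      L' (L x - Complex.exp (Complex.I * θ) • y) +
        Complex.exp (Complex.I * θ) • (L' y - Complex.exp (Complex.I * θ') • z) := by
    rw [LinearIsometryEquiv.trans_apply, map_sub, map_smul, smul_sub, smul_smul, ← Complex.exp_add]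
    push_cast
    rw [mul_add]
    abel
  rw [e]
  refine (norm_add_le _ _).trans_lt ?_
  rw [LinearIsometryEquiv.norm_map, norm_exp_I_smul]
  linarith

theorem ApproxReach.exp_smul {δ : ℝ} {x y : E} (h : ApproxReach G δ x y) (α : ℝ) :
    ApproxReach G δ x (Complex.exp (Complex.I * α) • y) := by
  intro ε hε
  obtain ⟨T, L, hL, hT, θ, hθ⟩ := h ε hε
  refine ⟨T, L, hL, hT, θ - α, ?_⟩
  rw [smul_smul, ← Complex.exp_add]
  push_cast
  rw [mul_sub, sub_add_cancel]
  exact hθ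

/-- Reachability passes to limits. -/
theorem ApproxReach.of_forall {δ : ℝ} {x y : E}
    (h : ∀ ε > (0 : ℝ), ∃ δ' ≤ δ + ε, ∃ y', ApproxReach G δ' x y' ∧ ‖y' - y‖ < ε) :
    ApproxReach G δ x y := by
  intro ε hε
  obtain ⟨δ', hδ', y', hy', hyy⟩ := h (ε / 2) (by positivity)
  obtain ⟨T, L, hL, hT, θ, hθ⟩ := hy' (ε / 2) (by positivity)
  refine ⟨T, L, hL, by linarith, θ, ?_⟩
  have e : L x - Complex.exp (Complex.I * θ) • y =
      (L x - Complex.exp (Complex.I * θ) • y') + Complex.exp (Complex.I * θ) • (y' - y) := by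
    rw [smul_sub]; abel
  rw [e]
  refine (norm_add_le _ _).trans_lt ?_
  rw [norm_exp_I_smul]
  linarith

/-- It is enough to test the reachability of an isometry on a dense set of vectors. -/
theorem ApproxReach.of_dense {δ : ℝ} {D : Set E} (hD : Dense D) (L : E →ₗᵢ[ℂ] E)
    (h : ∀ x ∈ D, ApproxReach G δ x (L x)) (x : E) : ApproxReach G δ x (L x) := by
  intro ε hε
  obtain ⟨x', hx', hxx⟩ := Metric.mem_closure_iff.1 (hD x) (ε / 3) (by positivity)
  obtain ⟨T, L', hL', hT, θ, hθ⟩ := h x' hx' (ε / 3) (by positivity)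
  refine ⟨T, L', hL', by linarith, θ, ?_⟩
  rw [dist_eq_norm] at hxx
  have e : L' x - Complex.exp (Complex.I * θ) • L x =
      L' (x - x') + (L' x' - Complex.exp (Complex.I * θ) • L x') -
        Complex.exp (Complex.I * θ) • L (x - x') := by
    rw [map_sub, map_sub, smul_sub]; abel
  rw [e]
  refine (norm_sub_le _ _).trans_lt ?_
  have h1 := norm_add_le (L' (x - x')) (L' x' - Complex.exp (Complex.I * θ) • L x')
  rw [norm_exp_I_smul, LinearIsometry.norm_map]
  rw [LinearIsometryEquiv.norm_map] at h1
  linarith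

end Reach

/-! ### Functions as elements of `L²` -/

section ToL2

variable {X : Type*} [MeasurableSpace X] {μ : Measure X}

open Classical in
/-- The class of `f` in `L²`, or `0` if `f` is not square-integrable. -/
def toL2 (μ : Measure X) (f : X → ℂ) : Lp ℂ 2 μ := if h : MemLp f 2 μ then h.toLp f else 0

theorem coeFn_toL2 {f : X → ℂ} (h : MemLp f 2 μ) : toL2 μ f =ᵐ[μ] f := by
  rw [toL2, dif_pos h]
  exact h.coeFn_toLp

theorem toL2_eq {f : X → ℂ} {x : Lp ℂ 2 μ} (h : x =ᵐ[μ] f) : toL2 μ f = x := by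
  have hf : MemLp f 2 μ := (memLp_congr_ae h).1 (Lp.memLp x)
  exact Lp.ext ((coeFn_toL2 hf).trans h.symm)

theorem toL2_coeFn (x : Lp ℂ 2 μ) : toL2 μ x = x := toL2_eq (ae_eq_refl _)

theorem toL2_congr {f g : X → ℂ} (h : f =ᵐ[μ] g) : toL2 μ f = toL2 μ g := by
  by_cases hf : MemLp f 2 μ
  · exact (toL2_eq ((coeFn_toL2 hf).trans h)).symm
  · have hg : ¬ MemLp g 2 μ := fun hg => hf ((memLp_congr_ae h).2 hg)
    rw [toL2, toL2, dif_neg hf, dif_neg hg]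

theorem toL2_add {f g : X → ℂ} (hf : MemLp f 2 μ) (hg : MemLp g 2 μ) :
    toL2 μ (fun x => f x + g x) = toL2 μ f + toL2 μ g :=
  toL2_eq ((Lp.coeFn_add _ _).trans ((coeFn_toL2 hf).add (coeFn_toL2 hg)))

theorem toL2_sub {f g : X → ℂ} (hf : MemLp f 2 μ) (hg : MemLp g 2 μ) :
    toL2 μ (fun x => f x - g x) = toL2 μ f - toL2 μ g :=
  toL2_eq ((Lp.coeFn_sub _ _).trans ((coeFn_toL2 hf).sub (coeFn_toL2 hg)))

theorem toL2_smul (c : ℂ) {f : X → ℂ} (hf : MemLp f 2 μ) :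
    toL2 μ (fun x => c * f x) = c • toL2 μ f := by
  refine toL2_eq ((Lp.coeFn_smul _ _).trans ?_)
  filter_upwards [coeFn_toL2 hf] with x hx
  simp [hx]

theorem toL2_neg {f : X → ℂ} (hf : MemLp f 2 μ) : toL2 μ (fun x => -f x) = -toL2 μ f := by
  have := toL2_smul (-1) hf
  simpa using this

theorem toL2_sum {ι : Type*} (s : Finset ι) {f : ι → X → ℂ} (hf : ∀ i ∈ s, MemLp (f i) 2 μ) :
    toL2 μ (fun x => ∑ i ∈ s, f i x) = ∑ i ∈ s, toL2 μ (f i) := by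
  classical
  induction s using Finset.induction_on with
  | empty =>
    simp only [Finset.sum_empty]
    exact toL2_eq (Lp.coeFn_zero _ _ _)
  | insert i s hi ih =>
    simp only [Finset.sum_insert hi]
    rw [toL2_add (hf i (Finset.mem_insert_self i s))
      (memLp_finsetSum s fun j hj => hf j (Finset.mem_insert_of_mem hj)),
      ih fun j hj => hf j (Finset.mem_insert_of_mem hj)]

theorem norm_sq_toL2 {f : X → ℂ} (hf : MemLp f 2 μ) : ‖toL2 μ f‖ ^ 2 = ∫ x, ‖f x‖ ^ 2 ∂μ := by
  rw [← inner_self_eq_norm_sq (𝕜 := ℂ), L2.inner_def, ← integral_re (L2.integrable_inner _ _)]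
  refine integral_congr_ae ?_
  filter_upwards [coeFn_toL2 hf] with x hx
  rw [hx, inner_self_eq_norm_sq]

theorem inner_toL2 {f g : X → ℂ} (hf : MemLp f 2 μ) (hg : MemLp g 2 μ) :
    inner ℂ (toL2 μ f) (toL2 μ g) = ∫ x, (starRingEnd ℂ) (f x) * g x ∂μ := by
  rw [L2.inner_def]
  refine integral_congr_ae ?_
  filter_upwards [coeFn_toL2 hf, coeFn_toL2 hg] with x hx hy
  rw [hx, hy, RCLike.inner_apply, mul_comm]

theorem norm_toL2_le {f g : X → ℂ} (hf : AEStronglyMeasurable f μ) (hg : MemLp g 2 μ) (c : ℝ)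
    (h : ∀ᵐ x ∂μ, ‖f x‖ ≤ c * ‖g x‖) : ‖toL2 μ f‖ ≤ c * ‖toL2 μ g‖ := by
  have hf2 : MemLp f 2 μ := MemLp.of_le_mul hg hf h
  refine Lp.norm_le_mul_norm_of_ae_le_mul ?_
  filter_upwards [h, coeFn_toL2 hf2, coeFn_toL2 hg] with x h1 h2 h3
  rwa [h2, h3]

theorem norm_toL2_le_of_le {f g : X → ℂ} (hf : AEStronglyMeasurable f μ) (hg : MemLp g 2 μ)
    (h : ∀ᵐ x ∂μ, ‖f x‖ ≤ ‖g x‖) : ‖toL2 μ f‖ ≤ ‖toL2 μ g‖ := by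
  simpa using norm_toL2_le hf hg 1 (by simpa using h)

/-- The function `e^{iφ}`. -/
def expI {X : Type*} (φ : X → ℝ) (x : X) : ℂ := Complex.exp (Complex.I * (φ x : ℂ))

theorem norm_expI {X : Type*} (φ : X → ℝ) (x : X) : ‖expI φ x‖ = 1 := Complex.norm_exp_I_mul_ofReal _

theorem aestronglyMeasurable_expI {φ : X → ℝ} (hφ : AEStronglyMeasurable φ μ) :
    AEStronglyMeasurable (expI φ) μ := by
  have hc : Continuous fun r : ℝ => Complex.exp (Complex.I * (r : ℂ)) := by fun_prop
  exact hc.comp_aestronglyMeasurable hφ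

theorem memLp_expI_mul {φ : X → ℝ} (hφ : AEStronglyMeasurable φ μ) {f : X → ℂ}
    (hf : MemLp f 2 μ) : MemLp (fun x => expI φ x * f x) 2 μ := by
  refine hf.of_le ((aestronglyMeasurable_expI hφ).mul hf.1) (ae_of_all _ fun x => ?_)
  rw [norm_mul, norm_expI, one_mul]

theorem norm_toL2_expI_mul {φ : X → ℝ} (hφ : AEStronglyMeasurable φ μ) {f : X → ℂ}
    (hf : MemLp f 2 μ) : ‖toL2 μ (fun x => expI φ x * f x)‖ = ‖toL2 μ f‖ := by
  apply le_antisymm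
  · refine norm_toL2_le_of_le (memLp_expI_mul hφ hf).1 hf (ae_of_all _ fun x => ?_)
    rw [norm_mul, norm_expI, one_mul]
  · refine norm_toL2_le_of_le hf.1 (memLp_expI_mul hφ hf) (ae_of_all _ fun x => ?_)
    rw [norm_mul, norm_expI, one_mul]

theorem norm_exp_I_mul_sub_le {x : ℝ} (hx : |x| ≤ 1) :
    ‖Complex.exp (Complex.I * x) - 1 - Complex.I * x‖ ≤ x ^ 2 := by
  have h := Complex.norm_exp_sub_one_sub_id_le (x := Complex.I * x) (by simpa using hx)
  simpa using h

/-- Phases with a varying coefficient are differentiable in `L²`, on functions on the support of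
which the phase is bounded. -/
theorem hasDerivAt_toL2_expI {χ w : X → ℝ} (hχ : AEStronglyMeasurable χ μ)
    (hw : AEStronglyMeasurable w μ) {f : X → ℂ} (hf : MemLp f 2 μ) {C : ℝ}
    (hC : ∀ x, f x ≠ 0 → |w x| ≤ C) (s : ℝ) :
    HasDerivAt (fun t : ℝ => toL2 μ fun x => expI (fun y => χ y - t * w y) x * f x)
      (toL2 μ fun x => expI (fun y => χ y - s * w y) x * (-Complex.I * (w x * f x))) s := by
  have hC' : ∀ x, ‖(w x : ℂ) * f x‖ ≤ |C| * ‖f x‖ := by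
    intro x
    by_cases hx : f x = 0
    · simp [hx]
    · rw [norm_mul, Complex.norm_real, Real.norm_eq_abs]
      exact mul_le_mul_of_nonneg_right ((hC x hx).trans (le_abs_self C)) (norm_nonneg _)
  have hwf : MemLp (fun x => -Complex.I * (w x * f x)) 2 μ := by
    have h1 : AEStronglyMeasurable (fun x => ((w x : ℂ))) μ :=
      Complex.continuous_ofReal.comp_aestronglyMeasurable hw
    refine (MemLp.of_le_mul hf (h1.mul hf.1) (ae_of_all _ hC')).const_mul (-Complex.I)
  have hm : ∀ t : ℝ, AEStronglyMeasurable (fun y => χ y - t * w y) μ := fun t =>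
    hχ.sub (hw.const_mul t)
  rw [hasDerivAt_iff_isLittleO, Asymptotics.isLittleO_iff]
  intro c hc
  -- The bound `1` keeps the exponent where the quadratic Taylor bound of the exponential holds; the
  -- other one turns the quadratic remainder into `c|t - s|`.
  have hev : ∀ᶠ t : ℝ in 𝓝 s, |t - s| * (|C| + 1) < min 1 (c / ((|C| + 1) * (‖toL2 μ f‖ + 1))) := by
    have : Tendsto (fun t : ℝ => |t - s| * (|C| + 1)) (𝓝 s) (𝓝 (|s - s| * (|C| + 1))) := by
      apply Continuous.tendsto; fun_prop
    rw [sub_self, abs_zero, zero_mul] at this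
    exact this.eventually_lt_const (by positivity)
  filter_upwards [hev] with t ht
  have ht1 := (ht.trans_le (min_le_left _ _)).le
  have ht2 := (ht.trans_le (min_le_right _ _)).le
  set F : X → ℂ := fun x => (expI (fun y => χ y - t * w y) x * f x -
    expI (fun y => χ y - s * w y) x * f x) -
    ((t - s : ℝ) : ℂ) * (expI (fun y => χ y - s * w y) x * (-Complex.I * (w x * f x))) with hF
  have e1 := memLp_expI_mul (hm t) hf
  have e2 := memLp_expI_mul (hm s) hf
  have e3 := memLp_expI_mul (hm s) hwf
  have hFm : MemLp F 2 μ := (e1.sub e2).sub (e3.const_mul _)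
  have e : toL2 μ F = toL2 μ (fun x => expI (fun y => χ y - t * w y) x * f x) -
      toL2 μ (fun x => expI (fun y => χ y - s * w y) x * f x) - (t - s) •
        toL2 μ (fun x => expI (fun y => χ y - s * w y) x * (-Complex.I * (w x * f x))) := by
    have hs : ∀ v : Lp ℂ 2 μ, (t - s) • v = ((t - s : ℝ) : ℂ) • v := fun v =>
      (Complex.coe_smul (t - s) v).symm
    rw [hs, ← toL2_smul _ e3, ← toL2_sub e1 e2]
    exact toL2_sub (e1.sub e2) (e3.const_mul _)
  rw [← e]
  have hb : ‖toL2 μ F‖ ≤ ((|t - s| * (|C| + 1)) ^ 2) * ‖toL2 μ f‖ := by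
    refine norm_toL2_le hFm.1 hf _ (ae_of_all _ fun x => ?_)
    by_cases hx : f x = 0
    · simp [hF, hx]
    have h1 : |(-((t - s) * w x))| ≤ |t - s| * (|C| + 1) := by
      rw [abs_neg, abs_mul]
      have := (hC x hx).trans (le_abs_self C)
      gcongr
      linarith
    have h2 : F x = expI (fun y => χ y - s * w y) x *
        ((Complex.exp (Complex.I * (-((t - s) * w x) : ℝ)) - 1 -
          Complex.I * (-((t - s) * w x) : ℝ)) * f x) := by
      have h3 : expI (fun y => χ y - t * w y) x = expI (fun y => χ y - s * w y) x *
          Complex.exp (Complex.I * (-((t - s) * w x) : ℝ)) := by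
        rw [expI, expI, ← Complex.exp_add]
        congr 1
        push_cast
        ring
      rw [hF]
      simp only [h3]
      push_cast
      ring
    rw [h2, norm_mul, norm_expI, one_mul, norm_mul]
    gcongr
    refine (norm_exp_I_mul_sub_le (h1.trans ht1)).trans ?_
    rw [← sq_abs]
    gcongr
  refine hb.trans ?_
  rw [Real.norm_eq_abs]
  rw [le_div_iff₀ (by positivity)] at ht2
  have h5 : 0 ≤ |t - s| := abs_nonneg _
  have h6 : 0 ≤ |C| := abs_nonneg _
  have h7 : 0 ≤ ‖toL2 μ f‖ := norm_nonneg _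
  calc _ = |t - s| * (|t - s| * (|C| + 1) * ((|C| + 1) * ‖toL2 μ f‖)) := by ring
    _ ≤ |t - s| * (|t - s| * (|C| + 1) * ((|C| + 1) * (‖toL2 μ f‖ + 1))) := by gcongr; linarith
    _ ≤ |t - s| * c := by gcongr
    _ = c * |t - s| := mul_comm _ _

/-- If the equation with potential `τ⁻¹ w` is solved by `e^{i(χ - s w)} f` up to a bounded error,
then its propagator over the small time `τ` is close to the phase `e^{-iw}`. -/
theorem norm_phase_sub_propagator_le {G : Set (Lp ℂ 2 μ × Lp ℂ 2 μ)}
    {U : ℝ → (Lp ℂ 2 μ ≃ₗᵢ[ℂ] Lp ℂ 2 μ)} (hU : IsPropagator G U) {τ : ℝ} (hτ : 0 < τ)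
    {χ w : X → ℝ} (hχ : AEStronglyMeasurable χ μ)
    (hw : AEStronglyMeasurable w μ) {f : X → ℂ} (hf : MemLp f 2 μ) {C : ℝ}
    (hC : ∀ x, f x ≠ 0 → |w x| ≤ C) {q : ℝ → X → ℂ} {Q : ℝ} (hq : ∀ s, MemLp (q s) 2 μ)
    (hG : ∀ s ∈ Set.Icc (0 : ℝ) 1, (toL2 μ fun x => expI (fun y => χ y - s * w y) x * f x,
      toL2 μ fun x => expI (fun y => χ y - s * w y) x * ((τ : ℂ)⁻¹ * (w x * f x) + q s x)) ∈
        closure G)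
    (hQ : ∀ s ∈ Set.Icc (0 : ℝ) 1, ‖toL2 μ (q s)‖ ≤ Q) :
    ‖toL2 μ (fun x => expI (fun y => χ y - w y) x * f x) -
      U τ (toL2 μ fun x => expI χ x * f x)‖ ≤ τ * Q := by
  have hm : ∀ t : ℝ, AEStronglyMeasurable (fun y => χ y - t * w y) μ := fun t =>
    hχ.sub (hw.const_mul t)
  have hwf : MemLp (fun x => w x * f x) 2 μ := by
    have h1 : AEStronglyMeasurable (fun x => ((w x : ℂ))) μ :=
      Complex.continuous_ofReal.comp_aestronglyMeasurable hw
    refine MemLp.of_le_mul (c := C) hf (h1.mul hf.1) (ae_of_all _ fun x => ?_)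
    by_cases hx : f x = 0
    · simp [hx]
    · rw [norm_mul, Complex.norm_real, Real.norm_eq_abs]
      exact mul_le_mul_of_nonneg_right (hC x hx) (norm_nonneg _)
  have h := hU.norm_sub_le (τ := τ) (C := τ * Q)
    (fun s _ => hasDerivAt_toL2_expI hχ hw hf hC s) hG (fun s hs => by
      have h1 : MemLp (fun x => expI (fun y => χ y - s * w y) x *
          ((τ : ℂ)⁻¹ * (w x * f x) + q s x)) 2 μ :=
        memLp_expI_mul (hm s) ((hwf.const_mul _).add (hq s))
      have h2 : MemLp (fun x => expI (fun y => χ y - s * w y) x *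
          (-Complex.I * (w x * f x))) 2 μ := memLp_expI_mul (hm s) (hwf.const_mul _)
      rw [smul_smul, ← toL2_smul _ h1, ← toL2_add h2 (h1.const_mul _)]
      -- The derivative of the phase cancels the large potential `τ⁻¹w`; the residual is `iτ q s`
      -- times a phase, so it is of size `τ`.
      have e : (fun x => expI (fun y => χ y - s * w y) x * (-Complex.I * (w x * f x)) +
          (τ : ℂ) * Complex.I * (expI (fun y => χ y - s * w y) x *
            ((τ : ℂ)⁻¹ * (w x * f x) + q s x))) =
          fun x => expI (fun y => χ y - s * w y) x * ((τ * Complex.I) * q s x) := by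
        funext x
        have hτ' : (τ : ℂ) ≠ 0 := by exact_mod_cast hτ.ne'
        field_simp
        ring
      rw [e, norm_toL2_expI_mul (hm s) ((hq s).const_mul _), toL2_smul _ (hq s), norm_smul]
      simp only [norm_mul, Complex.norm_real, Complex.norm_I, mul_one, Real.norm_eq_abs,
        abs_of_pos hτ]
      exact mul_le_mul_of_nonneg_left (hQ s hs) hτ.le)
  simpa using h

end ToL2

/-! ### Reachable phases -/

section PhaseReach

variable {X : Type*} [MeasurableSpace X] {μ : Measure X} {ι : Type*}
  {G : (ι → ℝ) → Set (Lp ℂ 2 μ × Lp ℂ 2 μ)}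

/-- The multiplication operator `e^{iφ}` is small-time approximately reachable. -/
def PhaseReach (G : (ι → ℝ) → Set (Lp ℂ 2 μ × Lp ℂ 2 μ)) (φ : X → ℝ) : Prop :=
  ∀ x : Lp ℂ 2 μ, ApproxReach G 0 x (toL2 μ fun p => expI φ p * x p)

/-- Multiplication by `e^{iφ}`, as a linear isometry of `L²`. -/
def phaseIsometry {φ : X → ℝ} (hφ : AEStronglyMeasurable φ μ) : Lp ℂ 2 μ →ₗᵢ[ℂ] Lp ℂ 2 μ where
  toFun x := toL2 μ fun p => expI φ p * x p
  map_add' x y := by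
    rw [← toL2_add (memLp_expI_mul hφ (Lp.memLp x)) (memLp_expI_mul hφ (Lp.memLp y))]
    refine toL2_congr ?_
    filter_upwards [Lp.coeFn_add x y] with p hp
    rw [hp, Pi.add_apply, mul_add]
  map_smul' c x := by
    rw [RingHom.id_apply, ← toL2_smul _ (memLp_expI_mul hφ (Lp.memLp x))]
    refine toL2_congr ?_
    filter_upwards [Lp.coeFn_smul c x] with p hp
    rw [hp, Pi.smul_apply, smul_eq_mul]
    ring
  norm_map' x := by
    refine (norm_toL2_expI_mul hφ (Lp.memLp x)).trans ?_
    rw [toL2_coeFn]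

theorem phaseIsometry_apply {φ : X → ℝ} (hφ : AEStronglyMeasurable φ μ) (x : Lp ℂ 2 μ) :
    phaseIsometry hφ x = toL2 μ fun p => expI φ p * x p := rfl

theorem phaseIsometry_toL2 {φ : X → ℝ} (hφ : AEStronglyMeasurable φ μ) {f : X → ℂ}
    (hf : MemLp f 2 μ) : phaseIsometry hφ (toL2 μ f) = toL2 μ fun p => expI φ p * f p := by
  refine toL2_congr ?_
  filter_upwards [coeFn_toL2 hf] with p hp
  rw [hp]

theorem expI_add {X : Type*} (φ χ : X → ℝ) (x : X) : expI (fun y => φ y + χ y) x = expI φ x * expI χ x := by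
  rw [expI, expI, expI, ← Complex.exp_add]
  push_cast
  rw [mul_add]

theorem phaseIsometry_phaseIsometry {φ χ : X → ℝ} (hφ : AEStronglyMeasurable φ μ)
    (hχ : AEStronglyMeasurable χ μ) (x : Lp ℂ 2 μ) :
    phaseIsometry hφ (phaseIsometry hχ x) = phaseIsometry (hφ.add hχ) x := by
  rw [phaseIsometry_apply hχ, phaseIsometry_toL2 hφ (memLp_expI_mul hχ (Lp.memLp x)),
    phaseIsometry_apply]
  congr 1
  funext p
  rw [← mul_assoc, ← expI_add]
  rfl

theorem PhaseReach.congr {φ χ : X → ℝ} (h : PhaseReach G φ) (hφ : φ =ᵐ[μ] χ) :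
    PhaseReach G χ := by
  intro x
  have e : (toL2 μ fun p => expI φ p * x p) = toL2 μ fun p => expI χ p * x p := by
    refine toL2_congr ?_
    filter_upwards [hφ] with p hp
    rw [expI, expI, hp]
  exact e ▸ h x

theorem PhaseReach.add {φ χ : X → ℝ} (h : PhaseReach G φ) (h' : PhaseReach G χ)
    (hφ : AEStronglyMeasurable φ μ) (hχ : AEStronglyMeasurable χ μ) :
    PhaseReach G (fun x => φ x + χ x) := by
  intro x
  have h1 := (h' x).trans (h (phaseIsometry hχ x))
  rw [add_zero] at h1
  have h2 := phaseIsometry_phaseIsometry hφ hχ x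
  rw [phaseIsometry_apply] at h2
  rw [h2] at h1
  exact h1

/-- A constant phase is a global phase, which reachability ignores. -/
theorem PhaseReach.const (c : ℝ) : PhaseReach G (fun _ => c) := by
  intro x
  have h := (ApproxReach.refl (G := G) x).exp_smul c
  convert h using 1
  refine (toL2_smul _ (Lp.memLp x)).trans ?_
  rw [toL2_coeFn]

/-- Dominated convergence with the bound `4|f|²`: phases have modulus one, so no integrability of
the exponents is needed. -/
theorem tendsto_toL2_expI_mul {φ : ℕ → X → ℝ} {φ₀ : X → ℝ}
    (hφ : ∀ n, AEStronglyMeasurable (φ n) μ) (hφ₀ : AEStronglyMeasurable φ₀ μ)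
    (hlim : ∀ᵐ p ∂μ, Tendsto (fun n => φ n p) atTop (𝓝 (φ₀ p))) {f : X → ℂ} (hf : MemLp f 2 μ) :
    Tendsto (fun n => toL2 μ fun p => expI (φ n) p * f p) atTop
      (𝓝 (toL2 μ fun p => expI φ₀ p * f p)) := by
  rw [tendsto_iff_norm_sub_tendsto_zero]
  have hF : ∀ n, MemLp (fun p => expI (φ n) p * f p - expI φ₀ p * f p) 2 μ := fun n =>
    (memLp_expI_mul (hφ n) hf).sub (memLp_expI_mul hφ₀ hf)
  have h : Tendsto (fun n => ∫ p, ‖expI (φ n) p * f p - expI φ₀ p * f p‖ ^ 2 ∂μ) atTop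
      (𝓝 (∫ _, (0 : ℝ) ∂μ)) := by
    refine tendsto_integral_of_dominated_convergence (fun p => 4 * ‖f p‖ ^ 2)
      (fun n => (hF n).1.norm.pow 2) ?_ ?_ ?_
    · exact ((memLp_two_iff_integrable_sq_norm hf.1).1 hf).const_mul 4
    · intro n
      refine ae_of_all _ fun p => ?_
      rw [Real.norm_eq_abs, abs_of_nonneg (by positivity)]
      have h1 := norm_sub_le (expI (φ n) p * f p) (expI φ₀ p * f p)
      rw [norm_mul, norm_mul, norm_expI, norm_expI, one_mul] at h1
      have h2 : 0 ≤ ‖expI (φ n) p * f p - expI φ₀ p * f p‖ := norm_nonneg _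
      nlinarith
    · filter_upwards [hlim] with p hp
      have hc : Continuous fun r : ℝ => ‖Complex.exp (Complex.I * (r : ℂ)) * f p -
          expI φ₀ p * f p‖ ^ 2 := by fun_prop
      have := (hc.tendsto (φ₀ p)).comp hp
      simpa [expI, Function.comp_def] using this
  simp only [integral_zero] at h
  have h2 : Tendsto (fun n => ‖toL2 μ (fun p => expI (φ n) p * f p) -
      toL2 μ (fun p => expI φ₀ p * f p)‖ ^ 2) atTop (𝓝 0) := by
    refine h.congr fun n => ?_
    rw [← norm_sq_toL2 (hF n), toL2_sub (memLp_expI_mul (hφ n) hf) (memLp_expI_mul hφ₀ hf)]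
  have h3 := h2.sqrt
  simpa using h3

theorem PhaseReach.of_tendsto {φ : ℕ → X → ℝ} {φ₀ : X → ℝ} (h : ∀ n, PhaseReach G (φ n))
    (hφ : ∀ n, AEStronglyMeasurable (φ n) μ) (hφ₀ : AEStronglyMeasurable φ₀ μ)
    (hlim : ∀ᵐ p ∂μ, Tendsto (fun n => φ n p) atTop (𝓝 (φ₀ p))) : PhaseReach G φ₀ := by
  intro x
  refine ApproxReach.of_forall fun ε hε => ?_
  have h1 := tendsto_toL2_expI_mul hφ hφ₀ hlim (Lp.memLp x)
  obtain ⟨n, hn⟩ := (Metric.tendsto_nhds.1 h1 ε hε).exists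
  exact ⟨0, by linarith, _, h n x, by rwa [dist_eq_norm] at hn⟩

theorem PhaseReach.isSTAR {φ : Lp ℝ 2 μ} (h : PhaseReach G φ) : IsSTAR G (phase φ) := by
  refine isSTAR_of_approxReach fun x => ?_
  have e : (phase φ) x = toL2 μ fun p => expI φ p * x p :=
    (toL2_eq (coeFn_phaseFun (Lp.aestronglyMeasurable φ) x)).symm
  rw [e]
  exact h x

end PhaseReach

/-! ### Calculus on the torus -/

section TorusCalculus

variable {d : ℕ}

/-- The projection of `ℝ^d` onto the torus. -/
def torusMk (x : EuclideanSpace ℝ (Fin d)) : Torus d := fun i => (x i : AddCircle (2 * Real.pi))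

/-- It allows continuity on the torus to be read on the lift to `ℝ^d`, where smoothness is defined.
-/
theorem isOpenQuotientMap_torusMk : IsOpenQuotientMap (torusMk (d := d)) := by
  have h : IsOpenQuotientMap (Pi.map fun (_ : Fin d) (t : ℝ) => (t : AddCircle (2 * Real.pi))) :=
    IsOpenQuotientMap.piMap fun _ => QuotientAddGroup.isOpenQuotientMap_mk
  exact h.comp (PiLp.homeomorph 2 (fun _ : Fin d => ℝ)).isOpenQuotientMap

theorem exists_torusMk_eq (p : Torus d) : ∃ x, torusMk x = p :=
  isOpenQuotientMap_torusMk.surjective p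

theorem torusMk_add_smul_single (x : EuclideanSpace ℝ (Fin d)) (j : Fin d) (t : ℝ) :
    torusMk (x + t • EuclideanSpace.single j (1 : ℝ)) =
      torusMk x + Pi.single j (t : AddCircle (2 * Real.pi)) := by
  funext i
  by_cases h : i = j
  · subst h
    simp [torusMk]
  · simp [torusMk, h]

theorem torusSmooth_iff {f : Torus d → ℂ} : TorusSmooth f ↔ ContDiff ℝ ∞ (f ∘ torusMk) := Iff.rfl

theorem TorusSmooth.continuous {f : Torus d → ℂ} (hf : TorusSmooth f) : Continuous f :=
  isOpenQuotientMap_torusMk.isQuotientMap.continuous_iff.2 (torusSmooth_iff.1 hf).continuous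

theorem TorusSmooth.memLp {f : Torus d → ℂ} (hf : TorusSmooth f) : MemLp f 2 volume :=
  hf.continuous.memLp_of_hasCompactSupport (HasCompactSupport.of_compactSpace f)

theorem TorusSmooth.exists_norm_le {f : Torus d → ℂ} (hf : TorusSmooth f) :
    ∃ C, ∀ p, ‖f p‖ ≤ C := by
  obtain ⟨C, hC⟩ := isCompact_univ.exists_bound_of_continuousOn hf.continuous.continuousOn
  exact ⟨C, fun p => hC p (Set.mem_univ p)⟩

theorem TorusSmooth.integrable {f : Torus d → ℂ} (hf : TorusSmooth f) : Integrable f volume :=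
  hf.continuous.integrable_of_hasCompactSupport (HasCompactSupport.of_compactSpace f)

theorem TorusSmooth.const (c : ℂ) : TorusSmooth (fun _ : Torus d => c) := contDiff_const

theorem TorusSmooth.add {f g : Torus d → ℂ} (hf : TorusSmooth f) (hg : TorusSmooth g) :
    TorusSmooth fun p => f p + g p := ContDiff.add hf hg

theorem TorusSmooth.mul {f g : Torus d → ℂ} (hf : TorusSmooth f) (hg : TorusSmooth g) :
    TorusSmooth fun p => f p * g p := ContDiff.mul hf hg

theorem TorusSmooth.const_mul {f : Torus d → ℂ} (c : ℂ) (hf : TorusSmooth f) :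
    TorusSmooth fun p => c * f p := (TorusSmooth.const c).mul hf

theorem TorusSmooth.neg {f : Torus d → ℂ} (hf : TorusSmooth f) :
    TorusSmooth fun p => -f p := ContDiff.neg hf

theorem TorusSmooth.sum {ι : Type*} {s : Finset ι} {f : ι → Torus d → ℂ}
    (hf : ∀ i ∈ s, TorusSmooth (f i)) : TorusSmooth fun p => ∑ i ∈ s, f i p :=
  ContDiff.sum fun i hi => hf i hi

theorem TorusSmooth.cexp {f : Torus d → ℂ} (hf : TorusSmooth f) :
    TorusSmooth fun p => Complex.exp (f p) := ContDiff.cexp hf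

theorem TorusSmooth.conj {f : Torus d → ℂ} (hf : TorusSmooth f) :
    TorusSmooth fun p => (starRingEnd ℂ) (f p) :=
  Complex.conjCLE.contDiff.comp (torusSmooth_iff.1 hf)

/-- The partial derivative `∂ⱼf` on the torus. -/
def torusDeriv (j : Fin d) (f : Torus d → ℂ) (p : Torus d) : ℂ :=
  deriv (fun t : ℝ => f (p + Pi.single j (t : AddCircle (2 * Real.pi)))) 0

theorem TorusSmooth.hasDerivAt_aux {f : Torus d → ℂ} (hf : TorusSmooth f) (j : Fin d)
    (x : EuclideanSpace ℝ (Fin d)) (t : ℝ) :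
    HasDerivAt (fun t : ℝ => f (torusMk x + Pi.single j (t : AddCircle (2 * Real.pi))))
      (fderiv ℝ (f ∘ torusMk) (x + t • EuclideanSpace.single j (1 : ℝ))
        (EuclideanSpace.single j 1)) t := by
  have h1 : HasDerivAt (fun t : ℝ => x + t • EuclideanSpace.single j (1 : ℝ))
      (EuclideanSpace.single j (1 : ℝ)) t := by
    simpa using ((hasDerivAt_id t).smul_const (EuclideanSpace.single j (1 : ℝ))).const_add x
  have h2 := ((torusSmooth_iff.1 hf).differentiable (by simp)
    (x + t • EuclideanSpace.single j (1 : ℝ))).hasFDerivAt.comp_hasDerivAt t h1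
  refine h2.congr_of_eventuallyEq (Eventually.of_forall fun s => ?_)
  simp [torusMk_add_smul_single]

theorem TorusSmooth.torusDeriv_mk {f : Torus d → ℂ} (hf : TorusSmooth f) (j : Fin d)
    (x : EuclideanSpace ℝ (Fin d)) :
    torusDeriv j f (torusMk x) = fderiv ℝ (f ∘ torusMk) x (EuclideanSpace.single j 1) := by
  have h := (hf.hasDerivAt_aux j x 0).deriv
  simpa [torusDeriv] using h

theorem TorusSmooth.torusDeriv {f : Torus d → ℂ} (hf : TorusSmooth f) (j : Fin d) :
    TorusSmooth (torusDeriv j f) := by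
  rw [torusSmooth_iff]
  have e : SchrodingerControl.torusDeriv j f ∘ torusMk =
      fun x => fderiv ℝ (f ∘ torusMk) x (EuclideanSpace.single j 1) := by
    funext x
    exact hf.torusDeriv_mk j x
  rw [e]
  exact ((torusSmooth_iff.1 hf).fderiv_right (m := ∞) (by simp)).clm_apply contDiff_const

theorem TorusSmooth.hasDerivAt {f : Torus d → ℂ} (hf : TorusSmooth f) (j : Fin d)
    (p : Torus d) (t : ℝ) :
    HasDerivAt (fun t : ℝ => f (p + Pi.single j (t : AddCircle (2 * Real.pi))))
      (SchrodingerControl.torusDeriv j f (p + Pi.single j (t : AddCircle (2 * Real.pi)))) t := by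
  obtain ⟨x, rfl⟩ := exists_torusMk_eq p
  rw [← torusMk_add_smul_single, hf.torusDeriv_mk]
  exact hf.hasDerivAt_aux j x t

theorem TorusSmooth.hasDerivAt_zero {f : Torus d → ℂ} (hf : TorusSmooth f) (j : Fin d)
    (p : Torus d) :
    HasDerivAt (fun t : ℝ => f (p + Pi.single j (t : AddCircle (2 * Real.pi))))
      (SchrodingerControl.torusDeriv j f p) 0 := by
  simpa using hf.hasDerivAt j p 0

theorem TorusSmooth.torusLaplacian_eq {f : Torus d → ℂ} (hf : TorusSmooth f) (p : Torus d) :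
    torusLaplacian f p =
      ∑ j, SchrodingerControl.torusDeriv j (SchrodingerControl.torusDeriv j f) p := by
  refine Finset.sum_congr rfl fun j _ => ?_
  rw [iteratedDeriv_succ, iteratedDeriv_one]
  have e : deriv (fun t : ℝ => f (p + Pi.single j (t : AddCircle (2 * Real.pi)))) =
      fun t : ℝ => SchrodingerControl.torusDeriv j f
        (p + Pi.single j (t : AddCircle (2 * Real.pi))) := by
    funext t
    exact (hf.hasDerivAt j p t).deriv
  rw [e]
  rfl

theorem TorusSmooth.torusLaplacian {f : Torus d → ℂ} (hf : TorusSmooth f) :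
    TorusSmooth (torusLaplacian f) := by
  have e : SchrodingerControl.torusLaplacian f = fun p =>
      ∑ j, SchrodingerControl.torusDeriv j (SchrodingerControl.torusDeriv j f) p :=
    funext hf.torusLaplacian_eq
  rw [e]
  exact TorusSmooth.sum fun j _ => (hf.torusDeriv j).torusDeriv j

theorem torusDeriv_eq {f : Torus d → ℂ} {j : Fin d} {p : Torus d} {c : ℂ}
    (h : HasDerivAt (fun t : ℝ => f (p + Pi.single j (t : AddCircle (2 * Real.pi)))) c 0) :
    torusDeriv j f p = c := h.deriv

theorem torusDeriv_add {f g : Torus d → ℂ} (hf : TorusSmooth f) (hg : TorusSmooth g) (j : Fin d)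
    (p : Torus d) :
    torusDeriv j (fun p => f p + g p) p = torusDeriv j f p + torusDeriv j g p :=
  torusDeriv_eq ((hf.hasDerivAt_zero j p).add (hg.hasDerivAt_zero j p))

theorem torusDeriv_mul {f g : Torus d → ℂ} (hf : TorusSmooth f) (hg : TorusSmooth g) (j : Fin d)
    (p : Torus d) :
    torusDeriv j (fun p => f p * g p) p = torusDeriv j f p * g p + f p * torusDeriv j g p := by
  refine torusDeriv_eq (((hf.hasDerivAt_zero j p).mul (hg.hasDerivAt_zero j p)).congr_deriv ?_)
  simp

theorem torusDeriv_const (c : ℂ) (j : Fin d) (p : Torus d) :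
    torusDeriv j (fun _ => c) p = 0 := torusDeriv_eq (hasDerivAt_const _ _)

theorem torusDeriv_const_mul {f : Torus d → ℂ} (c : ℂ) (hf : TorusSmooth f) (j : Fin d)
    (p : Torus d) : torusDeriv j (fun p => c * f p) p = c * torusDeriv j f p :=
  torusDeriv_eq ((hf.hasDerivAt_zero j p).const_mul c)

theorem torusDeriv_conj {f : Torus d → ℂ} (hf : TorusSmooth f) (j : Fin d) (p : Torus d) :
    torusDeriv j (fun p => (starRingEnd ℂ) (f p)) p = (starRingEnd ℂ) (torusDeriv j f p) :=
  torusDeriv_eq (Complex.conjCLE.toContinuousLinearMap.hasFDerivAt.comp_hasDerivAt 0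
    (hf.hasDerivAt_zero j p))

theorem torusDeriv_cexp {f : Torus d → ℂ} (hf : TorusSmooth f) (j : Fin d) (p : Torus d) :
    torusDeriv j (fun p => Complex.exp (f p)) p = Complex.exp (f p) * torusDeriv j f p := by
  refine torusDeriv_eq ?_
  simpa using (hf.hasDerivAt_zero j p).cexp

/-- The product `⟨∇f, ∇g⟩ = ∑ⱼ ∂ⱼf ∂ⱼg` on the torus. -/
def torusGrad (f g : Torus d → ℂ) (p : Torus d) : ℂ := ∑ j, torusDeriv j f p * torusDeriv j g p

theorem TorusSmooth.torusGrad {f g : Torus d → ℂ} (hf : TorusSmooth f) (hg : TorusSmooth g) :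
    TorusSmooth (torusGrad f g) :=
  TorusSmooth.sum fun j _ => (hf.torusDeriv j).mul (hg.torusDeriv j)

theorem torusLaplacian_add {f g : Torus d → ℂ} (hf : TorusSmooth f) (hg : TorusSmooth g)
    (p : Torus d) :
    torusLaplacian (fun p => f p + g p) p = torusLaplacian f p + torusLaplacian g p := by
  rw [(hf.add hg).torusLaplacian_eq, hf.torusLaplacian_eq, hg.torusLaplacian_eq,
    ← Finset.sum_add_distrib]
  refine Finset.sum_congr rfl fun j _ => ?_
  rw [funext (torusDeriv_add hf hg j), torusDeriv_add (hf.torusDeriv j) (hg.torusDeriv j)]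

theorem torusLaplacian_const_mul {f : Torus d → ℂ} (c : ℂ) (hf : TorusSmooth f) (p : Torus d) :
    torusLaplacian (fun p => c * f p) p = c * torusLaplacian f p := by
  rw [(hf.const_mul c).torusLaplacian_eq, hf.torusLaplacian_eq, Finset.mul_sum]
  refine Finset.sum_congr rfl fun j _ => ?_
  rw [funext (torusDeriv_const_mul c hf j), torusDeriv_const_mul c (hf.torusDeriv j)]

theorem torusLaplacian_conj {f : Torus d → ℂ} (hf : TorusSmooth f) (p : Torus d) :
    torusLaplacian (fun p => (starRingEnd ℂ) (f p)) p = (starRingEnd ℂ) (torusLaplacian f p) := by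
  rw [hf.conj.torusLaplacian_eq, hf.torusLaplacian_eq, map_sum]
  refine Finset.sum_congr rfl fun j _ => ?_
  rw [funext (torusDeriv_conj hf j), torusDeriv_conj (hf.torusDeriv j)]

theorem torusLaplacian_exp_mul {φ f : Torus d → ℂ} (hφ : TorusSmooth φ) (hf : TorusSmooth f)
    (p : Torus d) :
    torusLaplacian (fun p => Complex.exp (Complex.I * φ p) * f p) p =
      Complex.exp (Complex.I * φ p) * (torusLaplacian f p + 2 * Complex.I * torusGrad φ f p +
        Complex.I * torusLaplacian φ p * f p - torusGrad φ φ p * f p) := by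
  have hIφ := hφ.const_mul Complex.I
  have hE := hIφ.cexp
  rw [(hE.mul hf).torusLaplacian_eq, hf.torusLaplacian_eq, hφ.torusLaplacian_eq, torusGrad,
    torusGrad]
  have e1 : ∀ j, SchrodingerControl.torusDeriv j
      (fun p => Complex.exp (Complex.I * φ p) * f p) = fun p =>
        Complex.exp (Complex.I * φ p) * (Complex.I * torusDeriv j φ p * f p + torusDeriv j f p) := by
    intro j
    funext p
    rw [torusDeriv_mul hE hf, torusDeriv_cexp hIφ, torusDeriv_const_mul _ hφ]
    ring
  have e2 : ∀ j, SchrodingerControl.torusDeriv j (SchrodingerControl.torusDeriv j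
      (fun p => Complex.exp (Complex.I * φ p) * f p)) p = Complex.exp (Complex.I * φ p) *
        (torusDeriv j (torusDeriv j f) p + 2 * Complex.I * (torusDeriv j φ p * torusDeriv j f p) +
          Complex.I * f p * torusDeriv j (torusDeriv j φ) p -
            f p * (torusDeriv j φ p * torusDeriv j φ p)) := by
    intro j
    have h1 := (hφ.torusDeriv j).const_mul Complex.I
    rw [e1, torusDeriv_mul hE ((h1.mul hf).add (hf.torusDeriv j)), torusDeriv_cexp hIφ,
      torusDeriv_const_mul _ hφ, torusDeriv_add (h1.mul hf) (hf.torusDeriv j),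
      torusDeriv_mul h1 hf, torusDeriv_const_mul _ (hφ.torusDeriv j)]
    linear_combination (Complex.exp (Complex.I * φ p) * torusDeriv j φ p ^ 2 * f p) *
      Complex.I_mul_I
  simp only [e2]
  rw [← Finset.mul_sum, Finset.sum_sub_distrib, Finset.sum_add_distrib, Finset.sum_add_distrib,
    ← Finset.mul_sum, ← Finset.mul_sum, ← Finset.mul_sum]
  ring

/-- The integral of a translate of `f` does not depend on the translation; differentiate it under
the integral sign. -/
theorem integral_torusDeriv {f : Torus d → ℂ} (hf : TorusSmooth f) (j : Fin d) :
    ∫ p, torusDeriv j f p = 0 := by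
  obtain ⟨C, hC⟩ := (hf.torusDeriv j).exists_norm_le
  have hshift : ∀ {g : Torus d → ℂ}, Continuous g → ∀ t : ℝ,
      Continuous fun p : Torus d => g (p + Pi.single j (t : AddCircle (2 * Real.pi))) := fun hg t =>
    hg.comp (by fun_prop)
  have hconst : ∀ t : ℝ, ∫ p : Torus d, f (p + Pi.single j (t : AddCircle (2 * Real.pi))) = ∫ p, f p :=
    fun t => integral_add_right_eq_self f _
  have h1 : ∀ᶠ t : ℝ in 𝓝 0, AEStronglyMeasurable
      (fun p : Torus d => f (p + Pi.single j (t : AddCircle (2 * Real.pi)))) volume :=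
    Eventually.of_forall fun t => (hshift hf.continuous t).aestronglyMeasurable
  have h2 : Integrable
      (fun p : Torus d => f (p + Pi.single j ((0 : ℝ) : AddCircle (2 * Real.pi)))) volume := by
    simpa using hf.integrable
  have h3 : AEStronglyMeasurable (fun p : Torus d =>
      torusDeriv j f (p + Pi.single j ((0 : ℝ) : AddCircle (2 * Real.pi)))) volume :=
    (hshift (hf.torusDeriv j).continuous 0).aestronglyMeasurable
  have h4 : ∀ᵐ p : Torus d, ∀ t ∈ (Set.univ : Set ℝ),
      ‖torusDeriv j f (p + Pi.single j (t : AddCircle (2 * Real.pi)))‖ ≤ C :=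
    ae_of_all _ fun p t _ => hC _
  have h5 : ∀ᵐ p : Torus d, ∀ t ∈ (Set.univ : Set ℝ),
      HasDerivAt (fun t : ℝ => f (p + Pi.single j (t : AddCircle (2 * Real.pi))))
        (torusDeriv j f (p + Pi.single j (t : AddCircle (2 * Real.pi)))) t :=
    ae_of_all _ fun p t _ => hf.hasDerivAt j p t
  have h := (hasDerivAt_integral_of_dominated_loc_of_deriv_le (bound := fun _ => C)
    Filter.univ_mem h1 h2 h3 h4 (integrable_const C) h5).2
  simp only [hconst] at h
  have h6 := h.unique (hasDerivAt_const _ _)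
  simpa using h6

theorem integral_mul_torusLaplacian {f g : Torus d → ℂ} (hf : TorusSmooth f)
    (hg : TorusSmooth g) :
    ∫ p, f p * torusLaplacian g p = ∫ p, torusLaplacian f p * g p := by
  rw [← sub_eq_zero, ← integral_sub (hf.mul hg.torusLaplacian).integrable
    (hf.torusLaplacian.mul hg).integrable]
  -- Green's identity: `f Δg - g Δf` is the divergence of `f∇g - g∇f`, whose components are these
  -- functions.
  have h : ∀ j, TorusSmooth fun p =>
      f p * torusDeriv j g p + -1 * (torusDeriv j f p * g p) := fun j =>
    (hf.mul (hg.torusDeriv j)).add (((hf.torusDeriv j).mul hg).const_mul _)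
  have e : ∀ p, f p * torusLaplacian g p - torusLaplacian f p * g p =
      ∑ j, torusDeriv j (fun p => f p * torusDeriv j g p + -1 * (torusDeriv j f p * g p)) p := by
    intro p
    rw [hf.torusLaplacian_eq, hg.torusLaplacian_eq, Finset.mul_sum, Finset.sum_mul,
      ← Finset.sum_sub_distrib]
    refine Finset.sum_congr rfl fun j _ => ?_
    rw [torusDeriv_add (hf.mul (hg.torusDeriv j)) (((hf.torusDeriv j).mul hg).const_mul _),
      torusDeriv_const_mul _ ((hf.torusDeriv j).mul hg), torusDeriv_mul hf (hg.torusDeriv j),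
      torusDeriv_mul (hf.torusDeriv j) hg]
    ring
  simp only [e]
  rw [integral_finsetSum _ fun j _ => ((h j).torusDeriv j).integrable]
  exact Finset.sum_eq_zero fun j _ => integral_torusDeriv (h j) j

end TorusCalculus

/-! ### Characters of the torus -/

section TorusChar

variable {d : ℕ}

/-- The character `x ↦ e^{i⟨k, x⟩}` of the torus. -/
def torusChar (k : Fin d → ℤ) (p : Torus d) : ℂ := (AddCircle.toCircle (∑ i, k i • p i) : ℂ)

theorem toCircle_coe (t : ℝ) :
    ((AddCircle.toCircle (t : AddCircle (2 * Real.pi)) : Circle) : ℂ) =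
      Complex.exp (Complex.I * t) := by
  rw [AddCircle.toCircle_apply_mk, Circle.coe_exp]
  congr 1
  have : (2 * Real.pi) ≠ 0 := Real.two_pi_pos.ne'
  rw [div_self this, one_mul, mul_comm]

theorem torusChar_mk (k : Fin d → ℤ) (x : EuclideanSpace ℝ (Fin d)) :
    torusChar k (torusMk x) = Complex.exp (Complex.I * ((∑ i, k i * x i : ℝ) : ℂ)) := by
  rw [← toCircle_coe, torusChar]
  congr 2
  have h : ∀ i, k i • torusMk x i = ((k i * x i : ℝ) : AddCircle (2 * Real.pi)) := by
    intro i
    rw [torusMk, ← AddCircle.coe_zsmul, zsmul_eq_mul]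
  simp only [h]
  exact (map_sum (QuotientAddGroup.mk' (AddSubgroup.zmultiples (2 * Real.pi)))
    (fun i => (k i : ℝ) * x i) Finset.univ).symm

theorem torusChar_add (k l : Fin d → ℤ) (p : Torus d) :
    torusChar (k + l) p = torusChar k p * torusChar l p := by
  rw [torusChar, torusChar, torusChar, ← Circle.coe_mul, ← AddCircle.toCircle_add,
    ← Finset.sum_add_distrib]
  simp only [Pi.add_apply, add_smul]

theorem torusChar_neg (k : Fin d → ℤ) (p : Torus d) :
    torusChar (-k) p = (starRingEnd ℂ) (torusChar k p) := by
  rw [torusChar, torusChar, ← Circle.coe_inv_eq_conj, ← AddCircle.toCircle_neg,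
    ← Finset.sum_neg_distrib]
  simp only [Pi.neg_apply, neg_smul]

theorem torusChar_zero (p : Torus d) : torusChar 0 p = 1 := by
  simp [torusChar]

theorem norm_torusChar (k : Fin d → ℤ) (p : Torus d) : ‖torusChar k p‖ = 1 := Circle.norm_coe _

theorem torusSmooth_torusChar (k : Fin d → ℤ) : TorusSmooth (torusChar k) := by
  rw [torusSmooth_iff]
  have e : torusChar k ∘ torusMk = fun x => Complex.exp (Complex.I * ((∑ i, k i * x i : ℝ) : ℂ)) :=
    funext (torusChar_mk k)
  rw [e]
  have h : ContDiff ℝ ∞ fun x : EuclideanSpace ℝ (Fin d) => ∑ i, (k i : ℝ) * x i :=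
    ContDiff.sum fun i _ => contDiff_const.mul (EuclideanSpace.proj (𝕜 := ℝ) i).contDiff
  exact (contDiff_const.mul (Complex.ofRealCLM.contDiff.comp h)).cexp

theorem torusDeriv_torusChar (k : Fin d → ℤ) (j : Fin d) (p : Torus d) :
    torusDeriv j (torusChar k) p = Complex.I * k j * torusChar k p := by
  have e : ∀ t : ℝ, torusChar k (p + Pi.single j (t : AddCircle (2 * Real.pi))) =
      torusChar k p * Complex.exp (Complex.I * ((k j * t : ℝ) : ℂ)) := by
    intro t
    rw [← toCircle_coe, torusChar, torusChar, ← Circle.coe_mul, ← AddCircle.toCircle_add]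
    congr 2
    simp only [Pi.add_apply, smul_add, Finset.sum_add_distrib]
    congr 1
    rw [Finset.sum_eq_single j]
    · simp
    · intro i _ hi
      simp [hi]
    · simp
  refine torusDeriv_eq ?_
  simp only [e]
  have h1 : HasDerivAt (fun t : ℝ => Complex.I * ((k j * t : ℝ) : ℂ)) (Complex.I * (k j : ℂ)) 0 := by
    have := ((hasDerivAt_id (0 : ℝ)).const_mul (k j : ℝ)).ofReal_comp.const_mul Complex.I
    simpa using this
  refine (h1.cexp.const_mul (torusChar k p)).congr_deriv ?_
  simp
  ring

theorem torusLaplacian_torusChar (k : Fin d → ℤ) (p : Torus d) :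
    torusLaplacian (torusChar k) p = -((∑ j, (k j : ℝ) ^ 2 : ℝ) : ℂ) * torusChar k p := by
  rw [(torusSmooth_torusChar k).torusLaplacian_eq]
  have e : ∀ j, torusDeriv j (torusDeriv j (torusChar k)) p =
      -((k j : ℂ) ^ 2) * torusChar k p := by
    intro j
    rw [funext (torusDeriv_torusChar k j), torusDeriv_const_mul _ (torusSmooth_torusChar k),
      torusDeriv_torusChar]
    linear_combination (k j : ℂ) ^ 2 * torusChar k p * Complex.I_mul_I
  simp only [e]
  rw [← Finset.sum_mul, Finset.sum_neg_distrib]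
  push_cast
  rfl

/-- Characters, as continuous functions. -/
def torusCharC (k : Fin d → ℤ) : C(Torus d, ℂ) := ⟨torusChar k, (torusSmooth_torusChar k).continuous⟩

/-- The algebra of trigonometric polynomials on the torus. -/
def torusTrigPoly (d : ℕ) : StarSubalgebra ℂ C(Torus d, ℂ) where
  toSubalgebra := Algebra.adjoin ℂ (Set.range torusCharC)
  star_mem' := by
    change Algebra.adjoin ℂ (Set.range torusCharC) ≤ star (Algebra.adjoin ℂ (Set.range torusCharC))
    refine Algebra.adjoin_le ?_
    rintro - ⟨k, rfl⟩
    refine Algebra.subset_adjoin ⟨-k, ?_⟩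
    ext p
    exact torusChar_neg k p

/-- Characters are stable under products and contain `1`, so the algebra they generate is their
linear span. -/
theorem torusTrigPoly_coe :
    Subalgebra.toSubmodule (torusTrigPoly d).toSubalgebra =
      Submodule.span ℂ (Set.range torusCharC) := by
  apply Algebra.adjoin_eq_span_of_subset
  refine Set.Subset.trans ?_ Submodule.subset_span
  intro x hx
  refine Submonoid.closure_induction (fun _ => id) ⟨0, ?_⟩ ?_ hx
  · ext p
    exact torusChar_zero p
  · rintro _ _ _ _ ⟨m, rfl⟩ ⟨n, rfl⟩
    refine ⟨m + n, ?_⟩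
    ext p
    exact torusChar_add m n p

theorem separatesPoints_torusTrigPoly : (torusTrigPoly d).SeparatesPoints := by
  intro x y hxy
  obtain ⟨i, hi⟩ := Function.ne_iff.1 hxy
  refine ⟨_, ⟨torusCharC (Pi.single i 1), Algebra.subset_adjoin ⟨_, rfl⟩, rfl⟩, ?_⟩
  have e : ∀ z : Torus d, torusCharC (Pi.single i 1) z = (AddCircle.toCircle (z i) : ℂ) := by
    intro z
    change torusChar _ z = _
    rw [torusChar]
    congr 2
    rw [Finset.sum_eq_single i]
    · simp
    · intro j _ hj
      simp [hj]
    · simp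
  simp only [e]
  intro h
  exact hi (AddCircle.injective_toCircle Real.two_pi_pos.ne' (Subtype.ext h))

theorem closure_span_torusCharC :
    (Submodule.span ℂ (Set.range (torusCharC (d := d)))).topologicalClosure = ⊤ := by
  rw [← torusTrigPoly_coe]
  exact congrArg (Subalgebra.toSubmodule <| StarSubalgebra.toSubalgebra ·)
    (ContinuousMap.starSubalgebra_topologicalClosure_eq_top_of_separatesPoints (torusTrigPoly d)
      separatesPoints_torusTrigPoly)

/-- The trigonometric polynomials are dense in `L²`. -/
theorem dense_span_torusChar :
    Dense (Submodule.span ℂ (Set.range fun k : Fin d → ℤ =>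
      toL2 (volume : Measure (Torus d)) (torusChar k)) : Set (Lp ℂ 2 (volume : Measure (Torus d)))) := by
  have h := (ContinuousMap.toLp_denseRange ℂ (volume : Measure (Torus d)) ℂ
    (by simp : (2 : ℝ≥0∞) ≠ ⊤)).topologicalClosure_map_submodule closure_span_torusCharC
  rw [LinearMap.map_span] at h
  rw [Submodule.dense_iff_topologicalClosure_eq_top, ← h]
  congr 2
  rw [← Set.range_comp]
  congr 1
  funext k
  exact toL2_eq (ContinuousMap.coeFn_toLp (𝕜 := ℂ) _ _)

end TorusChar

/-! ### Ranges of symmetric operators -/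

section Range

variable {E : Type*} [NormedAddCommGroup E] [InnerProductSpace ℂ E]

local notation "⟪" x ", " y "⟫" => inner ℂ x y

theorem dense_range_of_forall_inner_eq_zero [CompleteSpace E] {S : Submodule ℂ (E × E)} {z : ℂ}
    (h : ∀ y : E, (∀ p ∈ S, ⟪y, p.2 + z • p.1⟫ = 0) → y = 0) :
    Dense {w : E | ∃ p ∈ S, p.2 + z • p.1 = w} := by
  let K : Submodule ℂ E := S.map (LinearMap.snd ℂ E E + z • LinearMap.fst ℂ E E)
  have hK : (K : Set E) = {w : E | ∃ p ∈ S, p.2 + z • p.1 = w} := by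
    ext w
    simp [K]
  rw [← hK, Submodule.dense_iff_topologicalClosure_eq_top, Submodule.topologicalClosure_eq_top_iff,
    Submodule.eq_bot_iff]
  intro y hy
  refine h y fun p hp => ?_
  rw [← inner_conj_symm, Submodule.mem_orthogonal _ _ |>.1 hy _ ?_, map_zero]
  exact ⟨p, hp, rfl⟩

/-- Bounded perturbations preserve the density of the range of `A + il`, for `l` large. -/
theorem IsSymmetricGraph.dense_range_of_perturbation [CompleteSpace E]
    {S₀ S : Submodule ℂ (E × E)} (hS₀ : IsSymmetricGraph S₀) {l C : ℝ} (hC : 0 ≤ C) (hl : C < |l|)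
    (hd : Dense {w : E | ∃ p ∈ S₀, p.2 + (Complex.I * l) • p.1 = w})
    (hS : ∀ p ∈ S₀, ∃ b, (p.1, p.2 + b) ∈ S ∧ ‖b‖ ≤ C * ‖p.1‖) :
    Dense {w : E | ∃ p ∈ S, p.2 + (Complex.I * l) • p.1 = w} := by
  refine dense_range_of_forall_inner_eq_zero fun y hy => ?_
  have hl0 : 0 < |l| := hC.trans_lt hl
  -- Choose `p` such that `w = (A + il)p` is `ε`-close to `y`. Orthogonality to `w + b` leaves `‖y‖²
  -- = ⟪y, y - w⟫ - ⟪y, b⟫`, and `‖b‖ ≤ C‖p.1‖ ≤ C(‖y‖ + ε)/|l|` is absorbed because `C < |l|`.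
  have key : ∀ ε > 0, (|l| - C) * ‖y‖ ^ 2 ≤ ε * ((|l| + C) * ‖y‖) := by
    intro ε hε
    obtain ⟨_, ⟨p, hp, rfl⟩, hpy⟩ := Metric.mem_closure_iff.1 (hd y) ε hε
    obtain ⟨b, hb, hbC⟩ := hS p hp
    rw [dist_eq_norm] at hpy
    set w := p.2 + (Complex.I * l) • p.1 with hw
    have h1 : |l| * ‖p.1‖ ≤ ‖y‖ + ε := by
      refine (hS₀.mul_norm_fst_le hp l).trans ?_
      have := norm_sub_norm_le w y
      rw [norm_sub_rev] at this
      linarith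
    have h2 : ⟪y, y⟫ = ⟪y, y - w⟫ - ⟪y, b⟫ := by
      have h3 := hy _ hb
      have h4 : (p.1, p.2 + b).2 + (Complex.I * (l : ℂ)) • (p.1, p.2 + b).1 = w + b := by
        simp only [hw]; abel
      rw [h4, inner_add_right] at h3
      rw [inner_sub_right]
      linear_combination h3
    have h5 : ‖y‖ ^ 2 ≤ ‖y‖ * ε + ‖y‖ * (C * ‖p.1‖) := by
      rw [inner_self_eq_norm_sq_to_K] at h2
      have h6 := congrArg norm h2
      rw [norm_pow, RCLike.norm_ofReal, abs_norm] at h6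
      rw [h6]
      refine (norm_sub_le _ _).trans (add_le_add ?_ ?_)
      · exact (norm_inner_le_norm _ _).trans (by gcongr)
      · exact (norm_inner_le_norm _ _).trans (by gcongr)
    have h7 : 0 ≤ ‖y‖ := norm_nonneg y
    have h8 : ‖y‖ * C * (|l| * ‖p.1‖) ≤ ‖y‖ * C * (‖y‖ + ε) := by gcongr
    have h9 : |l| * ‖y‖ ^ 2 ≤ |l| * (‖y‖ * ε + ‖y‖ * (C * ‖p.1‖)) := by gcongr
    nlinarith
  by_contra hne
  have hy0 : 0 < ‖y‖ := norm_pos_iff.2 hne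
  have h1 : 0 < (|l| - C) * ‖y‖ ^ 2 := mul_pos (by linarith) (by positivity)
  have h2 : 0 < (|l| + C) * ‖y‖ := by positivity
  have h3 := key ((|l| - C) * ‖y‖ ^ 2 / (2 * ((|l| + C) * ‖y‖))) (by positivity)
  rw [div_mul_eq_mul_div, mul_div_mul_right _ _ h2.ne'] at h3
  linarith

end Range

/-! ### The Schrödinger operators on the torus -/

section TorusSystem

variable {d : ℕ}

/-- The graph of `-Δ + P` on the smooth functions of the torus. -/
def torusGraph (P : Torus d → ℝ) : Submodule ℂ
    (Lp ℂ 2 (volume : Measure (Torus d)) × Lp ℂ 2 (volume : Measure (Torus d))) where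
  carrier := {q | ∃ f : Torus d → ℂ, TorusSmooth f ∧ q.1 =ᵐ[volume] f ∧
    q.2 =ᵐ[volume] fun p => -torusLaplacian f p + (P p : ℂ) * f p}
  add_mem' := by
    rintro q r ⟨f, hf, h1, h2⟩ ⟨g, hg, h3, h4⟩
    refine ⟨_, hf.add hg, (Lp.coeFn_add _ _).trans (h1.add h3), (Lp.coeFn_add _ _).trans ?_⟩
    filter_upwards [h2, h4] with p hp hp'
    rw [Pi.add_apply, hp, hp', torusLaplacian_add hf hg]
    ring
  zero_mem' := by
    refine ⟨_, TorusSmooth.const 0, Lp.coeFn_zero _ _ _, (Lp.coeFn_zero _ _ _).trans ?_⟩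
    have h := torusLaplacian_const_mul 0 (TorusSmooth.const (d := d) 0)
    simp only [mul_zero, zero_mul] at h
    refine ae_of_all _ fun p => ?_
    simp [h]
  smul_mem' := by
    rintro c q ⟨f, hf, h1, h2⟩
    refine ⟨_, hf.const_mul c, (Lp.coeFn_smul _ _).trans (h1.const_smul c),
      (Lp.coeFn_smul _ _).trans ?_⟩
    filter_upwards [h2] with p hp
    rw [Pi.smul_apply, hp, torusLaplacian_const_mul c hf, smul_eq_mul]
    ring

theorem memLp_potential_mul {X : Type*} [MeasurableSpace X] {μ : Measure X} {P : X → ℝ}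
    (hP : AEStronglyMeasurable P μ) {C : ℝ} (hC : ∀ᵐ p ∂μ, |P p| ≤ C) {f : X → ℂ}
    (hf : MemLp f 2 μ) : MemLp (fun p => (P p : ℂ) * f p) 2 μ := by
  have h1 : AEStronglyMeasurable (fun p => (P p : ℂ)) μ :=
    Complex.continuous_ofReal.comp_aestronglyMeasurable hP
  refine MemLp.of_le_mul (c := C) hf (h1.mul hf.1) ?_
  filter_upwards [hC] with p hp
  rw [norm_mul, Complex.norm_real, Real.norm_eq_abs]
  gcongr

variable {P : Torus d → ℝ} {C : ℝ}

theorem mk_mem_torusGraph (hP : AEStronglyMeasurable P volume) (hC : ∀ᵐ p, |P p| ≤ C)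
    {f : Torus d → ℂ} (hf : TorusSmooth f) {g : Torus d → ℂ}
    (hg : ∀ p, g p = -torusLaplacian f p + (P p : ℂ) * f p) :
    (toL2 volume f, toL2 volume g) ∈ torusGraph P := by
  refine ⟨f, hf, coeFn_toL2 hf.memLp, ?_⟩
  rw [show g = fun p => -torusLaplacian f p + (P p : ℂ) * f p from funext hg]
  exact coeFn_toL2 (hf.torusLaplacian.neg.memLp.add (memLp_potential_mul hP hC hf.memLp))

theorem exists_eq_of_mem_torusGraph (hP : AEStronglyMeasurable P volume) (hC : ∀ᵐ p, |P p| ≤ C)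
    {q} (hq : q ∈ torusGraph P) : ∃ f : Torus d → ℂ, TorusSmooth f ∧ q.1 = toL2 volume f ∧
      q.2 = -toL2 volume (torusLaplacian f) + toL2 volume (fun p => (P p : ℂ) * f p) := by
  obtain ⟨f, hf, h1, h2⟩ := hq
  refine ⟨f, hf, (toL2_eq h1).symm, ?_⟩
  rw [← toL2_eq h2, ← toL2_neg hf.torusLaplacian.memLp,
    ← toL2_add hf.torusLaplacian.neg.memLp (memLp_potential_mul hP hC hf.memLp)]

theorem isSymmetricGraph_torusGraph (hP : AEStronglyMeasurable P volume)
    (hC : ∀ᵐ p, |P p| ≤ C) : IsSymmetricGraph (torusGraph P) := by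
  intro p hp q hq
  obtain ⟨f, hf, h1, h2⟩ := exists_eq_of_mem_torusGraph hP hC hp
  obtain ⟨g, hg, h3, h4⟩ := exists_eq_of_mem_torusGraph hP hC hq
  have hPf := memLp_potential_mul hP hC hf.memLp
  have hPg := memLp_potential_mul hP hC hg.memLp
  rw [h1, h2, h3, h4, inner_add_left, inner_add_right, inner_neg_left, inner_neg_right,
    inner_toL2 hf.torusLaplacian.memLp hg.memLp, inner_toL2 hf.memLp hg.torusLaplacian.memLp,
    inner_toL2 hPf hg.memLp, inner_toL2 hf.memLp hPg]
  congr 2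
  · have h := integral_mul_torusLaplacian hf.conj hg
    rw [h]
    refine integral_congr_ae (ae_of_all _ fun p => ?_)
    simp only [torusLaplacian_conj hf]
  · funext p
    simp only [map_mul, Complex.conj_ofReal]
    ring

/-- A character is an eigenvector of `-Δ` with the real eigenvalue `|k|²`, so `|k|² + z` is
invertible for `z` nonreal. -/
theorem torusChar_mem_range_torusGraph (z : ℂ) (hz : z.im ≠ 0) (k : Fin d → ℤ) :
    ∃ p ∈ torusGraph (d := d) 0, p.2 + z • p.1 = toL2 volume (torusChar k) := by
  have hk := torusSmooth_torusChar (d := d) k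
  have hmem := mk_mem_torusGraph (P := (0 : Torus d → ℝ)) (C := 0)
    aestronglyMeasurable_zero (by simp) hk
    (g := fun p => ((∑ j, (k j : ℝ) ^ 2 : ℝ) : ℂ) * torusChar k p)
    (fun p => by rw [torusLaplacian_torusChar]; simp)
  set c : ℂ := ((∑ j, (k j : ℝ) ^ 2 : ℝ) : ℂ) + z with hc
  have hc0 : c ≠ 0 := by
    intro h
    apply hz
    have := congrArg Complex.im h
    simpa only [hc, Complex.add_im, Complex.ofReal_im, zero_add, Complex.zero_im] using this
  refine ⟨_, (torusGraph 0).smul_mem c⁻¹ hmem, ?_⟩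
  rw [Prod.smul_fst, Prod.smul_snd, toL2_smul _ hk.memLp]
  simp only [smul_smul]
  rw [← add_smul]
  have : c⁻¹ * ((∑ j, (k j : ℝ) ^ 2 : ℝ) : ℂ) + z * c⁻¹ = 1 := by
    rw [mul_comm z, ← mul_add, ← hc, inv_mul_cancel₀ hc0]
  rw [this, one_smul]

theorem dense_range_torusGraph_zero {l : ℝ} (hl : l ≠ 0) :
    Dense {w | ∃ p ∈ torusGraph (d := d) 0, p.2 + (Complex.I * l) • p.1 = w} := by
  let K := (torusGraph (d := d) 0).map (LinearMap.snd ℂ _ _ +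
    (Complex.I * (l : ℂ)) • LinearMap.fst ℂ _ _)
  have hK : (K : Set _) = {w | ∃ p ∈ torusGraph (d := d) 0, p.2 + (Complex.I * l) • p.1 = w} := by
    ext w
    simp [K]
  rw [← hK]
  refine dense_span_torusChar.mono ?_
  rw [SetLike.coe_subset_coe, Submodule.span_le]
  rintro _ ⟨k, rfl⟩
  rw [hK]
  exact torusChar_mem_range_torusGraph _ (by simpa using hl) k

theorem dense_domain_torusGraph (hP : AEStronglyMeasurable P volume) (hC : ∀ᵐ p, |P p| ≤ C) :
    Dense {x | ∃ y, (x, y) ∈ torusGraph P} := by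
  let K := (torusGraph P).map (LinearMap.fst ℂ _ _)
  have hK : (K : Set _) = {x | ∃ y, (x, y) ∈ torusGraph P} := by
    ext w
    simp [K]
  rw [← hK]
  refine dense_span_torusChar.mono ?_
  rw [SetLike.coe_subset_coe, Submodule.span_le]
  rintro _ ⟨k, rfl⟩
  exact ⟨_, mk_mem_torusGraph hP hC (torusSmooth_torusChar k) fun p => rfl, rfl⟩

/-- The free operator has a dense range by diagonalisation; a potential bounded by `C` is a
perturbation that is harmless once `|l| > |C|`. -/
theorem exists_isPropagator_torusGraph (hP : AEStronglyMeasurable P volume)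
    (hC : ∀ᵐ p, |P p| ≤ C) : ∃ U, IsPropagator (torusGraph P :
      Set (Lp ℂ 2 (volume : Measure (Torus d)) × Lp ℂ 2 (volume : Measure (Torus d)))) U := by
  refine exists_isPropagator (isSymmetricGraph_torusGraph hP hC) (dense_domain_torusGraph hP hC)
    (|C| + 1) fun l hl => ?_
  have hl0 : 0 < |l| := lt_of_lt_of_le (by positivity) hl
  have h0 : AEStronglyMeasurable (0 : Torus d → ℝ) volume := aestronglyMeasurable_zero
  have h0' : ∀ᵐ p : Torus d, |(0 : Torus d → ℝ) p| ≤ 0 := by simp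
  refine (isSymmetricGraph_torusGraph h0 h0').dense_range_of_perturbation (abs_nonneg C)
    (by linarith) (dense_range_torusGraph_zero (abs_pos.1 hl0)) fun p hp => ?_
  obtain ⟨f, hf, h1, h2⟩ := exists_eq_of_mem_torusGraph h0 h0' hp
  have hPf := memLp_potential_mul hP hC hf.memLp
  refine ⟨toL2 volume fun p => (P p : ℂ) * f p, ?_, ?_⟩
  · have := mk_mem_torusGraph hP hC hf fun p => rfl
    rw [toL2_add hf.torusLaplacian.neg.memLp hPf, toL2_neg hf.torusLaplacian.memLp] at this
    have e : p.2 = -toL2 volume (torusLaplacian f) := by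
      rw [h2]
      have : toL2 (volume : Measure (Torus d)) (fun p => (((0 : Torus d → ℝ) p : ℝ) : ℂ) * f p) =
          0 := by
        refine toL2_eq ((Lp.coeFn_zero _ _ _).trans ?_)
        exact ae_of_all _ fun p => by simp
      rw [this, add_zero]
    rw [h1, e]
    exact this
  · rw [h1]
    refine norm_toL2_le hPf.1 hf.memLp _ ?_
    filter_upwards [hC] with p hp
    rw [norm_mul, Complex.norm_real, Real.norm_eq_abs]
    have := hp.trans (le_abs_self C)
    gcongr

theorem sin_lift_bInner (j : Fin d) (p : Torus d) :
    Real.sin_periodic.lift (bInner j p) = (torusChar (bVec j) p).im := by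
  rw [bInner, torusChar]
  generalize (∑ i, bVec j i • p i) = t
  induction t using QuotientAddGroup.induction_on with
  | H t =>
    rw [Function.Periodic.lift_coe, toCircle_coe, mul_comm, Complex.exp_ofReal_mul_I_im]

theorem cos_lift_bInner (j : Fin d) (p : Torus d) :
    Real.cos_periodic.lift (bInner j p) = (torusChar (bVec j) p).re := by
  rw [bInner, torusChar]
  generalize (∑ i, bVec j i • p i) = t
  induction t using QuotientAddGroup.induction_on with
  | H t =>
    rw [Function.Periodic.lift_coe, toCircle_coe, mul_comm, Complex.exp_ofReal_mul_I_re]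

theorem torusPotential_eq (V : Torus d → ℝ) (u : Fin d × Fin 2 → ℝ) (p : Torus d) :
    torusPotential V u p = V p +
      ∑ j, (u (j, 0) * (torusChar (bVec j) p).im + u (j, 1) * (torusChar (bVec j) p).re) := by
  simp only [torusPotential, sin_lift_bInner, cos_lift_bInner]

theorem torusPotential_bounded {V : Torus d → ℝ} (hV : MemLp V ⊤ volume)
    (u : Fin d × Fin 2 → ℝ) :
    AEStronglyMeasurable (torusPotential V u) volume ∧
      ∃ C, ∀ᵐ p, |torusPotential V u p| ≤ C := by
  have hc : Continuous fun p : Torus d =>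
      ∑ j, (u (j, 0) * (torusChar (bVec j) p).im + u (j, 1) * (torusChar (bVec j) p).re) := by
    have : ∀ j : Fin d, Continuous (torusChar (bVec j)) := fun j =>
      (torusSmooth_torusChar _).continuous
    fun_prop
  have e : torusPotential V u = fun p => V p +
      ∑ j, (u (j, 0) * (torusChar (bVec j) p).im + u (j, 1) * (torusChar (bVec j) p).re) :=
    funext (torusPotential_eq V u)
  rw [e]
  refine ⟨hV.1.add hc.aestronglyMeasurable, ?_⟩
  obtain ⟨C, hC⟩ := isCompact_univ.exists_bound_of_continuousOn hc.continuousOn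
  refine ⟨(eLpNormEssSup V volume).toReal + C, ?_⟩
  have hV' : eLpNormEssSup V volume ≠ ⊤ := by
    have := hV.2.ne
    rwa [eLpNorm_exponent_top] at this
  filter_upwards [ae_le_eLpNormEssSup (f := V) (μ := volume)] with p hp
  refine (abs_add_le _ _).trans (add_le_add ?_ (hC p (Set.mem_univ p)))
  have := ENNReal.toReal_mono hV' hp
  simpa using this

theorem exists_isPropagator_torusSystem {V : Torus d → ℝ} (hV : MemLp V ⊤ volume)
    (u : Fin d × Fin 2 → ℝ) : ∃ U, IsPropagator (torusSystem V u) U := by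
  obtain ⟨h1, C, hC⟩ := torusPotential_bounded hV u
  exact exists_isPropagator_torusGraph h1 hC

end TorusSystem

/-! ### Small-time limits on the torus -/

section TorusLimits

variable {d : ℕ}

/-- `φ` is a smooth real function on the torus. -/
def TorusSmoothReal (φ : Torus d → ℝ) : Prop := TorusSmooth fun p => (φ p : ℂ)

theorem TorusSmoothReal.continuous {φ : Torus d → ℝ} (hφ : TorusSmoothReal φ) : Continuous φ := by
  have := Complex.continuous_re.comp (TorusSmooth.continuous hφ)
  exact this

theorem TorusSmoothReal.aestronglyMeasurable {φ : Torus d → ℝ} (hφ : TorusSmoothReal φ) :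
    AEStronglyMeasurable φ volume := hφ.continuous.aestronglyMeasurable

theorem TorusSmoothReal.expI {φ : Torus d → ℝ} (hφ : TorusSmoothReal φ) :
    TorusSmooth (expI φ) := (TorusSmooth.const_mul Complex.I hφ).cexp

theorem TorusSmoothReal.sub_mul {φ w : Torus d → ℝ} (hφ : TorusSmoothReal φ)
    (hw : TorusSmoothReal w) (r s : ℝ) : TorusSmoothReal fun p => r * φ p - s * w p := by
  have := (TorusSmooth.const_mul r hφ).add (TorusSmooth.const_mul (-s) hw)
  refine (congrArg TorusSmooth ?_).mp this
  funext p
  push_cast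
  ring

/-- The remainder in the conjugation of `-Δ + V` by the phase `e^{i(rφ - sw)}`. -/
def torusRemainder (V φ w : Torus d → ℝ) (f : Torus d → ℂ) (r s : ℝ) (p : Torus d) : ℂ :=
  (V p * f p - torusLaplacian f p) +
    r * (-(2 * Complex.I * torusGrad (fun p => (φ p : ℂ)) f p) -
      Complex.I * torusLaplacian (fun p => (φ p : ℂ)) p * f p) +
    s * (2 * Complex.I * torusGrad (fun p => (w p : ℂ)) f p +
      Complex.I * torusLaplacian (fun p => (w p : ℂ)) p * f p) -
    r * s * (2 * torusGrad (fun p => (φ p : ℂ)) (fun p => (w p : ℂ)) p * f p) +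
    s ^ 2 * (torusGrad (fun p => (w p : ℂ)) (fun p => (w p : ℂ)) p * f p)

/-- The term `r²|∇φ|²` is isolated because it is the only one growing faster than `r`. The drift
`Vf` is subtracted here and included in the remainder, so that it disappears when the potential is
added to `-Δ`. -/
theorem neg_torusLaplacian_expI_mul (V : Torus d → ℝ) {φ w : Torus d → ℝ}
    (hφ : TorusSmoothReal φ) (hw : TorusSmoothReal w) {f : Torus d → ℂ} (hf : TorusSmooth f)
    (r s : ℝ) (p : Torus d) :
    -torusLaplacian (fun p => expI (fun y => r * φ y - s * w y) p * f p) p =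
      expI (fun y => r * φ y - s * w y) p *
        (r ^ 2 * torusGrad (fun p => (φ p : ℂ)) (fun p => (φ p : ℂ)) p * f p - V p * f p +
          torusRemainder V φ w f r s p) := by
  have hφ' : TorusSmooth fun p => (φ p : ℂ) := hφ
  have hw' : TorusSmooth fun p => (w p : ℂ) := hw
  set Θ : Torus d → ℂ := fun p => (r : ℂ) * φ p + (-s : ℂ) * w p with hΘ
  have hΘs : TorusSmooth Θ := (TorusSmooth.const_mul r hφ).add (TorusSmooth.const_mul (-s : ℂ) hw)
  have e : ∀ p, expI (fun y => r * φ y - s * w y) p = Complex.exp (Complex.I * Θ p) := by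
    intro p
    rw [expI, hΘ]
    push_cast
    ring_nf
  simp only [e]
  rw [torusLaplacian_exp_mul hΘs hf]
  have hD : ∀ j p, torusDeriv j Θ p = (r : ℂ) * torusDeriv j (fun p => (φ p : ℂ)) p +
      (-s : ℂ) * torusDeriv j (fun p => (w p : ℂ)) p := by
    intro j p
    rw [hΘ, torusDeriv_add (hφ'.const_mul _) (hw'.const_mul _), torusDeriv_const_mul _ hφ',
      torusDeriv_const_mul _ hw']
  have hL : torusLaplacian Θ p = (r : ℂ) * torusLaplacian (fun p => (φ p : ℂ)) p +
      (-s : ℂ) * torusLaplacian (fun p => (w p : ℂ)) p := by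
    rw [hΘ, torusLaplacian_add (hφ'.const_mul _) (hw'.const_mul _),
      torusLaplacian_const_mul _ hφ', torusLaplacian_const_mul _ hw']
  have hG1 : torusGrad Θ f p = (r : ℂ) * torusGrad (fun p => (φ p : ℂ)) f p +
      (-s : ℂ) * torusGrad (fun p => (w p : ℂ)) f p := by
    simp only [torusGrad, hD, Finset.mul_sum, ← Finset.sum_add_distrib]
    exact Finset.sum_congr rfl fun j _ => by ring
  have hG2 : torusGrad Θ Θ p =
      (r : ℂ) ^ 2 * torusGrad (fun p => (φ p : ℂ)) (fun p => (φ p : ℂ)) p +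
      (-(2 * r * s) : ℂ) * torusGrad (fun p => (φ p : ℂ)) (fun p => (w p : ℂ)) p +
      (s : ℂ) ^ 2 * torusGrad (fun p => (w p : ℂ)) (fun p => (w p : ℂ)) p := by
    simp only [torusGrad, hD, Finset.mul_sum, ← Finset.sum_add_distrib]
    exact Finset.sum_congr rfl fun j _ => by ring
  rw [hL, hG1, hG2, torusRemainder]
  ring

/-- The remainder is a polynomial in `r` and `s`, of degree one in `r`, with fixed coefficients in
`L²`. This linear growth is decisive: over a time `r⁻²` the resulting error tends to `0`. -/
theorem exists_norm_torusRemainder_le {V : Torus d → ℝ} (hV : MemLp V ⊤ volume)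
    {φ w : Torus d → ℝ} (hφ : TorusSmoothReal φ) (hw : TorusSmoothReal w) {f : Torus d → ℂ}
    (hf : TorusSmooth f) :
    (∀ r s, MemLp (torusRemainder V φ w f r s) 2 volume) ∧
      ∃ Q, 0 ≤ Q ∧ ∀ r, 0 ≤ r → ∀ s ∈ Set.Icc (0 : ℝ) 1,
        ‖toL2 volume (torusRemainder V φ w f r s)‖ ≤ (1 + r) * Q := by
  have hφ' : TorusSmooth fun p => (φ p : ℂ) := hφ
  have hw' : TorusSmooth fun p => (w p : ℂ) := hw
  obtain ⟨hVm, C, hC⟩ := torusPotential_bounded hV 0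
  have hV0 : torusPotential V 0 = V := by
    funext p
    simp [torusPotential]
  rw [hV0] at hVm hC
  have h0 : MemLp (fun p => V p * f p - torusLaplacian f p) 2 volume :=
    (memLp_potential_mul hVm hC hf.memLp).sub hf.torusLaplacian.memLp
  have h1 : MemLp (fun p => -(2 * Complex.I * torusGrad (fun p => (φ p : ℂ)) f p) -
      Complex.I * torusLaplacian (fun p => (φ p : ℂ)) p * f p) 2 volume :=
    ((hφ'.torusGrad hf).const_mul _).neg.memLp.sub
      ((hφ'.torusLaplacian.const_mul Complex.I).mul hf).memLp
  have h2 : MemLp (fun p => 2 * Complex.I * torusGrad (fun p => (w p : ℂ)) f p +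
      Complex.I * torusLaplacian (fun p => (w p : ℂ)) p * f p) 2 volume :=
    (((hw'.torusGrad hf).const_mul _).add
      ((hw'.torusLaplacian.const_mul Complex.I).mul hf)).memLp
  have h3 : MemLp (fun p => 2 * torusGrad (fun p => (φ p : ℂ)) (fun p => (w p : ℂ)) p * f p) 2
      volume := (((hφ'.torusGrad hw').const_mul 2).mul hf).memLp
  have h4 : MemLp (fun p => torusGrad (fun p => (w p : ℂ)) (fun p => (w p : ℂ)) p * f p) 2
      volume := ((hw'.torusGrad hw').mul hf).memLp
  have e1 := fun r : ℝ => h0.add (h1.const_mul (r : ℂ))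
  have e2 := fun r s : ℝ => (e1 r).add (h2.const_mul (s : ℂ))
  have e3 := fun r s : ℝ => (e2 r s).sub (h3.const_mul ((r : ℂ) * s))
  have e4 := fun r s : ℝ => (e3 r s).add (h4.const_mul ((s : ℂ) ^ 2))
  refine ⟨e4, ‖toL2 volume (fun p => V p * f p - torusLaplacian f p)‖ +
    ‖toL2 volume (fun p => -(2 * Complex.I * torusGrad (fun p => (φ p : ℂ)) f p) -
      Complex.I * torusLaplacian (fun p => (φ p : ℂ)) p * f p)‖ +
    ‖toL2 volume (fun p => 2 * Complex.I * torusGrad (fun p => (w p : ℂ)) f p +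
      Complex.I * torusLaplacian (fun p => (w p : ℂ)) p * f p)‖ +
    ‖toL2 volume (fun p => 2 * torusGrad (fun p => (φ p : ℂ)) (fun p => (w p : ℂ)) p * f p)‖ +
    ‖toL2 volume (fun p => torusGrad (fun p => (w p : ℂ)) (fun p => (w p : ℂ)) p * f p)‖,
    by positivity, fun r hr s hs => ?_⟩
  have e : toL2 volume (torusRemainder V φ w f r s) =
      toL2 volume (fun p => V p * f p - torusLaplacian f p) +
      (r : ℂ) • toL2 volume (fun p => -(2 * Complex.I * torusGrad (fun p => (φ p : ℂ)) f p) -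
        Complex.I * torusLaplacian (fun p => (φ p : ℂ)) p * f p) +
      (s : ℂ) • toL2 volume (fun p => 2 * Complex.I * torusGrad (fun p => (w p : ℂ)) f p +
        Complex.I * torusLaplacian (fun p => (w p : ℂ)) p * f p) -
      ((r : ℂ) * s) • toL2 volume
        (fun p => 2 * torusGrad (fun p => (φ p : ℂ)) (fun p => (w p : ℂ)) p * f p) +
      ((s : ℂ) ^ 2) • toL2 volume
        (fun p => torusGrad (fun p => (w p : ℂ)) (fun p => (w p : ℂ)) p * f p) := by
    rw [← toL2_smul _ h1, ← toL2_smul _ h2, ← toL2_smul _ h3, ← toL2_smul _ h4,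
      ← toL2_add h0 (h1.const_mul _)]
    refine (toL2_add (e3 r s) (h4.const_mul _)).trans ?_
    congr 1
    refine (toL2_sub (e2 r s) (h3.const_mul _)).trans ?_
    congr 1
    exact toL2_add (e1 r) (h2.const_mul _)
  rw [e]
  have hs2 : s ^ 2 ≤ 1 := pow_le_one₀ hs.1 hs.2
  have hrs : r * s ≤ 1 + r := by nlinarith [hs.2]
  have hn : ∀ (a b c z e : Lp ℂ 2 (volume : Measure (Torus d))),
      ‖a + (r : ℂ) • b + (s : ℂ) • c - ((r : ℂ) * s) • z + ((s : ℂ) ^ 2) • e‖ ≤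
        (1 + r) * (‖a‖ + ‖b‖ + ‖c‖ + ‖z‖ + ‖e‖) := by
    intro a b c z e
    have t1 := norm_add_le (a + (r : ℂ) • b + (s : ℂ) • c - ((r : ℂ) * s) • z) (((s : ℂ) ^ 2) • e)
    have t2 := norm_sub_le (a + (r : ℂ) • b + (s : ℂ) • c) (((r : ℂ) * s) • z)
    have t3 := norm_add_le (a + (r : ℂ) • b) ((s : ℂ) • c)
    have t4 := norm_add_le a ((r : ℂ) • b)
    simp only [norm_smul, norm_mul, norm_pow, Complex.norm_real, Real.norm_eq_abs, abs_of_nonneg hr,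
      abs_of_nonneg hs.1] at t1 t2 t3 t4
    have u1 : r * ‖b‖ ≤ (1 + r) * ‖b‖ := by gcongr; linarith
    have u2 : s * ‖c‖ ≤ (1 + r) * ‖c‖ := by gcongr; linarith [hs.2]
    have u3 : r * s * ‖z‖ ≤ (1 + r) * ‖z‖ := by gcongr
    have u4 : s ^ 2 * ‖e‖ ≤ (1 + r) * ‖e‖ := by gcongr; linarith
    have u5 : ‖a‖ ≤ (1 + r) * ‖a‖ := le_mul_of_one_le_left (norm_nonneg _) (by linarith)
    linarith
  exact hn _ _ _ _ _

/-- Over a small time `τ`, the propagator of a potential `V + κ w` acts on the phase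
`e^{irφ}` as the phase `e^{-iw}`, if `r² |∇φ|² + κ w = τ⁻¹ w`. -/
theorem norm_torus_phase_sub_propagator_le {V : Torus d → ℝ} (hV : MemLp V ⊤ volume)
    {φ w : Torus d → ℝ} (hφ : TorusSmoothReal φ) (hw : TorusSmoothReal w) {f : Torus d → ℂ}
    (hf : TorusSmooth f) : ∃ Q, 0 ≤ Q ∧ ∀ (r τ : ℝ) (u : Fin d × Fin 2 → ℝ) U,
      0 ≤ r → 0 < τ → IsPropagator (torusSystem V u) U →
      (∀ p, (r : ℂ) ^ 2 * torusGrad (fun p => (φ p : ℂ)) (fun p => (φ p : ℂ)) p +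
        (torusPotential V u p - V p) = (τ : ℂ)⁻¹ * w p) →
      ‖toL2 volume (fun x => expI (fun y => r * φ y - w y) x * f x) -
        U τ (toL2 volume fun x => expI (fun y => r * φ y) x * f x)‖ ≤ τ * ((1 + r) * Q) := by
  obtain ⟨hm, Q, hQ0, hQ⟩ := exists_norm_torusRemainder_le hV hφ hw hf
  refine ⟨Q, hQ0, fun r τ u U hr hτ hU h => ?_⟩
  obtain ⟨C, hC⟩ := TorusSmooth.exists_norm_le hw
  have hφm : AEStronglyMeasurable (fun y => r * φ y) volume :=
    hφ.aestronglyMeasurable.const_mul r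
  refine norm_phase_sub_propagator_le hU hτ hφm hw.aestronglyMeasurable hf.memLp (C := C)
    (fun x _ => by simpa using hC x) (q := fun s => torusRemainder V φ w f r s) (fun s => hm r s)
    (fun s hs => subset_closure ?_) (fun s hs => hQ r hr s hs)
  obtain ⟨h1, C', hC'⟩ := torusPotential_bounded hV u
  refine mk_mem_torusGraph h1 hC' ((hφ.sub_mul hw r s).expI.mul hf) fun p => ?_
  rw [neg_torusLaplacian_expI_mul V hφ hw hf]
  linear_combination (-expI (fun y => r * φ y - s * w y) p * f p) * h p

theorem PhaseReach.of_torusSmooth {ι : Type*}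
    {G : (ι → ℝ) → Set (Lp ℂ 2 (volume : Measure (Torus d)) × Lp ℂ 2 (volume : Measure (Torus d)))}
    {φ : Torus d → ℝ} (hφ : AEStronglyMeasurable φ volume)
    (h : ∀ f, TorusSmooth f → ApproxReach G 0 (toL2 volume f)
      (toL2 volume fun p => expI φ p * f p)) : PhaseReach G φ := by
  have hd : Dense {x : Lp ℂ 2 (volume : Measure (Torus d)) | ∃ f, TorusSmooth f ∧
      toL2 volume f = x} := by
    refine (dense_domain_torusGraph (P := (0 : Torus d → ℝ)) (C := 0)
      aestronglyMeasurable_zero (by simp)).mono ?_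
    rintro x ⟨y, f, hf, h1, -⟩
    exact ⟨f, hf, toL2_eq h1⟩
  refine ApproxReach.of_dense hd (phaseIsometry hφ) ?_
  rintro _ ⟨f, hf, rfl⟩
  rw [phaseIsometry_toL2 hφ hf.memLp]
  exact h f hf

/-- The phases of the controlled potentials are reachable. -/
theorem phaseReach_torus_control {V : Torus d → ℝ} (hV : MemLp V ⊤ volume)
    (u : Fin d × Fin 2 → ℝ) :
    PhaseReach (torusSystem V) (fun p => -∑ j, (u (j, 0) * (torusChar (bVec j) p).im +
      u (j, 1) * (torusChar (bVec j) p).re)) := by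
  set w : Torus d → ℝ := fun p => ∑ j, (u (j, 0) * (torusChar (bVec j) p).im +
      u (j, 1) * (torusChar (bVec j) p).re) with hwdef
  have hw : TorusSmoothReal w := by
    have h1 : TorusSmooth fun p => ∑ j, (((u (j, 1) : ℂ) - Complex.I * u (j, 0)) / 2 *
        torusChar (bVec j) p + ((u (j, 1) : ℂ) + Complex.I * u (j, 0)) / 2 *
          torusChar (-bVec j) p) :=
      TorusSmooth.sum fun j _ => ((torusSmooth_torusChar _).const_mul _).add
        ((torusSmooth_torusChar _).const_mul _)
    refine (congrArg TorusSmooth (funext fun p => ?_)).mp h1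
    rw [hwdef]
    push_cast
    refine Finset.sum_congr rfl fun j _ => ?_
    rw [torusChar_neg]
    apply Complex.ext <;> simp <;> ring
  have hwm := hw.aestronglyMeasurable
  refine PhaseReach.of_torusSmooth hwm.neg fun f hf => ApproxReach.of_forall fun ε hε => ?_
  have h0 : TorusSmoothReal (fun _ : Torus d => 0) := by
    have := TorusSmooth.const (d := d) 0
    simpa [TorusSmoothReal] using this
  obtain ⟨Q, hQ0, hQ⟩ := norm_torus_phase_sub_propagator_le hV h0 hw hf
  -- Take `φ = 0` and `r = 0` in the estimate: the control `τ⁻¹u` during the time `τ` produces the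
  -- phase `e^{-iw}` with an error `τQ`.
  set τ : ℝ := min ε (ε / (2 * (Q + 1))) with hτdef
  have hτ : 0 < τ := lt_min hε (by positivity)
  obtain ⟨U, hU⟩ := exists_isPropagator_torusSystem hV (fun i => τ⁻¹ * u i)
  have h := hQ 0 τ _ U le_rfl hτ hU (fun p => by
    have hgrad : torusGrad (fun p : Torus d => ((0 : ℝ) : ℂ)) (fun p => ((0 : ℝ) : ℂ)) p = 0 := by
      simp [torusGrad, torusDeriv_const]
    rw [hgrad, torusPotential_eq, hwdef]
    push_cast
    rw [Finset.mul_sum]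
    simp only [mul_add, mul_assoc]
    ring)
  have hτQ : τ * Q < ε := by
    have h1 : τ ≤ ε / (2 * (Q + 1)) := min_le_right _ _
    rw [le_div_iff₀ (by positivity)] at h1
    nlinarith
  refine ⟨τ, by rw [zero_add]; exact min_le_left _ _, U τ (toL2 volume f), hU.approxReach hτ _, ?_⟩
  rw [norm_sub_rev]
  have e1 : (fun x => expI (fun y : Torus d => (0 : ℝ) * 0) x * f x) = f := by
    funext x
    simp [expI]
  simp only [mul_zero, zero_sub] at h e1
  rw [e1] at h
  refine h.trans_lt ?_
  simpa using hτQ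

/-- The squared gradients of reachable phases are reachable. -/
theorem phaseReach_torus_grad {V : Torus d → ℝ} (hV : MemLp V ⊤ volume)
    {φ w : Torus d → ℝ} (hφ : TorusSmoothReal φ) (hw : TorusSmoothReal w)
    (hφw : ∀ p, torusGrad (fun p => (φ p : ℂ)) (fun p => (φ p : ℂ)) p = w p)
    (hr : ∀ r : ℝ, PhaseReach (torusSystem V) (fun p => r * φ p)) :
    PhaseReach (torusSystem V) (fun p => -w p) := by
  have hwm := hw.aestronglyMeasurable
  refine PhaseReach.of_torusSmooth hwm.neg fun f hf => ApproxReach.of_forall fun ε hε => ?_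
  obtain ⟨Q, hQ0, hQ⟩ := norm_torus_phase_sub_propagator_le hV hφ hw hf
  -- Since `r ≥ 1`, the error `r⁻²(1 + r)Q` is at most `2Q/r`; this choice makes it, and the
  -- duration `r⁻²`, smaller than `ε`.
  set r : ℝ := 1 + (1 + 2 * Q) / ε with hrdef
  have hr1 : 1 ≤ r := by
    rw [hrdef]
    have : 0 ≤ (1 + 2 * Q) / ε := by positivity
    linarith
  have hrε : 1 + 2 * Q < r * ε := by
    rw [hrdef, add_mul, div_mul_cancel₀ _ hε.ne']
    linarith
  have hr0 : 0 < r := by linarith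
  set τ : ℝ := (r ^ 2)⁻¹ with hτdef
  have hτ : 0 < τ := by positivity
  obtain ⟨U, hU⟩ := exists_isPropagator_torusSystem hV 0
  have hp0 : ∀ p, torusPotential V 0 p = V p := fun p => by simp [torusPotential]
  have h := hQ r τ _ U hr0.le hτ hU (fun p => by
    rw [hp0, sub_self, add_zero, hφw, hτdef]
    push_cast
    rw [inv_inv])
  have hτε : τ ≤ ε := by
    rw [hτdef, inv_le_comm₀ (by positivity) hε, inv_le_iff_one_le_mul₀ hε]
    nlinarith
  have hτQ : τ * ((1 + r) * Q) < ε := by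
    rw [hτdef, inv_mul_lt_iff₀ (by positivity)]
    nlinarith
  have hm : ∀ r : ℝ, AEStronglyMeasurable (fun y => r * φ y) volume := fun r =>
    hφ.aestronglyMeasurable.const_mul r
  have hmf := memLp_expI_mul (hm r) hf.memLp
  -- Three moves: the phase `e^{irφ}`, the free evolution for the time `r⁻²`, then the phase
  -- `e^{-irφ}`.
  have s1 : ApproxReach (torusSystem V) 0 (toL2 volume f)
      (toL2 volume fun x => expI (fun y => r * φ y) x * f x) := by
    have := hr r (toL2 volume f)
    rwa [← phaseIsometry_apply (hm r), phaseIsometry_toL2 (hm r) hf.memLp] at this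
  have s2 := s1.trans (hU.approxReach hτ _)
  have s3 := s2.trans (hr (-r) _)
  refine ⟨_, ?_, _, s3, ?_⟩
  · simpa using hτε
  · rw [← phaseIsometry_apply (hm (-r))]
    have e : toL2 volume (fun p => expI (fun y => -w y) p * f p) = phaseIsometry (hm (-r))
        (toL2 volume fun p => expI (fun y => r * φ y - w y) p * f p) := by
      have hd : AEStronglyMeasurable (fun y => r * φ y - w y) volume := (hm r).sub hwm
      rw [phaseIsometry_toL2 (hm (-r)) (memLp_expI_mul hd hf.memLp)]
      congr 1
      funext p
      rw [← mul_assoc, ← expI_add]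
      congr 2
      funext y
      ring
    rw [e, ← map_sub, LinearIsometry.norm_map, norm_sub_rev]
    exact h.trans_lt hτQ

end TorusLimits

/-! ### Reachability of all phases on the torus -/

section TorusModes

variable {d : ℕ}

theorem torusDeriv_ofReal_re {f : Torus d → ℂ} (hf : TorusSmooth f) (j : Fin d) (p : Torus d) :
    torusDeriv j (fun p => ((f p).re : ℂ)) p = ((torusDeriv j f p).re : ℂ) :=
  torusDeriv_eq ((Complex.ofRealCLM.comp Complex.reCLM).hasFDerivAt.comp_hasDerivAt 0
    (hf.hasDerivAt_zero j p))

theorem TorusSmooth.ofReal_re {f : Torus d → ℂ} (hf : TorusSmooth f) :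
    TorusSmoothReal (fun p => (f p).re) :=
  (Complex.ofRealCLM.comp Complex.reCLM).contDiff.comp (torusSmooth_iff.1 hf)

/-- All the phases `Re(c e^{i⟨k, x⟩})` are reachable. -/
def ModeReach (V : Torus d → ℝ) (k : Fin d → ℤ) : Prop :=
  ∀ c : ℂ, PhaseReach (torusSystem V) (fun p => (c * torusChar k p).re)

theorem aestronglyMeasurable_mode (c : ℂ) (k : Fin d → ℤ) :
    AEStronglyMeasurable (fun p => (c * torusChar k p).re) volume :=
  ((torusSmooth_torusChar k).const_mul c).ofReal_re.aestronglyMeasurable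

variable {V : Torus d → ℝ}

theorem ModeReach.zero : ModeReach V 0 := fun c => by
  simp only [torusChar_zero, mul_one]
  exact PhaseReach.const _

theorem ModeReach.neg {k : Fin d → ℤ} (h : ModeReach V k) : ModeReach V (-k) := fun c => by
  have := h ((starRingEnd ℂ) c)
  refine (congrArg (PhaseReach (torusSystem V)) (funext fun p => ?_)).mp this
  rw [torusChar_neg]
  simp

theorem modeReach_bVec (hV : MemLp V ⊤ volume) (j : Fin d) : ModeReach V (bVec j) := fun c => by
  classical
  -- The reachable phase is the opposite of the controlled potential, and `Re(c e^{iθ}) = Re c cos θ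
  -- - Im c sin θ`, which gives the signs.
  have h := phaseReach_torus_control hV
    (fun i => if i.1 = j then (if i.2 = 0 then c.im else -c.re) else 0)
  refine (congrArg (PhaseReach (torusSystem V)) (funext fun p => ?_)).mp h
  rw [Finset.sum_eq_single j]
  · simp
    ring
  · intro i _ hi
    simp [hi]
  · simp

/-- The quadratic interaction of two modes. -/
theorem ModeReach.phaseReach_interaction (hV : MemLp V ⊤ volume) {k l : Fin d → ℤ}
    (hk : ModeReach V k) (hl : ModeReach V l) (a b : ℂ) :
    PhaseReach (torusSystem V) (fun p =>
      (((∑ i, k i ^ 2 : ℤ) : ℂ) / 2 * a ^ 2 * torusChar (k + k) p).re +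
      ((((∑ i, l i ^ 2 : ℤ) : ℂ) / 2 * b ^ 2 * torusChar (l + l) p).re +
      ((((∑ i, k i * l i : ℤ) : ℂ) * (a * b) * torusChar (k + l) p).re -
      (((∑ i, k i * l i : ℤ) : ℂ) * (a * (starRingEnd ℂ) b) * torusChar (k - l) p).re))) := by
  set A : Torus d → ℂ := fun p => a * torusChar k p with hA
  set B : Torus d → ℂ := fun p => b * torusChar l p with hB
  have hAs : TorusSmooth A := (torusSmooth_torusChar k).const_mul a
  have hBs : TorusSmooth B := (torusSmooth_torusChar l).const_mul b
  set φ : Torus d → ℝ := fun p => (A p).re + (B p).re with hφdef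
  have hφ : TorusSmoothReal φ := by
    have := hAs.add hBs
    refine (congrArg TorusSmoothReal (funext fun p => ?_)).mp this.ofReal_re
    simp [hφdef]
  -- This is `|∇φ|²`: the derivative of `Re A` along the `j`-th coordinate is `-k_j Im A`, and
  -- similarly for `B`.
  set w : Torus d → ℝ := fun p => ∑ j, (k j * (A p).im + l j * (B p).im) ^ 2 with hwdef
  have hgrad : ∀ p, torusGrad (fun p => (φ p : ℂ)) (fun p => (φ p : ℂ)) p = w p := by
    intro p
    have hD : ∀ j, torusDeriv j (fun p => (φ p : ℂ)) p =
        ((-(k j * (A p).im + l j * (B p).im) : ℝ) : ℂ) := by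
      intro j
      have e : (fun p => (φ p : ℂ)) = fun p => (((A p + B p).re : ℝ) : ℂ) := by
        funext p; simp [hφdef]
      rw [e, torusDeriv_ofReal_re (hAs.add hBs), torusDeriv_add hAs hBs,
        torusDeriv_const_mul a (torusSmooth_torusChar k),
        torusDeriv_const_mul b (torusSmooth_torusChar l), torusDeriv_torusChar,
        torusDeriv_torusChar]
      congr 1
      simp only [hA, hB, Complex.add_re, Complex.mul_re, Complex.mul_im, Complex.I_re,
        Complex.I_im, Complex.intCast_re, Complex.intCast_im]
      ring
    simp only [torusGrad, hD, hwdef]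
    push_cast
    exact Finset.sum_congr rfl fun j _ => by ring
  have hw : TorusSmoothReal w := by
    have h1 : TorusSmooth (torusGrad (fun p => (φ p : ℂ)) (fun p => (φ p : ℂ))) :=
      TorusSmooth.torusGrad hφ hφ
    exact (congrArg TorusSmooth (funext hgrad)).mp h1
  have hreach : ∀ r : ℝ, PhaseReach (torusSystem V) (fun p => r * φ p) := by
    intro r
    have h1 := (hk (r * a)).add (hl (r * b)) (aestronglyMeasurable_mode _ _)
      (aestronglyMeasurable_mode _ _)
    refine (congrArg (PhaseReach (torusSystem V)) (funext fun p => ?_)).mp h1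
    simp only [hφdef, hA, hB, mul_assoc, Complex.re_ofReal_mul]
    ring
  -- The constant cancels the mean of the squares, through `(Im A)² = (|A|² - Re A²)/2`. The cross
  -- term becomes a difference of modes by `-2 Im A Im B = Re(AB) - Re(A B̄)`.
  have h := (phaseReach_torus_grad hV hφ hw hgrad hreach).add
    (PhaseReach.const ((∑ i, (k i : ℝ) ^ 2) * ‖a‖ ^ 2 / 2 + (∑ i, (l i : ℝ) ^ 2) * ‖b‖ ^ 2 / 2))
    hw.aestronglyMeasurable.neg aestronglyMeasurable_const
  refine (congrArg (PhaseReach (torusSystem V)) (funext fun p => ?_)).mp h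
  have ew : w p = (∑ i, (k i : ℝ) ^ 2) * (A p).im ^ 2 + (∑ i, (l i : ℝ) ^ 2) * (B p).im ^ 2 +
      2 * (∑ i, (k i : ℝ) * l i) * ((A p).im * (B p).im) := by
    rw [hwdef]
    simp only [Finset.mul_sum, Finset.sum_mul, ← Finset.sum_add_distrib]
    exact Finset.sum_congr rfl fun j _ => by ring
  have hnA : ‖a‖ ^ 2 = (A p).re ^ 2 + (A p).im ^ 2 := by
    have : ‖A p‖ = ‖a‖ := by rw [hA]; simp [norm_torusChar]
    rw [← this, Complex.sq_norm, Complex.normSq_apply]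
    ring
  have hnB : ‖b‖ ^ 2 = (B p).re ^ 2 + (B p).im ^ 2 := by
    have : ‖B p‖ = ‖b‖ := by rw [hB]; simp [norm_torusChar]
    rw [← this, Complex.sq_norm, Complex.normSq_apply]
    ring
  have e1 : ((∑ i, k i ^ 2 : ℤ) : ℂ) / 2 * a ^ 2 * torusChar (k + k) p =
      ((∑ i, (k i : ℝ) ^ 2) / 2 : ℝ) * (A p * A p) := by
    rw [torusChar_add, hA]
    push_cast
    ring
  have e2 : ((∑ i, l i ^ 2 : ℤ) : ℂ) / 2 * b ^ 2 * torusChar (l + l) p =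
      ((∑ i, (l i : ℝ) ^ 2) / 2 : ℝ) * (B p * B p) := by
    rw [torusChar_add, hB]
    push_cast
    ring
  have e3 : ((∑ i, k i * l i : ℤ) : ℂ) * (a * b) * torusChar (k + l) p =
      (∑ i, (k i : ℝ) * l i : ℝ) * (A p * B p) := by
    rw [torusChar_add, hA, hB]
    push_cast
    ring
  have e4 : ((∑ i, k i * l i : ℤ) : ℂ) * (a * (starRingEnd ℂ) b) * torusChar (k - l) p =
      (∑ i, (k i : ℝ) * l i : ℝ) * (A p * (starRingEnd ℂ) (B p)) := by
    rw [sub_eq_add_neg, torusChar_add, torusChar_neg, hA, hB]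
    push_cast
    rw [map_mul]
    ring
  rw [e1, e2, e3, e4, ew, hnA, hnB]
  rw [Complex.re_ofReal_mul, Complex.re_ofReal_mul, Complex.re_ofReal_mul, Complex.re_ofReal_mul]
  simp only [Complex.mul_re, Complex.conj_re, Complex.conj_im]
  ring

/-- Add the interactions with coefficients `(a, 1)` and `(ia, -i)`. The squares change sign and so
does `a b̄`, whereas `ab` does not: only the mode `k + l` remains, with coefficient `2⟨k, l⟩a`.
Hence the choice of `a`, and the need for `⟨k, l⟩ ≠ 0`. -/
theorem ModeReach.add (hV : MemLp V ⊤ volume) {k l : Fin d → ℤ} (hk : ModeReach V k)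
    (hl : ModeReach V l) (hkl : (∑ i, k i * l i : ℤ) ≠ 0) : ModeReach V (k + l) := by
  intro c
  have hc : ((∑ i, k i * l i : ℤ) : ℂ) ≠ 0 := by exact_mod_cast hkl
  set a : ℂ := c / (2 * ((∑ i, k i * l i : ℤ) : ℂ)) with ha
  have h1 := hk.phaseReach_interaction hV hl a 1
  have h2 := hk.phaseReach_interaction hV hl (Complex.I * a) (-Complex.I)
  have hm := fun (c : ℂ) (k : Fin d → ℤ) => aestronglyMeasurable_mode c k
  have hm4 : ∀ (a b : ℂ), AEStronglyMeasurable (fun p =>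
      (((∑ i, k i ^ 2 : ℤ) : ℂ) / 2 * a ^ 2 * torusChar (k + k) p).re +
      ((((∑ i, l i ^ 2 : ℤ) : ℂ) / 2 * b ^ 2 * torusChar (l + l) p).re +
      ((((∑ i, k i * l i : ℤ) : ℂ) * (a * b) * torusChar (k + l) p).re -
      (((∑ i, k i * l i : ℤ) : ℂ) * (a * (starRingEnd ℂ) b) * torusChar (k - l) p).re)))
      volume := fun a b => (hm _ _).add ((hm _ _).add ((hm _ _).sub (hm _ _)))
  have h := h1.add h2 (hm4 _ _) (hm4 _ _)
  refine (congrArg (PhaseReach (torusSystem V)) (funext fun p => ?_)).mp h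
  have e : ((∑ i, k i * l i : ℤ) : ℂ) * (a * 1) + ((∑ i, k i * l i : ℤ) : ℂ) * (a * 1) = c := by
    rw [ha]
    field_simp
    ring
  have eI : Complex.I * a * -Complex.I = a * 1 := by
    linear_combination (-a) * Complex.I_mul_I
  have eI' : Complex.I * a * (starRingEnd ℂ) (-Complex.I) = -(a * (starRingEnd ℂ) 1) := by
    rw [map_neg, Complex.conj_I, neg_neg, map_one]
    linear_combination a * Complex.I_mul_I
  have eI2 : (Complex.I * a) ^ 2 = -(a ^ 2) := by
    rw [mul_pow, Complex.I_sq]; ring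
  have eI3 : (-Complex.I) ^ 2 = -(1 ^ 2) := by
    rw [neg_sq, Complex.I_sq]; ring
  rw [eI, eI', eI2, eI3, ← e]
  simp only [mul_neg, neg_mul, Complex.neg_re, add_mul, Complex.add_re]
  ring

/-- Modes can be added as long as they are not orthogonal. Removing the first `d - 1` canonical
vectors from `(1,…,1)` one after the other leaves the last one; multiples of each canonical vector
follow; finally the coordinates of `(1,…,1)` are corrected one at a time. -/
theorem modeReach_of_bVec (hd : 1 ≤ d) (hV : MemLp V ⊤ volume) (k : Fin d → ℤ) :
    ModeReach V k := by
  classical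
  have hsum : ∀ (k : Fin d → ℤ) (j : Fin d) (m : ℤ),
      (∑ i, k i * (Pi.single j m : Fin d → ℤ) i) = k j * m := by
    intro k j m
    rw [Finset.sum_eq_single j]
    · simp
    · intro i _ hi
      simp [hi]
    · simp
  let last : Fin d := ⟨d - 1, by omega⟩
  have hlast : bVec last = fun _ => 1 := by
    have : (last : ℕ) + 1 = d := by simp only [last]; omega
    rw [bVec, if_pos this]
  have hone : ModeReach V (fun _ => 1) := hlast ▸ modeReach_bVec hV last
  have hsingle' : ∀ j, j ≠ last → ModeReach V (Pi.single j 1) := by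
    intro j hj
    have h : ¬ (j : ℕ) + 1 = d := by
      intro h
      apply hj
      apply Fin.ext
      simp only [last]
      omega
    have := modeReach_bVec hV j
    rwa [bVec, if_neg h] at this
  have hsub : ∀ s : Finset (Fin d), last ∉ s → ModeReach V (fun i => if i ∈ s then 0 else 1) := by
    intro s
    induction s using Finset.induction_on with
    | empty => intro _; simpa using hone
    | insert j s hj ih =>
      intro hs
      rw [Finset.mem_insert, not_or] at hs
      have h1 := (ih hs.2).add hV (hsingle' j (Ne.symm hs.1)).neg (by
        have := hsum (fun i => if i ∈ s then 0 else 1) j (-1)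
        rw [Pi.single_neg] at this
        rw [this]
        simp [hj])
      refine (congrArg (ModeReach V) (funext fun i => ?_)).mp h1
      by_cases hij : i = j
      · subst hij
        simp [hj]
      · simp [hij]
  have hsingle : ∀ j, ModeReach V (Pi.single j 1) := by
    intro j
    by_cases hj : j = last
    · have h1 := hsub (Finset.univ.erase last) (by simp)
      refine (congrArg (ModeReach V) (funext fun i => ?_)).mp h1
      by_cases hi : i = last
      · simp [hi, hj]
      · simp [hi, hj]
    · exact hsingle' j hj
  have hnat : ∀ j (m : ℕ), ModeReach V (Pi.single j (m : ℤ)) := by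
    intro j m
    induction m with
    | zero => simpa using ModeReach.zero (V := V)
    | succ m ih =>
      -- The case is separate because `0` is orthogonal to everything, so the addition rule does not
      -- apply to it.
      by_cases hm : m = 0
      · subst hm
        simpa using hsingle j
      · have h1 := ih.add hV (hsingle j) (by rw [hsum]; simpa using hm)
        rw [← Pi.single_add] at h1
        exact_mod_cast h1
  have hint : ∀ j (m : ℤ), ModeReach V (Pi.single j m) := by
    intro j m
    obtain ⟨n, rfl | rfl⟩ := m.eq_nat_or_neg
    · exact hnat j n
    · rw [Pi.single_neg]
      exact (hnat j n).neg
  have hfin : ∀ s : Finset (Fin d), ModeReach V (fun i => if i ∈ s then k i else 1) := by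
    intro s
    induction s using Finset.induction_on with
    | empty => simpa using hone
    | insert j s hj ih =>
      -- The current vector has `j`-th coordinate `1`, so its product with the correction `(k_j -
      -- 1)e_j` is `k_j - 1`; if this vanishes there is nothing to correct.
      by_cases hk : k j - 1 = 0
      · refine (congrArg (ModeReach V) (funext fun i => ?_)).mp ih
        by_cases hij : i = j
        · subst hij
          simp only [hj, if_false, Finset.mem_insert_self, if_true]
          omega
        · simp [hij]
      · have h1 := ih.add hV (hint j (k j - 1)) (by rw [hsum]; simpa [hj] using hk)
        refine (congrArg (ModeReach V) (funext fun i => ?_)).mp h1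
        by_cases hij : i = j
        · subst hij
          simp [hj]
        · simp [hij]
  simpa using hfin Finset.univ

theorem phaseReach_re_of_mem_span (hd : 1 ≤ d) (hV : MemLp V ⊤ volume)
    {z : Lp ℂ 2 (volume : Measure (Torus d))}
    (hz : z ∈ Submodule.span ℂ (Set.range fun k : Fin d → ℤ =>
      toL2 (volume : Measure (Torus d)) (torusChar k))) (c : ℂ) :
    PhaseReach (torusSystem V) (fun p => (c * z p).re) := by
  have hm : ∀ (c : ℂ) (z : Lp ℂ 2 (volume : Measure (Torus d))),
      AEStronglyMeasurable (fun p => (c * z p).re) volume := fun c z =>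
    Complex.continuous_re.comp_aestronglyMeasurable ((Lp.aestronglyMeasurable z).const_mul c)
  -- The span is complex and only real parts are phases: a free complex factor `c` makes the
  -- statement stable under scalar multiplication.
  induction hz using Submodule.span_induction generalizing c with
  | mem z hz =>
    obtain ⟨k, rfl⟩ := hz
    refine (modeReach_of_bVec hd hV k c).congr ?_
    filter_upwards [coeFn_toL2 (torusSmooth_torusChar k).memLp] with p hp
    rw [hp]
  | zero =>
    refine (PhaseReach.const 0).congr ?_
    filter_upwards [Lp.coeFn_zero ℂ 2 (volume : Measure (Torus d))] with p hp
    simp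
  | add z z' _ _ h1 h2 =>
    refine ((h1 c).add (h2 c) (hm c z) (hm c z')).congr ?_
    filter_upwards [Lp.coeFn_add z z'] with p hp
    rw [hp, Pi.add_apply, mul_add, Complex.add_re]
  | smul a z _ h1 =>
    refine (h1 (c * a)).congr ?_
    filter_upwards [Lp.coeFn_smul a z] with p hp
    rw [hp, Pi.smul_apply, smul_eq_mul, mul_assoc]

/-- Trigonometric polynomials converge to `φ` in `L²`, hence almost everywhere along a subsequence;
their real parts are reachable phases. -/
theorem isSTAR_torus_phase (hd : 1 ≤ d) (hV : MemLp V ⊤ volume)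
    (φ : Lp ℝ 2 (volume : Measure (Torus d))) : IsSTAR (torusSystem V) (phase φ) := by
  have hφ : MemLp (fun p => (φ p : ℂ)) 2 volume := (Lp.memLp φ).ofReal
  obtain ⟨z, hz, hlim⟩ := mem_closure_iff_seq_limit.1
    (dense_span_torusChar (d := d) (toL2 volume fun p => (φ p : ℂ)))
  obtain ⟨n, -, hn⟩ := (tendstoInMeasure_of_tendsto_Lp hlim).exists_seq_tendsto_ae
  refine PhaseReach.isSTAR (PhaseReach.of_tendsto (φ := fun m p => (1 * z (n m) p).re)
    (fun m => phaseReach_re_of_mem_span hd hV (hz (n m)) 1) (fun m => ?_)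
    (Lp.aestronglyMeasurable φ) ?_)
  · exact Complex.continuous_re.comp_aestronglyMeasurable
      ((Lp.aestronglyMeasurable (z (n m))).const_mul 1)
  · filter_upwards [hn, coeFn_toL2 hφ] with p hp hp'
    rw [hp'] at hp
    have := (Complex.continuous_re.tendsto _).comp hp
    simpa [Function.comp_def] using this

end TorusModes

/-! ### Calculus on the Euclidean space -/

section LineCalculus

variable {d : ℕ}

/-- The derivative along the `j`-th coordinate. -/
def partialDeriv (j : Fin d) (f : EuclideanSpace ℝ (Fin d) → ℂ) (x : EuclideanSpace ℝ (Fin d)) :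
    ℂ := fderiv ℝ f x (EuclideanSpace.single j 1)

/-- The product `⟨∇f, ∇g⟩ = ∑ⱼ ∂ⱼf ∂ⱼg`. -/
def lineGrad (f g : EuclideanSpace ℝ (Fin d) → ℂ) (x : EuclideanSpace ℝ (Fin d)) : ℂ :=
  ∑ j, partialDeriv j f x * partialDeriv j g x

variable {f g : EuclideanSpace ℝ (Fin d) → ℂ}

theorem hasFDerivAt_of_contDiff (hf : ContDiff ℝ ∞ f) (x : EuclideanSpace ℝ (Fin d)) :
    HasFDerivAt f (fderiv ℝ f x) x :=
  (hf.differentiable (by simp) x).hasFDerivAt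

theorem contDiff_partialDeriv (hf : ContDiff ℝ ∞ f) (j : Fin d) :
    ContDiff ℝ ∞ (partialDeriv j f) :=
  (hf.fderiv_right (m := ∞) (by simp)).clm_apply contDiff_const

theorem contDiff_lineGrad (hf : ContDiff ℝ ∞ f) (hg : ContDiff ℝ ∞ g) :
    ContDiff ℝ ∞ (lineGrad f g) :=
  ContDiff.sum fun j _ => (contDiff_partialDeriv hf j).mul (contDiff_partialDeriv hg j)

theorem lineLaplacian_eq (hf : ContDiff ℝ ∞ f) (x : EuclideanSpace ℝ (Fin d)) :
    lineLaplacian f x = ∑ j, partialDeriv j (partialDeriv j f) x := by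
  rw [lineLaplacian, InnerProductSpace.laplacian_eq_iteratedFDeriv_orthonormalBasis f
    (EuclideanSpace.basisFun (Fin d) ℝ)]
  refine Finset.sum_congr rfl fun j _ => ?_
  rw [iteratedFDeriv_two_apply]
  have h1 : HasFDerivAt (fderiv ℝ f) (fderiv ℝ (fderiv ℝ f) x) x :=
    (((hf.fderiv_right (m := ∞) (by simp)).differentiable (by simp)) x).hasFDerivAt
  have h2 := h1.clm_apply (hasFDerivAt_const (EuclideanSpace.single j (1 : ℝ)) x)
  have h3 : partialDeriv j f = fun y => fderiv ℝ f y (EuclideanSpace.single j 1) := rfl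
  rw [partialDeriv, h3, h2.fderiv]
  simp

theorem contDiff_lineLaplacian (hf : ContDiff ℝ ∞ f) : ContDiff ℝ ∞ (lineLaplacian f) := by
  rw [show lineLaplacian f = fun x => ∑ j, partialDeriv j (partialDeriv j f) x from
    funext (lineLaplacian_eq hf)]
  exact ContDiff.sum fun j _ => contDiff_partialDeriv (contDiff_partialDeriv hf j) j

theorem partialDeriv_eq {j : Fin d} {x : EuclideanSpace ℝ (Fin d)}
    {L : EuclideanSpace ℝ (Fin d) →L[ℝ] ℂ} (h : HasFDerivAt f L x) :
    partialDeriv j f x = L (EuclideanSpace.single j 1) := by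
  rw [partialDeriv, h.fderiv]

theorem partialDeriv_add (hf : ContDiff ℝ ∞ f) (hg : ContDiff ℝ ∞ g) (j : Fin d)
    (x : EuclideanSpace ℝ (Fin d)) :
    partialDeriv j (fun x => f x + g x) x = partialDeriv j f x + partialDeriv j g x :=
  partialDeriv_eq ((hasFDerivAt_of_contDiff hf x).add (hasFDerivAt_of_contDiff hg x))

theorem partialDeriv_mul (hf : ContDiff ℝ ∞ f) (hg : ContDiff ℝ ∞ g) (j : Fin d)
    (x : EuclideanSpace ℝ (Fin d)) :
    partialDeriv j (fun x => f x * g x) x = partialDeriv j f x * g x + f x * partialDeriv j g x := by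
  refine (partialDeriv_eq
    ((hasFDerivAt_of_contDiff hf x).mul (hasFDerivAt_of_contDiff hg x))).trans ?_
  simp only [add_apply, smul_apply, smul_eq_mul,
    partialDeriv]
  ring

theorem partialDeriv_const (c : ℂ) (j : Fin d) (x : EuclideanSpace ℝ (Fin d)) :
    partialDeriv j (fun _ => c) x = 0 := partialDeriv_eq (hasFDerivAt_const _ _)

theorem partialDeriv_const_mul (c : ℂ) (hf : ContDiff ℝ ∞ f) (j : Fin d)
    (x : EuclideanSpace ℝ (Fin d)) :
    partialDeriv j (fun x => c * f x) x = c * partialDeriv j f x :=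
  partialDeriv_eq ((hasFDerivAt_of_contDiff hf x).const_mul c)

theorem partialDeriv_conj (hf : ContDiff ℝ ∞ f) (j : Fin d) (x : EuclideanSpace ℝ (Fin d)) :
    partialDeriv j (fun x => (starRingEnd ℂ) (f x)) x = (starRingEnd ℂ) (partialDeriv j f x) :=
  partialDeriv_eq (Complex.conjCLE.toContinuousLinearMap.hasFDerivAt.comp x
    (hasFDerivAt_of_contDiff hf x))

theorem partialDeriv_cexp (hf : ContDiff ℝ ∞ f) (j : Fin d) (x : EuclideanSpace ℝ (Fin d)) :
    partialDeriv j (fun x => Complex.exp (f x)) x = Complex.exp (f x) * partialDeriv j f x :=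
  partialDeriv_eq (hasFDerivAt_of_contDiff hf x).cexp

theorem contDiff_conj (hf : ContDiff ℝ ∞ f) : ContDiff ℝ ∞ fun x => (starRingEnd ℂ) (f x) :=
  Complex.conjCLE.contDiff.comp hf

theorem partialDeriv_comp_add (j : Fin d) (v x : EuclideanSpace ℝ (Fin d)) :
    partialDeriv j (fun x => f (x + v)) x = partialDeriv j f (x + v) := by
  rw [partialDeriv, fderiv_comp_add_right, partialDeriv]

theorem lineLaplacian_add (hf : ContDiff ℝ ∞ f) (hg : ContDiff ℝ ∞ g)
    (x : EuclideanSpace ℝ (Fin d)) :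
    lineLaplacian (fun x => f x + g x) x = lineLaplacian f x + lineLaplacian g x := by
  rw [lineLaplacian_eq (hf.add hg), lineLaplacian_eq hf, lineLaplacian_eq hg,
    ← Finset.sum_add_distrib]
  refine Finset.sum_congr rfl fun j _ => ?_
  rw [funext (partialDeriv_add hf hg j), partialDeriv_add (contDiff_partialDeriv hf j)
    (contDiff_partialDeriv hg j)]

theorem lineLaplacian_const_mul (c : ℂ) (hf : ContDiff ℝ ∞ f) (x : EuclideanSpace ℝ (Fin d)) :
    lineLaplacian (fun x => c * f x) x = c * lineLaplacian f x := by
  rw [lineLaplacian_eq (contDiff_const.mul hf), lineLaplacian_eq hf, Finset.mul_sum]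
  refine Finset.sum_congr rfl fun j _ => ?_
  rw [funext (partialDeriv_const_mul c hf j), partialDeriv_const_mul c (contDiff_partialDeriv hf j)]

theorem lineLaplacian_conj (hf : ContDiff ℝ ∞ f) (x : EuclideanSpace ℝ (Fin d)) :
    lineLaplacian (fun x => (starRingEnd ℂ) (f x)) x = (starRingEnd ℂ) (lineLaplacian f x) := by
  rw [lineLaplacian_eq (contDiff_conj hf), lineLaplacian_eq hf, map_sum]
  refine Finset.sum_congr rfl fun j _ => ?_
  rw [funext (partialDeriv_conj hf j), partialDeriv_conj (contDiff_partialDeriv hf j)]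

theorem lineLaplacian_comp_add (hf : ContDiff ℝ ∞ f) (v x : EuclideanSpace ℝ (Fin d)) :
    lineLaplacian (fun x => f (x + v)) x = lineLaplacian f (x + v) := by
  have h : ContDiff ℝ ∞ fun x => f (x + v) := hf.comp (contDiff_id.add contDiff_const)
  rw [lineLaplacian_eq h, lineLaplacian_eq hf]
  refine Finset.sum_congr rfl fun j _ => ?_
  rw [funext (partialDeriv_comp_add j v), partialDeriv_comp_add]

theorem lineLaplacian_mul (hf : ContDiff ℝ ∞ f) (hg : ContDiff ℝ ∞ g)
    (x : EuclideanSpace ℝ (Fin d)) :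
    lineLaplacian (fun x => f x * g x) x =
      lineLaplacian f x * g x + 2 * lineGrad f g x + f x * lineLaplacian g x := by
  rw [lineLaplacian_eq (hf.mul hg), lineLaplacian_eq hf, lineLaplacian_eq hg, lineGrad,
    Finset.sum_mul, Finset.mul_sum, Finset.mul_sum, ← Finset.sum_add_distrib,
    ← Finset.sum_add_distrib]
  refine Finset.sum_congr rfl fun j _ => ?_
  have h1 := contDiff_partialDeriv hf j
  have h2 := contDiff_partialDeriv hg j
  rw [funext (partialDeriv_mul hf hg j), partialDeriv_add (h1.mul hg) (hf.mul h2),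
    partialDeriv_mul h1 hg, partialDeriv_mul hf h2]
  ring

theorem lineLaplacian_exp_mul {φ : EuclideanSpace ℝ (Fin d) → ℂ} (hφ : ContDiff ℝ ∞ φ)
    (hf : ContDiff ℝ ∞ f) (x : EuclideanSpace ℝ (Fin d)) :
    lineLaplacian (fun x => Complex.exp (Complex.I * φ x) * f x) x =
      Complex.exp (Complex.I * φ x) * (lineLaplacian f x + 2 * Complex.I * lineGrad φ f x +
        Complex.I * lineLaplacian φ x * f x - lineGrad φ φ x * f x) := by
  have hIφ : ContDiff ℝ ∞ fun x => Complex.I * φ x := contDiff_const.mul hφ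
  have hE : ContDiff ℝ ∞ fun x => Complex.exp (Complex.I * φ x) := hIφ.cexp
  have e1 : ∀ j, partialDeriv j (fun x => Complex.exp (Complex.I * φ x)) = fun x =>
      Complex.exp (Complex.I * φ x) * (Complex.I * partialDeriv j φ x) := by
    intro j
    funext x
    rw [partialDeriv_cexp hIφ, partialDeriv_const_mul _ hφ]
  have e2 : lineGrad (fun x => Complex.exp (Complex.I * φ x)) f x =
      Complex.exp (Complex.I * φ x) * Complex.I * lineGrad φ f x := by
    simp only [lineGrad, e1, Finset.mul_sum]
    exact Finset.sum_congr rfl fun j _ => by ring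
  have e3 : lineLaplacian (fun x => Complex.exp (Complex.I * φ x)) x =
      Complex.exp (Complex.I * φ x) * (Complex.I * lineLaplacian φ x - lineGrad φ φ x) := by
    rw [lineLaplacian_eq hE, lineLaplacian_eq hφ, lineGrad, Finset.mul_sum,
      ← Finset.sum_sub_distrib, Finset.mul_sum]
    refine Finset.sum_congr rfl fun j _ => ?_
    have h1 := contDiff_partialDeriv hφ j
    have h2 : ContDiff ℝ ∞ fun x => Complex.I * partialDeriv j φ x := contDiff_const.mul h1
    rw [e1, partialDeriv_mul hE h2, e1, partialDeriv_const_mul _ h1]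
    linear_combination (Complex.exp (Complex.I * φ x) * partialDeriv j φ x ^ 2) * Complex.I_mul_I
  rw [lineLaplacian_mul hE hf, e2, e3]
  ring

/-- The test functions, i.e. the elements of `C_c^∞(ℝ^d, ℂ)`. -/
structure IsTestFun (f : EuclideanSpace ℝ (Fin d) → ℂ) : Prop where
  contDiff : ContDiff ℝ ∞ f
  hasCompactSupport : HasCompactSupport f

namespace IsTestFun

theorem continuous (hf : IsTestFun f) : Continuous f := hf.contDiff.continuous

theorem memLp (hf : IsTestFun f) : MemLp f 2 volume :=
  hf.continuous.memLp_of_hasCompactSupport hf.hasCompactSupport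

theorem integrable (hf : IsTestFun f) : Integrable f volume :=
  hf.continuous.integrable_of_hasCompactSupport hf.hasCompactSupport

theorem exists_norm_le (hf : IsTestFun f) : ∃ C, 0 ≤ C ∧ ∀ x, ‖f x‖ ≤ C := by
  obtain ⟨C, hC⟩ := hf.continuous.bounded_above_of_compact_support hf.hasCompactSupport
  exact ⟨C, (norm_nonneg _).trans (hC 0), hC⟩

theorem zero : IsTestFun (fun _ : EuclideanSpace ℝ (Fin d) => (0 : ℂ)) :=
  ⟨contDiff_const, HasCompactSupport.zero⟩

theorem add (hf : IsTestFun f) (hg : IsTestFun g) : IsTestFun fun x => f x + g x :=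
  ⟨hf.contDiff.add hg.contDiff, hf.hasCompactSupport.add hg.hasCompactSupport⟩

theorem mul_left (hf : ContDiff ℝ ∞ f) (hg : IsTestFun g) : IsTestFun fun x => f x * g x :=
  ⟨hf.mul hg.contDiff, hg.hasCompactSupport.mul_left⟩

theorem mul_right (hf : IsTestFun f) (hg : ContDiff ℝ ∞ g) : IsTestFun fun x => f x * g x :=
  ⟨hf.contDiff.mul hg, hf.hasCompactSupport.mul_right⟩

theorem const_mul (c : ℂ) (hf : IsTestFun f) : IsTestFun fun x => c * f x :=
  mul_left contDiff_const hf

theorem neg (hf : IsTestFun f) : IsTestFun fun x => -f x :=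
  ⟨hf.contDiff.neg, hf.hasCompactSupport.neg⟩

theorem sub (hf : IsTestFun f) (hg : IsTestFun g) : IsTestFun fun x => f x - g x := by
  simpa only [sub_eq_add_neg] using hf.add hg.neg

theorem sum {ι : Type*} {s : Finset ι} {f : ι → EuclideanSpace ℝ (Fin d) → ℂ}
    (hf : ∀ i ∈ s, IsTestFun (f i)) : IsTestFun fun x => ∑ i ∈ s, f i x := by
  classical
  induction s using Finset.induction_on with
  | empty => simpa using zero
  | insert i s hi ih =>
    simp only [Finset.sum_insert hi]
    exact (hf i (Finset.mem_insert_self i s)).add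
      (ih fun j hj => hf j (Finset.mem_insert_of_mem hj))

theorem conj (hf : IsTestFun f) : IsTestFun fun x => (starRingEnd ℂ) (f x) :=
  ⟨contDiff_conj hf.contDiff, hf.hasCompactSupport.comp_left (g := starRingEnd ℂ) (map_zero _)⟩

theorem partialDeriv (hf : IsTestFun f) (j : Fin d) : IsTestFun (partialDeriv j f) :=
  ⟨contDiff_partialDeriv hf.contDiff j, (hf.hasCompactSupport.fderiv ℝ).comp_left
    (g := fun L : EuclideanSpace ℝ (Fin d) →L[ℝ] ℂ => L (EuclideanSpace.single j 1)) rfl⟩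

theorem lineLaplacian (hf : IsTestFun f) : IsTestFun (lineLaplacian f) := by
  rw [show SchrodingerControl.lineLaplacian f = fun x => ∑ j, SchrodingerControl.partialDeriv j
    (SchrodingerControl.partialDeriv j f) x from funext (lineLaplacian_eq hf.contDiff)]
  exact sum fun j _ => (hf.partialDeriv j).partialDeriv j

theorem lineGrad (hf : ContDiff ℝ ∞ f) (hg : IsTestFun g) : IsTestFun (lineGrad f g) :=
  sum fun j _ => mul_left (contDiff_partialDeriv hf j) (hg.partialDeriv j)

theorem comp_add (hf : IsTestFun f) (v : EuclideanSpace ℝ (Fin d)) :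
    IsTestFun fun x => f (x + v) :=
  ⟨hf.contDiff.comp (contDiff_id.add contDiff_const),
    hf.hasCompactSupport.comp_homeomorph (Homeomorph.addRight v)⟩

end IsTestFun

theorem integral_mul_partialDeriv (hf : ContDiff ℝ ∞ f) (hg : IsTestFun g) (j : Fin d) :
    ∫ x, f x * partialDeriv j g x = -∫ x, partialDeriv j f x * g x :=
  integral_mul_fderiv_eq_neg_fderiv_mul_of_integrable
    (IsTestFun.mul_left (contDiff_partialDeriv hf j) hg).integrable
    (IsTestFun.mul_left hf (hg.partialDeriv j)).integrable (IsTestFun.mul_left hf hg).integrable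
    (fun x _ => hf.differentiable (by simp) x) (fun x _ => hg.contDiff.differentiable (by simp) x)

theorem integral_mul_lineLaplacian (hf : ContDiff ℝ ∞ f) (hg : IsTestFun g) :
    ∫ x, f x * lineLaplacian g x = -∫ x, lineGrad f g x := by
  simp only [lineLaplacian_eq hg.contDiff, lineGrad, Finset.mul_sum]
  rw [integral_finsetSum _ fun j _ => (IsTestFun.mul_left hf
      ((hg.partialDeriv j).partialDeriv j)).integrable,
    integral_finsetSum _ fun j _ => (IsTestFun.mul_left (contDiff_partialDeriv hf j)
      (hg.partialDeriv j)).integrable, ← Finset.sum_neg_distrib]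
  exact Finset.sum_congr rfl fun j _ => integral_mul_partialDeriv hf (hg.partialDeriv j) j

theorem lineGrad_comm (x : EuclideanSpace ℝ (Fin d)) : lineGrad f g x = lineGrad g f x :=
  Finset.sum_congr rfl fun _ _ => mul_comm _ _

theorem integral_lineLaplacian_mul (hf : IsTestFun f) (hg : IsTestFun g) :
    ∫ x, lineLaplacian f x * g x = ∫ x, f x * lineLaplacian g x := by
  have h1 := integral_mul_lineLaplacian hf.contDiff hg
  have h2 := integral_mul_lineLaplacian hg.contDiff hf
  simp only [lineGrad_comm (f := g) (g := f)] at h2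
  rw [h1, ← h2]
  simp only [mul_comm]

/-- `⟨f, -Δf⟩ = ‖∇f‖²`. -/
theorem inner_neg_lineLaplacian (hf : IsTestFun f) :
    inner ℂ (toL2 volume f) (-toL2 volume (lineLaplacian f)) =
      ((∑ j, ‖toL2 volume (partialDeriv j f)‖ ^ 2 : ℝ) : ℂ) := by
  rw [inner_neg_right, inner_toL2 hf.memLp hf.lineLaplacian.memLp,
    integral_mul_lineLaplacian (contDiff_conj hf.contDiff) hf, neg_neg]
  simp only [lineGrad]
  rw [integral_finsetSum _ fun j _ => (IsTestFun.mul_left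
    (contDiff_partialDeriv (contDiff_conj hf.contDiff) j) (hf.partialDeriv j)).integrable,
    Complex.ofReal_sum]
  refine Finset.sum_congr rfl fun j _ => ?_
  simp only [partialDeriv_conj hf.contDiff]
  rw [← inner_toL2 (hf.partialDeriv j).memLp (hf.partialDeriv j).memLp,
    inner_self_eq_norm_sq_to_K]
  push_cast
  rfl

end LineCalculus

/-! ### Nonnegative operators: from the range of `A + 1` to that of `A + z`. -/

section NonnegRange

variable {E : Type*} [NormedAddCommGroup E] [InnerProductSpace ℂ E]

local notation "⟪" x ", " y "⟫" => inner ℂ x y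

theorem IsSymmetricGraph.im_inner_eq_zero {S : Submodule ℂ (E × E)} (hS : IsSymmetricGraph S)
    {p : E × E} (hp : p ∈ S) : ⟪p.2, p.1⟫.im = 0 := by
  have h := hS p hp p hp
  rw [← inner_conj_symm p.1 p.2] at h
  exact Complex.conj_eq_iff_im.1 h.symm

/-- If `A ≥ 0` is symmetric and `A + 1` has a dense range, then so has `A + z` for `z` nonreal. -/
theorem IsSymmetricGraph.dense_range_of_nonneg [CompleteSpace E] {S : Submodule ℂ (E × E)}
    (hS : IsSymmetricGraph S) (hpos : ∀ p ∈ S, 0 ≤ ⟪p.2, p.1⟫.re)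
    (hd : Dense {w : E | ∃ p ∈ S, p.2 + (1 : ℂ) • p.1 = w}) {z : ℂ} (hz : z.im ≠ 0) :
    Dense {w : E | ∃ p ∈ S, p.2 + z • p.1 = w} := by
  refine dense_range_of_forall_inner_eq_zero fun y hy => ?_
  have hz0 : 0 < |z.im| := abs_pos.2 hz
  -- Choose `w = (A + 1)p` within `ε` of `y`, with `y` orthogonal to `w + (z - 1)p`. Then `‖y‖² + (z
  -- - 1)r = O(ε)`, where `r = ⟪w, p⟫` is real and nonnegative. The imaginary part shows that `r` is
  -- small, and then so is `‖y‖²`.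
  have key : ∀ ε > 0, ε ≤ 1 → ‖y‖ ^ 2 ≤
      ε * ((‖y‖ + ‖z - 1‖ * (‖y‖ + 1)) * (1 + ‖z - 1‖ / |z.im|)) := by
    intro ε hε hε1
    obtain ⟨_, ⟨p, hp, rfl⟩, hpy⟩ := Metric.mem_closure_iff.1 (hd y) ε hε
    rw [dist_eq_norm] at hpy
    set w := p.2 + (1 : ℂ) • p.1 with hw
    have hwp : ⟪w, p.1⟫ = ((⟪p.2, p.1⟫.re + ‖p.1‖ ^ 2 : ℝ) : ℂ) := by
      rw [hw, one_smul, inner_add_left, inner_self_eq_norm_sq_to_K]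
      apply Complex.ext
      · simp [← Complex.ofReal_pow]
      · simp [← Complex.ofReal_pow, hS.im_inner_eq_zero hp]
    set r : ℝ := ⟪p.2, p.1⟫.re + ‖p.1‖ ^ 2 with hr
    have hr0 : 0 ≤ r := add_nonneg (hpos p hp) (by positivity)
    have hp1 : ‖p.1‖ ≤ ‖y‖ + 1 := by
      have h1 : ‖w‖ ≤ ‖y‖ + 1 := by
        have := norm_sub_norm_le w y
        rw [norm_sub_rev] at this
        linarith
      have h2 : ‖p.1‖ ^ 2 ≤ ‖w‖ * ‖p.1‖ := by
        have h3 := norm_inner_le_norm (𝕜 := ℂ) w p.1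
        rw [hwp, Complex.norm_real, Real.norm_eq_abs, abs_of_nonneg hr0] at h3
        have := hpos p hp
        linarith
      rcases eq_or_lt_of_le (norm_nonneg p.1) with h0 | h0
      · rw [← h0]
        positivity
      · refine le_trans ?_ h1
        rw [sq] at h2
        exact le_of_mul_le_mul_right h2 h0
    have h3 : ((‖y‖ ^ 2 : ℝ) : ℂ) + (z - 1) * r =
        ⟪y, y - w⟫ - (z - 1) * ⟪y - w, p.1⟫ := by
      have h4 := hy p hp
      have h5 : p.2 + z • p.1 = w + (z - 1) • p.1 := by
        rw [hw]
        module
      rw [h5, inner_add_right, inner_smul_right] at h4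
      rw [inner_sub_right, inner_sub_left, hwp, inner_self_eq_norm_sq_to_K]
      push_cast
      have h6 : ((‖y‖ : ℝ) : ℂ) = (RCLike.ofReal ‖y‖ : ℂ) := rfl
      rw [h6]
      linear_combination h4
    have h4 : ‖((‖y‖ ^ 2 : ℝ) : ℂ) + (z - 1) * r‖ ≤ ε * (‖y‖ + ‖z - 1‖ * (‖y‖ + 1)) := by
      rw [h3]
      refine (norm_sub_le _ _).trans ?_
      rw [norm_mul]
      have h5 : ‖⟪y, y - w⟫‖ ≤ ‖y‖ * ε := (norm_inner_le_norm _ _).trans (by gcongr)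
      have h6 : ‖⟪y - w, p.1⟫‖ ≤ ε * (‖y‖ + 1) := (norm_inner_le_norm _ _).trans (by gcongr)
      have h7 := mul_le_mul_of_nonneg_left h6 (norm_nonneg (z - 1))
      linarith
    set η := ε * (‖y‖ + ‖z - 1‖ * (‖y‖ + 1)) with hη
    have h5 : |z.im| * r ≤ η := by
      refine le_trans (le_of_eq ?_) ((Complex.abs_im_le_norm _).trans h4)
      rw [Complex.add_im, Complex.ofReal_im, zero_add, Complex.im_mul_ofReal, Complex.sub_im,
      Complex.one_im, sub_zero, abs_mul, abs_of_nonneg hr0]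
    have h6 : ‖y‖ ^ 2 ≤ η + ‖z - 1‖ * r := by
      have h7 := norm_sub_le (((‖y‖ ^ 2 : ℝ) : ℂ) + (z - 1) * r) ((z - 1) * r)
      rw [add_sub_cancel_right, norm_mul, Complex.norm_real, Complex.norm_real, Real.norm_eq_abs,
        Real.norm_eq_abs, abs_of_nonneg hr0, abs_of_nonneg (sq_nonneg _)] at h7
      linarith
    have h7 : r ≤ η / |z.im| := by
      rw [le_div_iff₀ hz0]
      linarith
    calc ‖y‖ ^ 2 ≤ η + ‖z - 1‖ * (η / |z.im|) := by
          have := mul_le_mul_of_nonneg_left h7 (norm_nonneg (z - 1))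
          linarith
      _ = _ := by rw [hη]; ring
  have hK : 0 ≤ (‖y‖ + ‖z - 1‖ * (‖y‖ + 1)) * (1 + ‖z - 1‖ / |z.im|) := by positivity
  set K := (‖y‖ + ‖z - 1‖ * (‖y‖ + 1)) * (1 + ‖z - 1‖ / |z.im|)
  by_contra hne
  have hy0 : 0 < ‖y‖ ^ 2 := by
    have := norm_pos_iff.2 hne
    positivity
  have h1 := key (min 1 (‖y‖ ^ 2 / (2 * (K + 1)))) (by positivity) (min_le_left _ _)
  have h2 : min 1 (‖y‖ ^ 2 / (2 * (K + 1))) * K ≤ ‖y‖ ^ 2 / (2 * (K + 1)) * K := by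
    gcongr
    exact min_le_right _ _
  have h3 : ‖y‖ ^ 2 / (2 * (K + 1)) * K ≤ ‖y‖ ^ 2 / 2 := by
    rw [div_mul_eq_mul_div, div_le_div_iff₀ (by positivity) (by positivity)]
    nlinarith
  linarith

end NonnegRange

/-! ### Schrödinger operators with locally square-integrable potentials -/

section LocL2

variable {d : ℕ}

/-- The class `L²_loc(ℝ^d, ℝ)`. -/
def LocL2 (P : EuclideanSpace ℝ (Fin d) → ℝ) : Prop :=
  ∀ K, IsCompact K → MemLp P 2 (volume.restrict K)

variable {P : EuclideanSpace ℝ (Fin d) → ℝ} {f g : EuclideanSpace ℝ (Fin d) → ℂ}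

theorem LocL2.add {Q : EuclideanSpace ℝ (Fin d) → ℝ} (hP : LocL2 P) (hQ : LocL2 Q) :
    LocL2 fun x => P x + Q x := fun K hK => (hP K hK).add (hQ K hK)

theorem Continuous.locL2 (hP : Continuous P) : LocL2 P := by
  intro K hK
  obtain ⟨C, hC⟩ := hK.exists_bound_of_continuousOn hP.continuousOn
  have : IsFiniteMeasure (volume.restrict K) := ⟨by simpa using hK.measure_lt_top⟩
  refine MemLp.of_bound hP.aestronglyMeasurable C ?_
  filter_upwards [ae_restrict_mem hK.measurableSet] with x hx
  exact hC x hx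

theorem LocL2.of_abs_le {Q : EuclideanSpace ℝ (Fin d) → ℝ} (hP : LocL2 P)
    {F : ℝ → ℝ} (hF : Continuous F) {c : ℝ} (h : ∀ x, Q x = F (P x)) (hc : ∀ t, |F t| ≤ |t| + c) :
    LocL2 Q := by
  intro K hK
  have : IsFiniteMeasure (volume.restrict K) := ⟨by simpa using hK.measure_lt_top⟩
  rw [show Q = fun x => F (P x) from funext h]
  have h1 := (hP K hK).abs.add (memLp_const (p := 2) (μ := volume.restrict K) c)
  refine h1.of_le (hF.comp_aestronglyMeasurable (hP K hK).1) (ae_of_all _ fun x => ?_)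
  exact (hc _).trans (le_abs_self _)

theorem LocL2.min_const (hP : LocL2 P) (c : ℝ) : LocL2 fun x => min (P x) c :=
  hP.of_abs_le (F := fun t => min t c) (c := |c|) (by fun_prop) (fun _ => rfl) fun t => by
    rcases min_choice t c with h | h <;> rw [h] <;> simp

theorem LocL2.max_const (hP : LocL2 P) (c : ℝ) : LocL2 fun x => max (P x) c :=
  hP.of_abs_le (F := fun t => max t c) (c := |c|) (by fun_prop) (fun _ => rfl) fun t => by
    rcases max_choice t c with h | h <;> rw [h] <;> simp

theorem LocL2.const_sub (hP : LocL2 P) (c : ℝ) : LocL2 fun x => c - P x :=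
  hP.of_abs_le (F := fun t => c - t) (c := |c|) (by fun_prop) (fun _ => rfl) fun t => by
    have := abs_sub c t
    linarith

theorem LocL2.memLp_mul (hP : LocL2 P) (hf : Continuous f) (hfs : HasCompactSupport f) :
    MemLp (fun x => (P x : ℂ) * f x) 2 volume := by
  obtain ⟨C, hC⟩ := hf.bounded_above_of_compact_support hfs
  have hK : MeasurableSet (tsupport f) := (isClosed_tsupport f).measurableSet
  have h1 : MemLp (fun x => (P x : ℂ) * f x) 2 (volume.restrict (tsupport f)) := by
    refine MemLp.of_le_mul (c := C) (hP _ hfs)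
      ((Complex.continuous_ofReal.comp_aestronglyMeasurable (hP _ hfs).1).mul
        hf.aestronglyMeasurable) (ae_of_all _ fun x => ?_)
    rw [norm_mul, mul_comm, Complex.norm_real]
    gcongr
    exact hC x
  rw [← memLp_indicator_iff_restrict hK] at h1
  refine (congrArg (fun g => MemLp g 2 volume) (funext fun x => ?_)).mp h1
  by_cases hx : x ∈ tsupport f
  · rw [Set.indicator_of_mem hx]
  · rw [Set.indicator_of_notMem hx, image_eq_zero_of_notMem_tsupport hx, mul_zero]

/-- The function `-Δf + Pf`. -/
def lineOp (P : EuclideanSpace ℝ (Fin d) → ℝ) (f : EuclideanSpace ℝ (Fin d) → ℂ)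
    (x : EuclideanSpace ℝ (Fin d)) : ℂ := -lineLaplacian f x + (P x : ℂ) * f x

theorem IsTestFun.memLp_mul (hf : IsTestFun f) (hP : LocL2 P) :
    MemLp (fun x => (P x : ℂ) * f x) 2 volume :=
  hP.memLp_mul hf.continuous hf.hasCompactSupport

theorem IsTestFun.memLp_lineOp (hf : IsTestFun f) (hP : LocL2 P) : MemLp (lineOp P f) 2 volume :=
  hf.lineLaplacian.neg.memLp.add (hf.memLp_mul hP)

theorem IsTestFun.toL2_lineOp (hf : IsTestFun f) (hP : LocL2 P) :
    toL2 volume (lineOp P f) =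
      -toL2 volume (SchrodingerControl.lineLaplacian f) + toL2 volume (fun x => (P x : ℂ) * f x) := by
  rw [← toL2_neg hf.lineLaplacian.memLp]
  exact toL2_add hf.lineLaplacian.neg.memLp (hf.memLp_mul hP)

theorem lineOp_sub (hf : IsTestFun f) (hg : IsTestFun g) (x : EuclideanSpace ℝ (Fin d)) :
    lineOp P (fun x => f x - g x) x = lineOp P f x - lineOp P g x := by
  have e : (fun x => f x - g x) = fun x => f x + (-1 : ℂ) * g x := by
    funext x
    ring
  rw [lineOp, lineOp, lineOp, e, lineLaplacian_add hf.contDiff (hg.const_mul _).contDiff,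
    lineLaplacian_const_mul _ hg.contDiff]
  ring

/-- The graph of `-Δ + P` on the test functions. -/
def lineGraph (P : EuclideanSpace ℝ (Fin d) → ℝ) : Submodule ℂ
    (Lp ℂ 2 (volume : Measure (EuclideanSpace ℝ (Fin d))) ×
      Lp ℂ 2 (volume : Measure (EuclideanSpace ℝ (Fin d)))) where
  carrier := {q | ∃ f : EuclideanSpace ℝ (Fin d) → ℂ, ContDiff ℝ ∞ f ∧ HasCompactSupport f ∧
    q.1 =ᵐ[volume] f ∧ q.2 =ᵐ[volume] fun x => -lineLaplacian f x + (P x : ℂ) * f x}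
  add_mem' := by
    rintro q r ⟨f, hf, hfs, h1, h2⟩ ⟨g, hg, hgs, h3, h4⟩
    refine ⟨_, hf.add hg, hfs.add hgs, (Lp.coeFn_add _ _).trans (h1.add h3),
      (Lp.coeFn_add _ _).trans ?_⟩
    filter_upwards [h2, h4] with p hp hp'
    have := lineLaplacian_add hf hg p
    simp only [Pi.add_apply]
    rw [hp, hp', this]
    ring
  zero_mem' := by
    refine ⟨fun _ => 0, contDiff_const, HasCompactSupport.zero, Lp.coeFn_zero _ _ _,
      (Lp.coeFn_zero _ _ _).trans ?_⟩
    have h := lineLaplacian_const_mul (d := d) 0 (contDiff_const (c := (0 : ℂ)))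
    simp only [mul_zero, zero_mul] at h
    refine ae_of_all _ fun p => ?_
    simp [h]
  smul_mem' := by
    rintro c q ⟨f, hf, hfs, h1, h2⟩
    have h := IsTestFun.const_mul c ⟨hf, hfs⟩
    refine ⟨_, h.contDiff, h.hasCompactSupport, (Lp.coeFn_smul _ _).trans (h1.const_smul c),
      (Lp.coeFn_smul _ _).trans ?_⟩
    filter_upwards [h2] with p hp
    rw [Pi.smul_apply, hp, lineLaplacian_const_mul c hf, smul_eq_mul]
    ring

theorem coe_lineGraph (V : EuclideanSpace ℝ (Fin d) → ℝ) (u : Fin (d + 1) → ℝ) :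
    (lineGraph (linePotential V u) : Set _) = lineSystem V u := rfl

theorem mk_mem_lineGraph (hP : LocL2 P) (hf : IsTestFun f) :
    (toL2 volume f, toL2 volume (lineOp P f)) ∈ lineGraph P :=
  ⟨f, hf.contDiff, hf.hasCompactSupport, coeFn_toL2 hf.memLp, coeFn_toL2 (hf.memLp_lineOp hP)⟩

theorem exists_eq_of_mem_lineGraph {q} (hq : q ∈ lineGraph P) :
    ∃ f, IsTestFun f ∧ q.1 = toL2 volume f ∧ q.2 = toL2 volume (lineOp P f) := by
  obtain ⟨f, hf, hfs, h1, h2⟩ := hq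
  exact ⟨f, ⟨hf, hfs⟩, (toL2_eq h1).symm, (toL2_eq h2).symm⟩

theorem isSymmetricGraph_lineGraph (hP : LocL2 P) : IsSymmetricGraph (lineGraph P) := by
  intro p hp q hq
  obtain ⟨f, hf, h1, h2⟩ := exists_eq_of_mem_lineGraph hp
  obtain ⟨g, hg, h3, h4⟩ := exists_eq_of_mem_lineGraph hq
  have hPf := hf.memLp_mul hP
  have hPg := hg.memLp_mul hP
  rw [h1, h2, h3, h4, hf.toL2_lineOp hP, hg.toL2_lineOp hP, inner_add_left, inner_add_right,
    inner_neg_left, inner_neg_right,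
    inner_toL2 hf.lineLaplacian.memLp hg.memLp, inner_toL2 hf.memLp hg.lineLaplacian.memLp,
    inner_toL2 hPf hg.memLp, inner_toL2 hf.memLp hPg]
  congr 2
  · rw [← integral_lineLaplacian_mul hf.conj hg]
    refine integral_congr_ae (ae_of_all _ fun p => ?_)
    simp only [lineLaplacian_conj hf.contDiff]
  · funext p
    simp only [map_mul, Complex.conj_ofReal]
    ring

theorem dense_testFun : Dense {x : Lp ℂ 2 (volume : Measure (EuclideanSpace ℝ (Fin d))) |
    ∃ f, IsTestFun f ∧ toL2 volume f = x} := by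
  refine (Lp.dense_hasCompactSupport_contDiff (E := EuclideanSpace ℝ (Fin d)) (F := ℂ)
    (μ := volume) (p := 2) (by simp)).mono ?_
  rintro x ⟨g, h1, h2, h3⟩
  exact ⟨g, ⟨h3, h2⟩, toL2_eq h1⟩

theorem dense_domain_lineGraph (hP : LocL2 P) : Dense {x | ∃ y, (x, y) ∈ lineGraph P} := by
  refine dense_testFun.mono ?_
  rintro _ ⟨f, hf, rfl⟩
  exact ⟨_, mk_mem_lineGraph hP hf⟩

theorem inner_lineOp_re (hP : LocL2 P) (hf : IsTestFun f) :
    (inner ℂ (toL2 volume f) (toL2 volume (lineOp P f))).re =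
      ∑ j, ‖toL2 volume (partialDeriv j f)‖ ^ 2 + ∫ x, P x * ‖f x‖ ^ 2 := by
  rw [hf.toL2_lineOp hP, inner_add_right, inner_neg_lineLaplacian hf,
    inner_toL2 hf.memLp (hf.memLp_mul hP), Complex.add_re, Complex.ofReal_re]
  congr 1
  rw [← Complex.ofReal_re (∫ x, P x * ‖f x‖ ^ 2), ← integral_complex_ofReal]
  congr 2
  funext x
  push_cast
  rw [← Complex.conj_mul']
  ring

/-- Energy estimate: the quadratic form is `‖∇f‖² + ∫ P|f|²`, and the negative part of `P` costs at
most `c‖f‖²`. -/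
theorem sum_norm_sq_le_inner_lineOp (hP : LocL2 P) (hf : IsTestFun f) {c : ℝ}
    (hc : ∀ᵐ x, -c ≤ P x) : ∑ j, ‖toL2 volume (partialDeriv j f)‖ ^ 2 ≤
      (inner ℂ (toL2 volume f) (toL2 volume (lineOp P f))).re + c * ‖toL2 volume f‖ ^ 2 := by
  rw [inner_lineOp_re hP hf, norm_sq_toL2 hf.memLp, ← integral_const_mul, add_assoc,
    ← integral_add _ _]
  · refine le_add_of_nonneg_right (integral_nonneg_of_ae ?_)
    filter_upwards [hc] with x hx
    have : 0 ≤ (P x + c) * ‖f x‖ ^ 2 := mul_nonneg (by linarith) (by positivity)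
    simp only [Pi.zero_apply]
    linarith
  · have h := (hf.memLp.integrable_mul (hf.memLp_mul hP)).norm
    have h2 := (hf.conj.memLp.integrable_mul (hf.memLp_mul hP)).re
    refine h2.congr (ae_of_all _ fun x => ?_)
    have e : (starRingEnd ℂ) (f x) * ((P x : ℂ) * f x) = ((P x * ‖f x‖ ^ 2 : ℝ) : ℂ) := by
      push_cast
      rw [← Complex.conj_mul']
      ring
    simp only [Pi.mul_apply, e]
    exact Complex.ofReal_re _
  · exact ((memLp_two_iff_integrable_sq_norm hf.memLp.1).1 hf.memLp).const_mul c

end LocL2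

/-! ### Cutoffs, and a localised criterion for the density of the range. -/

section Cutoff

variable {d : ℕ}

theorem partialDeriv_comp_smul {f : EuclideanSpace ℝ (Fin d) → ℂ} (hf : ContDiff ℝ ∞ f) (c : ℝ)
    (j : Fin d) (x : EuclideanSpace ℝ (Fin d)) :
    partialDeriv j (fun x => f (c • x)) x = c * partialDeriv j f (c • x) := by
  have h := (hasFDerivAt_of_contDiff hf (c • x)).comp x ((hasFDerivAt_id x).const_smul c)
  refine (partialDeriv_eq h).trans ?_
  simp [partialDeriv]

/-- A smooth function equal to `1` on the ball of radius `R`, supported in the ball of radius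
`2R`, with a gradient and a Laplacian of size `1/R`. -/
structure IsCutoff (C R : ℝ) (η : EuclideanSpace ℝ (Fin d) → ℂ) : Prop where
  isTestFun : IsTestFun η
  eq_one : ∀ x, ‖x‖ ≤ R → η x = 1
  eq_zero : ∀ x, 2 * R ≤ ‖x‖ → η x = 0
  norm_le : ∀ x, ‖η x‖ ≤ 1
  partialDeriv_le : ∀ j x, ‖partialDeriv j η x‖ ≤ C / R
  lineLaplacian_le : ∀ x, ‖lineLaplacian η x‖ ≤ C / R
  partialDeriv_eq_zero : ∀ j x, ‖x‖ < R → partialDeriv j η x = 0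
  lineLaplacian_eq_zero : ∀ x, ‖x‖ < R → lineLaplacian η x = 0

theorem partialDeriv_eq_zero_of_eventually {f : EuclideanSpace ℝ (Fin d) → ℂ} {c : ℂ}
    {x : EuclideanSpace ℝ (Fin d)} (h : f =ᶠ[𝓝 x] fun _ => c) (j : Fin d) :
    partialDeriv j f x = 0 := by
  rw [partialDeriv, h.fderiv_eq]
  simp

/-- Rescale a fixed bump function by `R`. The Laplacian scales like `R⁻²`, which is at most `R⁻¹`
because `R ≥ 1`. -/
theorem exists_isCutoff : ∃ C, 0 ≤ C ∧ ∀ R, 1 ≤ R →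
    ∃ η : EuclideanSpace ℝ (Fin d) → ℂ, IsCutoff C R η := by
  let b : ContDiffBump (0 : EuclideanSpace ℝ (Fin d)) := ⟨1, 2, one_pos, one_lt_two⟩
  let χ : EuclideanSpace ℝ (Fin d) → ℂ := fun x => (b x : ℂ)
  have hχ : IsTestFun χ := ⟨Complex.ofRealCLM.contDiff.comp b.contDiff,
    b.hasCompactSupport.comp_left (g := fun r : ℝ => (r : ℂ)) Complex.ofReal_zero⟩
  have hD : ∀ j, ∃ C, 0 ≤ C ∧ ∀ x, ‖partialDeriv j χ x‖ ≤ C := fun j =>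
    (hχ.partialDeriv j).exists_norm_le
  choose A hA0 hA using hD
  obtain ⟨B, hB0, hB⟩ := hχ.lineLaplacian.exists_norm_le
  refine ⟨∑ j, A j + B, add_nonneg (Finset.sum_nonneg fun j _ => hA0 j) hB0, fun R hR => ?_⟩
  have hR0 : 0 < R := by linarith
  have hη : ContDiff ℝ ∞ fun x : EuclideanSpace ℝ (Fin d) => χ (R⁻¹ • x) :=
    hχ.contDiff.comp (contDiff_id.const_smul R⁻¹)
  have e1 : ∀ j, partialDeriv j (fun x : EuclideanSpace ℝ (Fin d) => χ (R⁻¹ • x)) =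
      fun x => ((R⁻¹ : ℝ) : ℂ) * partialDeriv j χ (R⁻¹ • x) := fun j =>
    funext fun x => partialDeriv_comp_smul hχ.contDiff _ j x
  have e2 : ∀ x, lineLaplacian (fun x : EuclideanSpace ℝ (Fin d) => χ (R⁻¹ • x)) x =
      ((R⁻¹ : ℝ) : ℂ) ^ 2 * lineLaplacian χ (R⁻¹ • x) := by
    intro x
    rw [lineLaplacian_eq hη, lineLaplacian_eq hχ.contDiff, Finset.mul_sum]
    refine Finset.sum_congr rfl fun j _ => ?_
    have h1 := contDiff_partialDeriv hχ.contDiff j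
    have h2 : ContDiff ℝ ∞ fun x : EuclideanSpace ℝ (Fin d) => partialDeriv j χ (R⁻¹ • x) :=
      h1.comp (contDiff_id.const_smul R⁻¹)
    rw [e1, partialDeriv_const_mul _ h2, partialDeriv_comp_smul h1]
    ring
  have hn : ∀ x : EuclideanSpace ℝ (Fin d), ‖R⁻¹ • x‖ = ‖x‖ / R := fun x => by
    rw [norm_smul, Real.norm_eq_abs, abs_of_pos (by positivity), inv_mul_eq_div]
  have hone : ∀ x : EuclideanSpace ℝ (Fin d), ‖x‖ ≤ R → χ (R⁻¹ • x) = 1 := fun x hx => by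
    have : R⁻¹ • x ∈ Metric.closedBall (0 : EuclideanSpace ℝ (Fin d)) b.rIn := by
      rw [mem_closedBall_zero_iff, hn]
      exact (div_le_one hR0).2 hx
    simp only [χ, b.one_of_mem_closedBall this, Complex.ofReal_one]
  have hev : ∀ x : EuclideanSpace ℝ (Fin d), ‖x‖ < R →
      (fun x : EuclideanSpace ℝ (Fin d) => χ (R⁻¹ • x)) =ᶠ[𝓝 x] fun _ => 1 := fun x hx => by
    filter_upwards [Metric.isOpen_ball.mem_nhds (mem_ball_zero_iff.2 hx)] with y hy
    exact hone y (mem_ball_zero_iff.1 hy).le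
  have hRi : ‖((R⁻¹ : ℝ) : ℂ)‖ = R⁻¹ := by
    rw [Complex.norm_real, Real.norm_eq_abs, abs_of_pos (by positivity)]
  have hev' : ∀ j x, ‖x‖ < R →
      partialDeriv j (fun x : EuclideanSpace ℝ (Fin d) => χ (R⁻¹ • x)) x = 0 := fun j x hx =>
    partialDeriv_eq_zero_of_eventually (hev x hx) j
  refine ⟨fun x => χ (R⁻¹ • x), ⟨⟨hη, ?_⟩, hone, ?_, ?_, ?_, ?_, hev', ?_⟩⟩
  · exact hχ.hasCompactSupport.comp_homeomorph (Homeomorph.smulOfNeZero R⁻¹ (by positivity))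
  · intro x hx
    have : b (R⁻¹ • x) = 0 := by
      refine b.zero_of_le_dist ?_
      rw [dist_zero_right, hn, le_div_iff₀ hR0]
      exact hx
    simp only [χ, this, Complex.ofReal_zero]
  · intro x
    simp only [χ, Complex.norm_real, Real.norm_eq_abs, abs_of_nonneg b.nonneg]
    exact b.le_one
  · intro j x
    rw [e1, norm_mul, hRi, inv_mul_eq_div]
    gcongr
    refine (hA j _).trans ?_
    have := Finset.single_le_sum (fun i _ => hA0 i) (Finset.mem_univ j)
    linarith
  · intro x
    rw [e2, norm_mul, norm_pow, hRi, div_eq_inv_mul]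
    have h1 : R⁻¹ ^ 2 ≤ R⁻¹ := by
      have : R⁻¹ ≤ 1 := inv_le_one_of_one_le₀ hR
      have : 0 < R⁻¹ := by positivity
      nlinarith
    gcongr
    refine (hB _).trans ?_
    have := Finset.sum_nonneg fun j (_ : j ∈ Finset.univ) => hA0 j
    linarith
  · intro x hx
    rw [lineLaplacian_eq hη]
    refine Finset.sum_eq_zero fun j _ => ?_
    refine partialDeriv_eq_zero_of_eventually (c := 0) ?_ j
    filter_upwards [Metric.isOpen_ball.mem_nhds (mem_ball_zero_iff.2 hx)] with y hy
    exact hev' j y (mem_ball_zero_iff.1 hy)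

variable {P : EuclideanSpace ℝ (Fin d) → ℝ} {f η : EuclideanSpace ℝ (Fin d) → ℂ} {C R : ℝ}

/-- The commutator of the Laplacian with a cutoff. -/
def cutoffError (η f : EuclideanSpace ℝ (Fin d) → ℂ) (x : EuclideanSpace ℝ (Fin d)) : ℂ :=
  2 * lineGrad η f x + lineLaplacian η x * f x

theorem lineOp_mul (hη : ContDiff ℝ ∞ η) (hf : ContDiff ℝ ∞ f) (x : EuclideanSpace ℝ (Fin d)) :
    lineOp P (fun x => η x * f x) x = η x * lineOp P f x - cutoffError η f x := by
  rw [lineOp, lineLaplacian_mul hη hf, lineOp, cutoffError]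
  ring

theorem IsTestFun.cutoffError (hη : IsTestFun η) (hf : ContDiff ℝ ∞ f) :
    IsTestFun (cutoffError η f) := by
  have h : IsTestFun (SchrodingerControl.lineGrad η f) := by
    rw [show SchrodingerControl.lineGrad η f = SchrodingerControl.lineGrad f η from
      funext fun x => lineGrad_comm x]
    exact IsTestFun.lineGrad hf hη
  exact (h.const_mul 2).add (hη.lineLaplacian.mul_right hf)

theorem IsCutoff.cutoffError_eq_zero (hη : IsCutoff C R η) {x : EuclideanSpace ℝ (Fin d)}
    (hx : ‖x‖ < R) : cutoffError η f x = 0 := by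
  have : lineGrad η f x = 0 := Finset.sum_eq_zero fun j _ => by
    rw [hη.partialDeriv_eq_zero j x hx, zero_mul]
  rw [SchrodingerControl.cutoffError, this, hη.lineLaplacian_eq_zero x hx]
  simp

/-- The factor `R⁻¹` compensates a gradient of order `R`: in that regime the commutator is bounded
in `L²` uniformly in `R`, although not small. -/
theorem IsCutoff.norm_cutoffError_le (hη : IsCutoff C R η) (hf : ContDiff ℝ ∞ f)
    (hf2 : MemLp f 2 volume) (hDf : ∀ j, MemLp (partialDeriv j f) 2 volume) :
    ‖toL2 volume (cutoffError η f)‖ ≤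
      C / R * (2 * ∑ j, ‖toL2 volume (partialDeriv j f)‖ + ‖toL2 volume f‖) := by
  have h1 : ∀ j, IsTestFun fun x => partialDeriv j η x * partialDeriv j f x := fun j =>
    (hη.isTestFun.partialDeriv j).mul_right (contDiff_partialDeriv hf j)
  have h2 : IsTestFun fun x => lineLaplacian η x * f x := hη.isTestFun.lineLaplacian.mul_right hf
  have h3 : IsTestFun (lineGrad η f) := IsTestFun.sum fun j _ => h1 j
  have e : toL2 volume (cutoffError η f) =
      (2 : ℂ) • ∑ j, toL2 volume (fun x => partialDeriv j η x * partialDeriv j f x) +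
        toL2 volume (fun x => lineLaplacian η x * f x) := by
    rw [← toL2_sum _ fun j _ => (h1 j).memLp, ← toL2_smul _ (IsTestFun.sum fun j _ => h1 j).memLp]
    exact toL2_add (h3.const_mul 2).memLp h2.memLp
  rw [e]
  refine (norm_add_le _ _).trans ?_
  rw [norm_smul, mul_add, mul_left_comm, Finset.mul_sum]
  simp only [Complex.norm_ofNat]
  refine add_le_add (mul_le_mul_of_nonneg_left ((norm_sum_le _ _).trans
    (Finset.sum_le_sum fun j _ => ?_)) zero_le_two) ?_
  · refine norm_toL2_le (h1 j).memLp.1 (hDf j) _ (ae_of_all _ fun x => ?_)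
    rw [norm_mul]
    gcongr
    exact hη.partialDeriv_le j x
  · refine norm_toL2_le h2.memLp.1 hf2 _ (ae_of_all _ fun x => ?_)
    rw [norm_mul]
    gcongr
    exact hη.lineLaplacian_le x

theorem IsTestFun.exists_radius (hf : IsTestFun f) :
    ∃ R₀, ∀ x : EuclideanSpace ℝ (Fin d), R₀ ≤ ‖x‖ → f x = 0 := by
  obtain ⟨r, hr⟩ := hf.hasCompactSupport.isCompact.isBounded.subset_closedBall 0
  refine ⟨r + 1, fun x hx => image_eq_zero_of_notMem_tsupport fun h => ?_⟩
  have := mem_closedBall_zero_iff.1 (hr h)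
  linarith

/-- The range of `-Δ + P + z` is dense as soon as the equation can be approximately solved on
balls, with bounds that grow at most linearly on the gradient of the solution. -/
theorem dense_range_of_local_solutions (hP : LocL2 P) (z : ℂ)
    (H : ∀ h : EuclideanSpace ℝ (Fin d) → ℂ, IsTestFun h → ∃ C, 0 ≤ C ∧ ∀ R, 1 ≤ R → ∀ ε > 0, ∃ f,
      IsTestFun f ∧ ‖toL2 volume f‖ ≤ C ∧ (∀ j, ‖toL2 volume (partialDeriv j f)‖ ≤ C * R) ∧
        ‖toL2 volume (Set.indicator (Metric.ball 0 (2 * R))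
          fun x => lineOp P f x + z * f x - h x)‖ ≤ ε) :
    Dense {w | ∃ p ∈ lineGraph P, p.2 + z • p.1 = w} := by
  refine dense_range_of_forall_inner_eq_zero fun y hy => ?_
  refine dense_testFun.eq_zero_of_inner_left (𝕜 := ℂ) ?_
  rintro _ ⟨h, hh, rfl⟩
  obtain ⟨C, hC0, hC⟩ := H h hh
  obtain ⟨A, hA0, hA⟩ := exists_isCutoff (d := d)
  obtain ⟨R₁, hR₁⟩ := hh.exists_radius
  rw [← norm_le_zero_iff]
  set K : ℝ := ‖y‖ + A * (2 * (d * C) + C) with hK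
  have hK0 : 0 ≤ K := by positivity
  -- Test the orthogonality of `y` on the solution cut off by `η`: up to a residual of size `δ`,
  -- `⟪y, h⟫` is the product of `y` with the commutator, which is bounded uniformly in `R`.
  have key : ∀ δ > 0, ‖inner ℂ y (toL2 volume h)‖ ≤ δ * K := by
    intro δ hδ
    obtain ⟨_, ⟨g, hg, rfl⟩, hgy⟩ := Metric.mem_closure_iff.1 (dense_testFun y) δ hδ
    rw [dist_eq_norm] at hgy
    obtain ⟨R₂, hR₂⟩ := hg.exists_radius
    -- Beyond the supports of `h` and of the approximation `g` of `y`: then `η h = h`, and the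
    -- commutator, which vanishes for `‖x‖ < R`, is orthogonal to `g`. Only `y - g`, of norm less
    -- than `δ`, meets it.
    set R := max 1 (max R₁ R₂) with hR
    have hR1 : 1 ≤ R := le_max_left _ _
    have hR0 : 0 < R := by linarith
    have hh0 : ∀ x, R ≤ ‖x‖ → h x = 0 := fun x hx =>
      hR₁ x (le_trans (le_trans (le_max_left _ _) (le_max_right _ _)) hx)
    have hg0 : ∀ x, R ≤ ‖x‖ → g x = 0 := fun x hx =>
      hR₂ x (le_trans (le_trans (le_max_right _ _) (le_max_right _ _)) hx)
    obtain ⟨η, hη⟩ := hA R hR1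
    obtain ⟨f, hf, hf1, hf2, hf3⟩ := hC R hR1 δ hδ
    have hηf : IsTestFun fun x => η x * f x := hη.isTestFun.mul_right hf.contDiff
    have hr : MemLp (fun x => lineOp P f x + z * f x - h x) 2 volume :=
      ((hf.memLp_lineOp hP).add (hf.const_mul z).memLp).sub hh.memLp
    have hrR := hr.indicator (s := Metric.ball 0 (2 * R)) measurableSet_ball
    have herr := IsTestFun.cutoffError hη.isTestFun hf.contDiff
    have hηr : MemLp (fun x => η x * (lineOp P f x + z * f x - h x)) 2 volume := by
      refine MemLp.of_le hr (hη.isTestFun.continuous.aestronglyMeasurable.mul hr.1)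
        (ae_of_all _ fun x => ?_)
      rw [norm_mul]
      exact mul_le_of_le_one_left (norm_nonneg _) (hη.norm_le x)
    have hηr' : ‖toL2 volume fun x => η x * (lineOp P f x + z * f x - h x)‖ ≤ δ := by
      refine (norm_toL2_le_of_le hηr.1 hrR (ae_of_all _ fun x => ?_)).trans hf3
      by_cases hx : x ∈ Metric.ball 0 (2 * R)
      · rw [Set.indicator_of_mem hx, norm_mul]
        exact mul_le_of_le_one_left (norm_nonneg _) (hη.norm_le x)
      · rw [mem_ball_zero_iff, not_lt] at hx
        rw [hη.eq_zero x hx, zero_mul, norm_zero]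
        exact norm_nonneg _
    have herr' : ‖toL2 volume (cutoffError η f)‖ ≤ A * (2 * (d * C) + C) := by
      refine (hη.norm_cutoffError_le hf.contDiff hf.memLp
        fun j => (hf.partialDeriv j).memLp).trans ?_
      have h1 : ∑ j, ‖toL2 volume (partialDeriv j f)‖ ≤ d * (C * R) := by
        refine (Finset.sum_le_sum fun j _ => hf2 j).trans ?_
        simp
      have h2 : ‖toL2 volume f‖ ≤ C * R := hf1.trans (le_mul_of_one_le_right hC0 hR1)
      calc A / R * (2 * ∑ j, ‖toL2 volume (partialDeriv j f)‖ + ‖toL2 volume f‖)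
          ≤ A / R * (2 * (d * (C * R)) + C * R) := by gcongr
        _ = A * (2 * (d * C) + C) := by
          field_simp
    have e1 : toL2 volume (lineOp P fun x => η x * f x) + z • toL2 volume (fun x => η x * f x) =
        toL2 volume (fun x => η x * (lineOp P f x + z * f x - h x)) + toL2 volume h -
          toL2 volume (cutoffError η f) := by
      rw [← toL2_smul z hηf.memLp, ← toL2_add hηr hh.memLp]
      refine (toL2_add (hηf.memLp_lineOp hP) (hηf.const_mul z).memLp).symm.trans ?_
      refine Eq.trans ?_ (toL2_sub (hηr.add hh.memLp) herr.memLp)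
      congr 1
      funext x
      have hηh : η x * h x = h x := by
        by_cases hx : R ≤ ‖x‖
        · rw [hh0 x hx, mul_zero]
        · rw [hη.eq_one x (not_le.1 hx).le, one_mul]
      rw [lineOp_mul hη.isTestFun.contDiff hf.contDiff]
      linear_combination hηh
    have e2 : inner ℂ (toL2 volume g) (toL2 volume (cutoffError η f)) = 0 := by
      rw [inner_toL2 hg.memLp herr.memLp]
      refine integral_eq_zero_of_ae (ae_of_all _ fun x => ?_)
      by_cases hx : R ≤ ‖x‖
      · simp [hg0 x hx]
      · simp [hη.cutoffError_eq_zero (f := f) (not_le.1 hx)]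
    have e3 := hy _ (mk_mem_lineGraph hP hηf)
    simp only [e1] at e3
    have e4 : inner ℂ y (toL2 volume h) =
        inner ℂ (y - toL2 volume g) (toL2 volume (cutoffError η f)) -
          inner ℂ y (toL2 volume fun x => η x * (lineOp P f x + z * f x - h x)) := by
      rw [inner_sub_right, inner_add_right] at e3
      rw [inner_sub_left, e2]
      linear_combination e3
    rw [e4]
    refine (norm_sub_le _ _).trans ?_
    have h5 := norm_inner_le_norm (𝕜 := ℂ) (y - toL2 volume g) (toL2 volume (cutoffError η f))
    have h6 := norm_inner_le_norm (𝕜 := ℂ) y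
      (toL2 volume fun x => η x * (lineOp P f x + z * f x - h x))
    have h7 : ‖y - toL2 volume g‖ * ‖toL2 volume (cutoffError η f)‖ ≤
        δ * (A * (2 * (d * C) + C)) := by gcongr
    have h8 : ‖y‖ * ‖toL2 volume fun x => η x * (lineOp P f x + z * f x - h x)‖ ≤ ‖y‖ * δ := by
      gcongr
    rw [hK]
    linarith
  refine le_of_forall_pos_le_add fun ε hε => ?_
  refine (key (ε / (K + 1)) (by positivity)).trans ?_
  rw [zero_add, div_mul_eq_mul_div, div_le_iff₀ (by positivity)]
  nlinarith

end Cutoff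

/-! ### Approximate solutions of `-Δf + mf = k`, with a supremum bound. -/

section Resolvent

variable {d : ℕ}

-- Fourier multiplier with symbol `(4π²|ξ|² + m)⁻¹`, written as `m⁻¹(1 + |cξ|²)⁻¹` with `c = 2π/√m`
-- so that its temperate growth follows from that of powers of `1 + |ξ|²`.
open scoped SchwartzMap in
theorem exists_schwartz_solution {m : ℝ} (hm : 0 < m) {k : EuclideanSpace ℝ (Fin d) → ℂ}
    (hk : IsTestFun k) : ∃ u : 𝓢(EuclideanSpace ℝ (Fin d), ℂ),
      ∀ x, -lineLaplacian u x + m * u x = k x := by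
  set c : ℝ := 2 * Real.pi / Real.sqrt m with hc
  let σ : EuclideanSpace ℝ (Fin d) → ℝ := fun ξ => m⁻¹ * (1 + ‖c • ξ‖ ^ 2) ^ (-1 : ℝ)
  have hσ : σ.HasTemperateGrowth := by
    have h1 := (Function.hasTemperateGrowth_one_add_norm_sq_rpow
      (EuclideanSpace ℝ (Fin d)) (-1)).comp (f := fun ξ : EuclideanSpace ℝ (Fin d) => c • ξ)
      (by fun_prop)
    exact (Function.HasTemperateGrowth.const m⁻¹).mul h1
  have hσm : ∀ ξ, (2 * Real.pi) ^ 2 * (‖ξ‖ ^ 2 * σ ξ) + m * σ ξ = 1 := by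
    intro ξ
    have hs : Real.sqrt m ^ 2 = m := Real.sq_sqrt hm.le
    have hc2 : c ^ 2 = (2 * Real.pi) ^ 2 / m := by rw [hc, div_pow, hs]
    have hpos : 0 < 1 + c ^ 2 * ‖ξ‖ ^ 2 := by positivity
    simp only [σ]
    rw [Real.rpow_neg_one, norm_smul, mul_pow ‖c‖, Real.norm_eq_abs, sq_abs]
    have h2 : (2 * Real.pi) ^ 2 = c ^ 2 * m := by rw [hc2]; field_simp
    rw [h2]
    field_simp
    ring
  have hn : (fun ξ : EuclideanSpace ℝ (Fin d) => ‖ξ‖ ^ 2).HasTemperateGrowth := by fun_prop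
  set K : 𝓢(EuclideanSpace ℝ (Fin d), ℂ) := hk.hasCompactSupport.toSchwartzMap hk.contDiff with hK
  refine ⟨SchwartzMap.fourierMultiplierCLM ℂ σ K, fun x => ?_⟩
  have h1 : (2 * Real.pi) ^ 2 • SchwartzMap.fourierMultiplierCLM ℂ
        (fun ξ : EuclideanSpace ℝ (Fin d) => ‖ξ‖ ^ 2) (SchwartzMap.fourierMultiplierCLM ℂ σ K) +
      m • SchwartzMap.fourierMultiplierCLM ℂ σ K = K := by
    rw [SchwartzMap.fourierMultiplierCLM_fourierMultiplierCLM_apply hn hσ]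
    have e : ((2 * Real.pi) ^ 2 • ((fun ξ : EuclideanSpace ℝ (Fin d) => ‖ξ‖ ^ 2) * σ) + m • σ) =
        fun _ => (1 : ℝ) := by
      funext ξ
      exact hσm ξ
    have h2 : (2 * Real.pi) ^ 2 • SchwartzMap.fourierMultiplierCLM ℂ
          ((fun ξ : EuclideanSpace ℝ (Fin d) => ‖ξ‖ ^ 2) * σ) +
        m • SchwartzMap.fourierMultiplierCLM ℂ σ =
        SchwartzMap.fourierMultiplierCLM (E := EuclideanSpace ℝ (Fin d)) ℂ fun _ => (1 : ℝ) := by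
      rw [← e, ← SchwartzMap.fourierMultiplierCLM_smul (hn.mul hσ),
        ← SchwartzMap.fourierMultiplierCLM_smul hσ]
      -- Additivity in the symbol, as a finite sum with two terms.
      have := SchwartzMap.fourierMultiplierCLM_sum (E := EuclideanSpace ℝ (Fin d)) ℂ
        (s := (Finset.univ : Finset (Fin 2)))
        (g := ![(2 * Real.pi) ^ 2 • ((fun ξ : EuclideanSpace ℝ (Fin d) => ‖ξ‖ ^ 2) * σ), m • σ])
        (by
          intro i _
          fin_cases i
          · exact (Function.HasTemperateGrowth.const _).mul (hn.mul hσ)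
          · exact (Function.HasTemperateGrowth.const _).mul hσ)
      simp only [Fin.sum_univ_two, Matrix.cons_val_zero, Matrix.cons_val_one] at this
      exact this.symm
    have h3 := congrArg (fun L => L K) h2
    simpa using h3
  have h2 := SchwartzMap.laplacian_eq_fourierMultiplierCLM (SchwartzMap.fourierMultiplierCLM ℂ σ K)
  have h3 := congrArg (fun L : 𝓢(EuclideanSpace ℝ (Fin d), ℂ) => L x) h1
  have h4 := congrArg (fun L : 𝓢(EuclideanSpace ℝ (Fin d), ℂ) => L x) h2
  simp only [SchwartzMap.laplacian_apply] at h4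
  rw [lineLaplacian, h4]
  have h5 : K x = k x := rfl
  rw [← h5]
  refine Eq.trans ?_ h3
  simp only [add_apply, smul_apply, Complex.real_smul]
  push_cast
  ring_nf

/-- A positive second derivative would make `0` a local minimum as well, so `g` would be constant
near `0` and its second derivative would vanish. -/
theorem nonpos_of_isLocalMax {g g' : ℝ → ℝ} {c : ℝ} (hmax : IsLocalMax g 0)
    (h1 : ∀ t, HasDerivAt g (g' t) t) (h2 : HasDerivAt g' c 0) : c ≤ 0 := by
  by_contra hc
  rw [not_le] at hc
  have hd : deriv g = g' := funext fun t => (h1 t).deriv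
  have hmin : IsLocalMin g 0 := isLocalMin_of_deriv_deriv_pos (by rwa [hd, h2.deriv])
    hmax.deriv_eq_zero (h1 0).continuousAt
  have hconst : g =ᶠ[𝓝 0] fun _ => g 0 := by
    filter_upwards [hmax, hmin] with t ht ht'
    exact le_antisymm ht ht'
  have h3 : g' =ᶠ[𝓝 0] fun _ => 0 := by
    have := hconst.deriv
    rw [hd] at this
    simpa using this
  have := h3.deriv_eq
  rw [h2.deriv] at this
  simp at this
  linarith

theorem hasDerivAt_line {f : EuclideanSpace ℝ (Fin d) → ℂ} (hf : ContDiff ℝ ∞ f) (j : Fin d)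
    (x : EuclideanSpace ℝ (Fin d)) (t : ℝ) :
    HasDerivAt (fun t : ℝ => f (x + t • EuclideanSpace.single j (1 : ℝ)))
      (partialDeriv j f (x + t • EuclideanSpace.single j (1 : ℝ))) t := by
  have h1 : HasDerivAt (fun t : ℝ => x + t • EuclideanSpace.single j (1 : ℝ))
      (EuclideanSpace.single j (1 : ℝ)) t := by
    simpa using ((hasDerivAt_id t).smul_const (EuclideanSpace.single j (1 : ℝ))).const_add x
  exact (hasFDerivAt_of_contDiff hf _).comp_hasDerivAt t h1

/-- The maximum principle. -/
theorem norm_le_of_norm_neg_lineLaplacian_add_le {u : EuclideanSpace ℝ (Fin d) → ℂ}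
    (hu : ContDiff ℝ ∞ u) (hlim : Tendsto u (cocompact _) (𝓝 0)) {m K : ℝ} (hm : 0 < m)
    (hK : ∀ x, ‖-lineLaplacian u x + m * u x‖ ≤ K) (x : EuclideanSpace ℝ (Fin d)) :
    ‖u x‖ ≤ K / m := by
  have hK0 : 0 ≤ K := (norm_nonneg _).trans (hK 0)
  by_cases hx : u x = 0
  · rw [hx, norm_zero]
    positivity
  have hx0 : 0 < ‖u x‖ := norm_pos_iff.2 hx
  -- The rotation makes `c u(x)` equal to `‖u x‖`, which reduces the claim to the real function `v =
  -- Re(cu)`. It tends to `0` at infinity and is positive at `x`, so it attains its maximum, and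
  -- there `Δv ≤ 0`.
  set c : ℂ := (starRingEnd ℂ) (u x) / ‖u x‖ with hc
  have hc1 : ‖c‖ = 1 := by
    rw [hc, norm_div, RCLike.norm_conj, Complex.norm_real, norm_norm, div_self hx0.ne']
  let v : EuclideanSpace ℝ (Fin d) → ℝ := fun y => (c * u y).re
  have hvx : v x = ‖u x‖ := by
    simp only [v, hc]
    rw [div_mul_eq_mul_div, Complex.conj_mul', ← Complex.ofReal_pow, ← Complex.ofReal_div,
      Complex.ofReal_re, sq, mul_div_cancel_right₀ _ hx0.ne']
  have hvc : Continuous v := by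
    have := hu.continuous
    fun_prop
  have hvlim : Tendsto v (cocompact _) (𝓝 0) := by
    have : Continuous fun z : ℂ => (c * z).re := by fun_prop
    have h := (this.tendsto 0).comp hlim
    rwa [mul_zero, Complex.zero_re] at h
  obtain ⟨p, hp⟩ := hvc.exists_forall_ge' x (by
    filter_upwards [hvlim.eventually_lt_const (show (0 : ℝ) < v x by rwa [hvx])] with y hy
    exact hy.le)
  have hre : ∀ {g : ℝ → ℂ} {g' : ℂ} {t : ℝ}, HasDerivAt g g' t →
      HasDerivAt (fun s => (c * g s).re) (c * g').re t := fun h =>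
    Complex.reCLM.hasFDerivAt.comp_hasDerivAt _ (h.const_mul c)
  have hj : ∀ j, (c * partialDeriv j (partialDeriv j u) p).re ≤ 0 := by
    intro j
    refine nonpos_of_isLocalMax (g := fun t => v (p + t • EuclideanSpace.single j (1 : ℝ)))
      (Eventually.of_forall fun t => ?_) (fun t => hre (hasDerivAt_line hu j p t)) ?_
    · simpa using hp _
    · have := hre (hasDerivAt_line (contDiff_partialDeriv hu j) j p 0)
      simpa using this
  have hL : (c * lineLaplacian u p).re ≤ 0 := by
    rw [lineLaplacian_eq hu, Finset.mul_sum, Complex.re_sum]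
    exact Finset.sum_nonpos fun j _ => hj j
  have h1 : (c * (-lineLaplacian u p + m * u p)).re ≤ K := by
    refine (Complex.re_le_norm _).trans ?_
    rw [norm_mul, hc1, one_mul]
    exact hK p
  have h2 : (c * (-lineLaplacian u p + m * u p)).re = -(c * lineLaplacian u p).re + m * v p := by
    have e : c * (-lineLaplacian u p + m * u p) = -(c * lineLaplacian u p) + m * (c * u p) := by
      ring
    rw [e, Complex.add_re, Complex.neg_re, Complex.re_ofReal_mul]
  rw [le_div_iff₀ hm, ← hvx]
  have h3 := mul_le_mul_of_nonneg_left (hp x) hm.le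
  linarith

/-- Bounded square-integrable functions are approximated by test functions with almost the same
bound. -/
theorem exists_testFun_norm_sub_le {k : EuclideanSpace ℝ (Fin d) → ℂ} (hk : MemLp k 2 volume)
    {K δ ε : ℝ} (hK0 : 0 ≤ K) (hK : ∀ᵐ x, ‖k x‖ ≤ K) (hδ : 0 < δ) (hε : 0 < ε) :
    ∃ g, IsTestFun g ∧ (∀ x, ‖g x‖ ≤ K + δ) ∧ ‖toL2 volume (fun x => g x - k x)‖ ≤ ε := by
  obtain ⟨a, ha⟩ := dense_testFun.exists_dist_lt (toL2 volume k) (ε := ε / 4) (by positivity)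
  obtain ⟨⟨g₀, hg₀, rfl⟩, hd⟩ := ha
  rw [dist_comm, dist_eq_norm, ← toL2_sub hg₀.memLp hk] at hd
  set M : ℝ := K + δ / 2 with hM
  have hM0 : 0 < M := by positivity
  -- Radial retraction onto the disc of radius `M`. It at most doubles the distance to the points of
  -- the disc, hence to the values of `k`, so truncating `g₀` keeps it close to `k` in `L²`.
  let r : ℂ → ℂ := fun z => ((M / max M ‖z‖ : ℝ) : ℂ) * z
  have hrc : Continuous r := by
    refine (Complex.continuous_ofReal.comp (continuous_const.div (by fun_prop) fun z => ?_)).mul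
      continuous_id
    exact (hM0.trans_le (le_max_left _ _)).ne'
  have hr1 : ∀ z, ‖r z‖ ≤ M := by
    intro z
    simp only [r]
    rw [norm_mul, Complex.norm_real, Real.norm_eq_abs, abs_of_nonneg (by positivity),
      div_mul_eq_mul_div, div_le_iff₀ (by positivity)]
    exact mul_le_mul_of_nonneg_left (le_max_right _ _) hM0.le
  have hr2 : ∀ z w : ℂ, ‖w‖ ≤ M → ‖r z - w‖ ≤ 2 * ‖z - w‖ := by
    intro z w hw
    rcases le_total ‖z‖ M with h | h
    · have : r z = z := by
        simp only [r]
        rw [max_eq_left h, div_self hM0.ne', Complex.ofReal_one, one_mul]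
      rw [this]
      linarith [norm_nonneg (z - w)]
    · have hz0 : 0 < ‖z‖ := hM0.trans_le h
      have h1 : ‖r z - z‖ = ‖z‖ - M := by
        have : r z - z = ((M / ‖z‖ - 1 : ℝ) : ℂ) * z := by
          simp only [r]
          rw [max_eq_right h]
          push_cast
          ring
        rw [this, norm_mul, Complex.norm_real, Real.norm_eq_abs, abs_of_nonpos]
        · field_simp
          ring
        · rw [sub_nonpos, div_le_one hz0]
          exact h
      have h2 := norm_add_le (r z - z) (z - w)
      rw [sub_add_sub_cancel, h1] at h2
      have h3 := norm_sub_norm_le z w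
      linarith
  have hr0 : r 0 = 0 := by simp [r]
  have hrg : Continuous fun x => r (g₀ x) := hrc.comp hg₀.continuous
  have hrgs : HasCompactSupport fun x => r (g₀ x) := hg₀.hasCompactSupport.comp_left hr0
  have hrgL : MemLp (fun x => r (g₀ x)) 2 volume := hrg.memLp_of_hasCompactSupport hrgs
  have hT : MeasurableSet (tsupport fun x => r (g₀ x)) := (isClosed_tsupport _).measurableSet
  have h1T : MemLp ((tsupport fun x => r (g₀ x)).indicator fun _ => (1 : ℂ)) 2
      (volume : Measure (EuclideanSpace ℝ (Fin d))) :=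
    memLp_indicator_const 2 hT 1 (Or.inr hrgs.measure_lt_top.ne)
  set N := ‖toL2 volume ((tsupport fun x => r (g₀ x)).indicator fun _ => (1 : ℂ))‖ with hN
  -- Uniform error allowed when smoothing `r ∘ g₀` inside its support: the first bound preserves the
  -- supremum bound `K + δ`, the second one makes the `L²` error at most `ε/4`.
  set e : ℝ := min (δ / 2) (ε / (4 * (N + 1))) with he
  have he0 : 0 < e := lt_min (by positivity) (by positivity)
  obtain ⟨g, hg1, hg2, hg3⟩ := hrg.exists_contDiff_approx ⊤ (ε := fun _ => e) continuous_const
    fun _ => he0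
  have hg : IsTestFun g := ⟨hg1, hrgs.mono hg3⟩
  have hg2' : ∀ x, ‖g x - r (g₀ x)‖ ≤ e := fun x => by
    rw [← dist_eq_norm]
    exact (hg2 x).le
  refine ⟨g, hg, fun x => ?_, ?_⟩
  · have h1 := norm_add_le (g x - r (g₀ x)) (r (g₀ x))
    rw [sub_add_cancel] at h1
    have h2 := hg2' x
    have h3 := hr1 (g₀ x)
    have h4 : e ≤ δ / 2 := min_le_left _ _
    linarith
  · have hA : ‖toL2 volume (fun x => g x - r (g₀ x))‖ ≤ e * N := by
      refine norm_toL2_le (hg.memLp.sub hrgL).1 h1T _ (ae_of_all _ fun x => ?_)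
      by_cases hx : x ∈ tsupport fun x => r (g₀ x)
      · rw [Set.indicator_of_mem hx, norm_one, mul_one]
        exact hg2' x
      · have hx0 : r (g₀ x) = 0 :=
          image_eq_zero_of_notMem_tsupport (f := fun x => r (g₀ x)) hx
        have hx1 : g x = 0 := by
          by_contra hne
          exact hg3 hne hx0
        change ‖g x - r (g₀ x)‖ ≤ _
        rw [hx0, hx1, sub_zero, norm_zero]
        positivity
    have hB : ‖toL2 volume (fun x => r (g₀ x) - k x)‖ ≤ 2 * (ε / 4) := by
      refine (norm_toL2_le (hrgL.sub hk).1 (hg₀.memLp.sub hk) 2 ?_).trans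
        (mul_le_mul_of_nonneg_left hd.le zero_le_two)
      filter_upwards [hK] with x hx
      exact hr2 _ _ (by linarith)
    have e1 : toL2 volume (fun x => g x - k x) =
        toL2 volume (fun x => g x - r (g₀ x)) + toL2 volume (fun x => r (g₀ x) - k x) := by
      refine Eq.trans ?_ (toL2_add (hg.memLp.sub hrgL) (hrgL.sub hk))
      congr 1
      funext x
      simp
    rw [e1]
    refine (norm_add_le _ _).trans ((add_le_add hA hB).trans ?_)
    have h4 : e * N ≤ ε / 4 := by
      have h5 : e ≤ ε / (4 * (N + 1)) := min_le_right _ _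
      rw [le_div_iff₀ (by positivity)] at h5
      nlinarith
    linarith

open scoped SchwartzMap LineDeriv in
/-- The equation `-Δf + mf = k` has approximate solutions bounded by `sup |k| / m`. -/
theorem exists_testFun_resolvent {k : EuclideanSpace ℝ (Fin d) → ℂ} (hk : MemLp k 2 volume)
    {m K δ ε : ℝ} (hm : 0 < m) (hK0 : 0 ≤ K) (hK : ∀ᵐ x, ‖k x‖ ≤ K) (hδ : 0 < δ) (hε : 0 < ε) :
    ∃ f, IsTestFun f ∧ (∀ x, ‖f x‖ ≤ (K + δ) / m) ∧
      ‖toL2 volume (fun x => lineOp (fun _ => m) f x - k x)‖ ≤ ε := by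
  obtain ⟨g, hg, hgK, hgk⟩ := exists_testFun_norm_sub_le hk hK0 hK hδ (half_pos hε)
  obtain ⟨u, hu⟩ := exists_schwartz_solution hm hg
  have hus : ContDiff ℝ ∞ (u : EuclideanSpace ℝ (Fin d) → ℂ) := u.smooth'
  have huK := norm_le_of_norm_neg_lineLaplacian_add_le hus u.tendsto_cocompact hm
    (K := K + δ) fun x => by
      have := hu x
      exact this ▸ hgK x
  have huL : MemLp u 2 volume := u.memLp 2 volume
  have hDu : ∀ j, MemLp (partialDeriv j u) 2 volume := fun j =>
    (∂_{EuclideanSpace.single j (1 : ℝ)} u).memLp 2 volume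
  obtain ⟨C, hC0, hC⟩ := exists_isCutoff (d := d)
  obtain ⟨R₁, hR₁⟩ := hg.exists_radius
  set N := 2 * ∑ j, ‖toL2 volume (partialDeriv j u)‖ + ‖toL2 volume u‖ with hN
  have hN0 : 0 ≤ N := by positivity
  -- Large enough for the cutoff to be `1` on the support of `g` and for the commutator, of norm at
  -- most `CN/R`, to be below `ε/2`.
  set R := max 1 (max R₁ (2 * (C * N) / ε)) with hR
  have hR1 : 1 ≤ R := le_max_left _ _
  have hR2 : R₁ ≤ R := (le_max_left _ _).trans (le_max_right _ _)
  have hR3 : 2 * (C * N) / ε ≤ R := (le_max_right _ _).trans (le_max_right _ _)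
  have hR0 : 0 < R := by linarith
  obtain ⟨η, hη⟩ := hC R hR1
  have hηu : IsTestFun fun x => η x * u x := hη.isTestFun.mul_right hus
  have herr := IsTestFun.cutoffError hη.isTestFun hus
  refine ⟨_, hηu, fun x => ?_, ?_⟩
  · rw [norm_mul]
    exact (mul_le_of_le_one_left (norm_nonneg _) (hη.norm_le x)).trans (huK x)
  · have e : (fun x => lineOp (fun _ => m) (fun x => η x * u x) x - k x) =
        fun x => (g x - k x) - cutoffError η u x := by
      funext x
      rw [lineOp_mul hη.isTestFun.contDiff hus, lineOp, hu x]
      by_cases hx : R ≤ ‖x‖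
      · rw [hR₁ x (hR2.trans hx)]
        ring
      · rw [hη.eq_one x (not_le.1 hx).le]
        ring
    rw [e]
    refine (congrArg norm (toL2_sub (hg.memLp.sub hk) herr.memLp)).le.trans ?_
    refine (norm_sub_le _ _).trans ?_
    have h1 := hη.norm_cutoffError_le hus huL hDu
    have h2 : C / R * N ≤ ε / 2 := by
      rw [div_le_iff₀ hε] at hR3
      rw [div_mul_eq_mul_div, div_le_iff₀ hR0]
      linarith
    have h3 : ‖toL2 volume (fun x => g x - k x)‖ ≤ ε / 2 := hgk
    exact (add_le_add h3 (h1.trans h2)).trans (by linarith)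

end Resolvent

/-! ### Essential self-adjointness -/

section SelfAdjoint

variable {d : ℕ} {P W : EuclideanSpace ℝ (Fin d) → ℝ} {f h : EuclideanSpace ℝ (Fin d) → ℂ}

theorem mul_norm_le_norm_lineOp (hP : LocL2 P) (hf : IsTestFun f) {c : ℝ}
    (hc : ∀ᵐ x, c ≤ P x) : c * ‖toL2 volume f‖ ≤ ‖toL2 volume (lineOp P f)‖ := by
  have h1 := sum_norm_sq_le_inner_lineOp hP hf (c := -c) (by simpa using hc)
  have h2 : 0 ≤ ∑ j, ‖toL2 volume (partialDeriv j f)‖ ^ 2 := by positivity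
  have h3 := (Complex.re_le_norm _).trans
    (norm_inner_le_norm (𝕜 := ℂ) (toL2 volume f) (toL2 volume (lineOp P f)))
  rcases eq_or_lt_of_le (norm_nonneg (toL2 volume f)) with h0 | h0
  · rw [← h0, mul_zero]
    exact norm_nonneg _
  · refine le_of_mul_le_mul_left ?_ h0
    nlinarith

theorem lineOp_const_eq (m : ℝ) (x : EuclideanSpace ℝ (Fin d)) :
    lineOp (fun _ => m) f x = lineOp W f x + ((m - W x : ℝ) : ℂ) * f x := by
  rw [lineOp, lineOp]
  push_cast
  ring

/-- For a bounded nonnegative potential `W`, the equation `-Δf + Wf + f = h` has approximate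
solutions that are bounded independently of `W`. -/
theorem exists_testFun_bounded_potential (hW : LocL2 W) {M K ε : ℝ} (hM : 0 ≤ M)
    (hW0 : ∀ᵐ x, 0 ≤ W x) (hWM : ∀ᵐ x, W x ≤ M) (hh : IsTestFun h) (hK0 : 0 ≤ K)
    (hK : ∀ x, ‖h x‖ ≤ K) (hε : 0 < ε) :
    ∃ f, IsTestFun f ∧ (∀ x, ‖f x‖ ≤ K + 1) ∧
      ‖toL2 volume (fun x => lineOp W f x + f x - h x)‖ ≤ ε := by
  set q : ℝ := M / (1 + M) with hq
  have hM1 : 0 < 1 + M := by linarith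
  have hq0 : 0 ≤ q := by positivity
  have hq1 : q < 1 := (div_lt_one hM1).2 (by linarith)
  have hqM : q * (1 + M) = M := div_mul_cancel₀ _ hM1.ne'
  set e : ℝ := ε / (4 * (1 + M)) with he
  have he0 : 0 < e := by positivity
  have heM : 2 * e * (1 + M) = ε / 2 := by
    rw [he]
    field_simp
    ring
  have hMW : LocL2 fun x => M - W x := hW.const_sub M
  -- Iteration of `(-Δ + 1 + M)g = h + (M - W)f`, each step being solved up to `e`. As `0 ≤ M - W ≤
  -- M`, the residual contracts by `q = M/(1 + M)`. The supremum bound reproduces itself, since `(K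
  -- + M(K + 1) + 1)/(1 + M) = K + 1`; the additional `1` is the tolerance of the resolvent step.
  have key : ∀ n : ℕ, ∃ f, IsTestFun f ∧ (∀ x, ‖f x‖ ≤ K + 1) ∧
      ‖toL2 volume (fun x => lineOp W f x + f x - h x)‖ ≤
        q ^ n * ‖toL2 volume h‖ + 2 * e * (1 + M) := by
    intro n
    induction n with
    | zero =>
      refine ⟨fun _ => 0, IsTestFun.zero, fun x => by rw [norm_zero]; positivity, ?_⟩
      have e0 : (fun x : EuclideanSpace ℝ (Fin d) => lineOp W (fun _ => 0) x + 0 - h x) =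
          fun x => -h x := by
        funext x
        have := lineOp_sub (P := W) hh hh x
        simp only [sub_self] at this
        rw [this]
        ring
      rw [e0, toL2_neg hh.memLp, norm_neg, pow_zero, one_mul]
      linarith [mul_pos (mul_pos two_pos he0) hM1]
    | succ n ih =>
      obtain ⟨f, hf, hfK, hfn⟩ := ih
      have hk : MemLp (fun x => h x + ((M - W x : ℝ) : ℂ) * f x) 2 volume :=
        hh.memLp.add (hf.memLp_mul hMW)
      have hkK : ∀ᵐ x, ‖h x + ((M - W x : ℝ) : ℂ) * f x‖ ≤ K + M * (K + 1) := by
        filter_upwards [hW0, hWM] with x h0 h1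
        refine (norm_add_le _ _).trans (add_le_add (hK x) ?_)
        rw [norm_mul, Complex.norm_real, Real.norm_eq_abs, abs_of_nonneg (by linarith)]
        have := hfK x
        gcongr
        linarith
      obtain ⟨g, hg, hgK, hgn⟩ := exists_testFun_resolvent hk hM1 (by positivity) hkK one_pos he0
      have hgf : IsTestFun fun x => g x - f x := hg.sub hf
      set r : EuclideanSpace ℝ (Fin d) → ℂ := fun x => lineOp W f x + f x - h x with hr
      set s : EuclideanSpace ℝ (Fin d) → ℂ := fun x =>
        lineOp (fun _ => 1 + M) g x - (h x + ((M - W x : ℝ) : ℂ) * f x) with hs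
      have hrL : MemLp r 2 volume := ((hf.memLp_lineOp hW).add hf.memLp).sub hh.memLp
      have hcL : LocL2 fun _ : EuclideanSpace ℝ (Fin d) => 1 + M := Continuous.locL2 continuous_const
      have hsL : MemLp s 2 volume := (hg.memLp_lineOp hcL).sub hk
      have h1 : (1 + M) * ‖toL2 volume fun x => g x - f x‖ ≤ e + ‖toL2 volume r‖ := by
        refine (mul_norm_le_norm_lineOp hcL hgf (ae_of_all _ fun _ => le_rfl)).trans ?_
        have e1 : lineOp (fun _ => 1 + M) (fun x => g x - f x) = fun x => s x - r x := by
          funext x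
          rw [lineOp_sub hg hf, hs, hr, lineOp_const_eq (W := W) (f := f)]
          push_cast
          ring
        rw [e1, toL2_sub hsL hrL]
        exact (norm_sub_le _ _).trans (add_le_add hgn le_rfl)
      refine ⟨g, hg, fun x => (hgK x).trans ?_, ?_⟩
      · rw [div_le_iff₀ hM1]
        linarith
      · have e2 : (fun x => lineOp W g x + g x - h x) =
            fun x => s x - ((M - W x : ℝ) : ℂ) * (g x - f x) := by
          funext x
          simp only [hs]
          rw [lineOp_const_eq (W := W) (f := g)]
          push_cast
          ring
        have h2 : ‖toL2 volume fun x => ((M - W x : ℝ) : ℂ) * (g x - f x)‖ ≤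
            M * ‖toL2 volume fun x => g x - f x‖ := by
          refine norm_toL2_le (hgf.memLp_mul hMW).1 hgf.memLp _ ?_
          filter_upwards [hW0, hWM] with x h0 h1
          rw [norm_mul, Complex.norm_real, Real.norm_eq_abs, abs_of_nonneg (by linarith)]
          gcongr
          linarith
        rw [e2, toL2_sub hsL (hgf.memLp_mul hMW)]
        refine (norm_sub_le _ _).trans ((add_le_add hgn h2).trans ?_)
        have h3 : M * ‖toL2 volume fun x => g x - f x‖ ≤ q * (e + ‖toL2 volume r‖) := by
          rw [← hqM, mul_assoc]
          exact mul_le_mul_of_nonneg_left h1 hq0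
        have h4 : q * ‖toL2 volume r‖ ≤ q * (q ^ n * ‖toL2 volume h‖ + 2 * e * (1 + M)) :=
          mul_le_mul_of_nonneg_left hfn hq0
        have h5 : q * (2 * e * (1 + M)) = 2 * e * M := by
          rw [mul_comm (2 * e), ← mul_assoc, hqM]
          ring
        have h6 : q * e ≤ e := mul_le_of_le_one_left he0.le hq1.le
        rw [pow_succ]
        nlinarith
  have hlim : Tendsto (fun n : ℕ => q ^ n * ‖toL2 volume h‖) atTop (𝓝 0) := by
    simpa using (tendsto_pow_atTop_nhds_zero_of_lt_one hq0 hq1).mul_const ‖toL2 volume h‖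
  obtain ⟨n, hn⟩ := (hlim.eventually_le_const (show (0 : ℝ) < ε / 2 by positivity)).exists
  obtain ⟨f, hf, hfK, hfn⟩ := key n
  exact ⟨f, hf, hfK, hfn.trans (by rw [heM]; linarith)⟩

/-- Truncations of a nonnegative potential converge in `L²` of a compact set. -/
theorem LocL2.exists_truncation (hP : LocL2 P) (hP0 : ∀ᵐ x, 0 ≤ P x)
    {B : Set (EuclideanSpace ℝ (Fin d))} (hB : IsCompact B) {ε : ℝ} (hε : 0 < ε) :
    ∃ n : ℕ, MemLp (B.indicator fun x => ((P x - min (P x) n : ℝ) : ℂ)) 2 volume ∧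
      ‖toL2 volume (B.indicator fun x => ((P x - min (P x) n : ℝ) : ℂ))‖ < ε := by
  have hm : ∀ Q, LocL2 Q → MemLp (B.indicator fun x => ((Q x : ℝ) : ℂ)) 2
      (volume : Measure (EuclideanSpace ℝ (Fin d))) := fun Q hQ =>
    (memLp_indicator_iff_restrict hB.measurableSet).2 (hQ B hB).ofReal
  have hF : ∀ n : ℕ, MemLp (B.indicator fun x => ((P x - min (P x) n : ℝ) : ℂ)) 2 volume :=
    fun n => hm _ (hP.of_abs_le (F := fun t => t - min t n) (c := n) (by fun_prop)
      (fun _ => rfl) fun t => by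
        have hn : (0 : ℝ) ≤ n := Nat.cast_nonneg n
        rcases le_total t n with h | h
        · rw [min_eq_left h, sub_self, abs_zero]
          positivity
        · rw [min_eq_right h, abs_of_nonneg (by linarith), abs_of_nonneg (by linarith)]
          linarith)
  have h1 : Tendsto (fun n : ℕ => ∫ x, ‖B.indicator (fun x => ((P x - min (P x) n : ℝ) : ℂ)) x‖ ^ 2)
      atTop (𝓝 (∫ _ : EuclideanSpace ℝ (Fin d), (0 : ℝ))) := by
    refine tendsto_integral_of_dominated_convergence
      (fun x => ‖B.indicator (fun x => (P x : ℂ)) x‖ ^ 2) (fun n => (hF n).1.norm.pow 2) ?_ ?_ ?_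
    · exact (memLp_two_iff_integrable_sq_norm (hm P hP).1).1 (hm P hP)
    · intro n
      filter_upwards [hP0] with x hx
      rw [Real.norm_eq_abs, abs_of_nonneg (by positivity)]
      by_cases hxB : x ∈ B
      · rw [Set.indicator_of_mem hxB, Set.indicator_of_mem hxB, Complex.norm_real,
          Complex.norm_real, Real.norm_eq_abs, Real.norm_eq_abs, abs_of_nonneg hx,
          abs_of_nonneg (sub_nonneg.2 (min_le_left _ _))]
        have h2 : 0 ≤ min (P x) n := le_min hx (Nat.cast_nonneg n)
        have h3 : min (P x) n ≤ P x := min_le_left _ _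
        gcongr
        linarith
      · rw [Set.indicator_of_notMem hxB, Set.indicator_of_notMem hxB]
    · refine ae_of_all _ fun x => ?_
      refine tendsto_const_nhds.congr' ?_
      filter_upwards [eventually_ge_atTop ⌈P x⌉₊] with n hn
      have h2 : P x ≤ n := (Nat.le_ceil _).trans (by exact_mod_cast hn)
      by_cases hxB : x ∈ B
      · rw [Set.indicator_of_mem hxB, min_eq_left h2, sub_self]
        simp
      · rw [Set.indicator_of_notMem hxB]
        simp
  rw [integral_zero] at h1
  obtain ⟨n, hn⟩ := (h1.eventually_lt_const (show (0 : ℝ) < ε ^ 2 by positivity)).exists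
  refine ⟨n, hF n, ?_⟩
  rw [← norm_sq_toL2 (hF n)] at hn
  exact lt_of_pow_lt_pow_left₀ 2 hε.le hn

theorem setOf_range_lineGraph (hP : LocL2 P) (z : ℂ) :
    {w | ∃ p ∈ lineGraph P, p.2 + z • p.1 = w} =
      {w | ∃ f, IsTestFun f ∧ toL2 volume (fun x => lineOp P f x + z * f x) = w} := by
  have e : ∀ f, IsTestFun f → toL2 volume (fun x => lineOp P f x + z * f x) =
      toL2 volume (lineOp P f) + z • toL2 volume f := fun f hf => by
    rw [← toL2_smul z hf.memLp]
    exact toL2_add (hf.memLp_lineOp hP) (hf.const_mul z).memLp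
  ext w
  constructor
  · rintro ⟨p, hp, rfl⟩
    obtain ⟨f, hf, h1, h2⟩ := exists_eq_of_mem_lineGraph hp
    exact ⟨f, hf, by rw [h1, h2, e f hf]⟩
  · rintro ⟨f, hf, rfl⟩
    exact ⟨_, mk_mem_lineGraph hP hf, (e f hf).symm⟩

theorem norm_le_of_norm_lineOp_add_le (hP : LocL2 P) (hP0 : ∀ᵐ x, 0 ≤ P x) (hf : IsTestFun f)
    {A : ℝ} (hA : ‖toL2 volume (lineOp P f) + toL2 volume f‖ ≤ A) :
    ‖toL2 volume f‖ ≤ A ∧ ∀ j, ‖toL2 volume (partialDeriv j f)‖ ≤ A := by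
  have hA0 : 0 ≤ A := (norm_nonneg _).trans hA
  have h2 := sum_norm_sq_le_inner_lineOp hP hf (c := 0) (by simpa using hP0)
  have h3 := (Complex.re_le_norm _).trans (norm_inner_le_norm (𝕜 := ℂ) (toL2 volume f)
    (toL2 volume (lineOp P f) + toL2 volume f))
  have h4 : (inner ℂ (toL2 volume f) (toL2 volume f)).re = ‖toL2 volume f‖ ^ 2 :=
    inner_self_eq_norm_sq (𝕜 := ℂ) _
  rw [inner_add_right, Complex.add_re, h4] at h3
  have h5 : ‖toL2 volume f‖ * ‖toL2 volume (lineOp P f) + toL2 volume f‖ ≤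
      ‖toL2 volume f‖ * A := by gcongr
  have h6 : 0 ≤ ∑ j, ‖toL2 volume (partialDeriv j f)‖ ^ 2 :=
    Finset.sum_nonneg fun j _ => sq_nonneg _
  have h7 : ‖toL2 volume f‖ ≤ A := by
    have : ‖toL2 volume f‖ ^ 2 ≤ ‖toL2 volume f‖ * A := by linarith
    by_contra hlt
    rw [not_le] at hlt
    nlinarith
  refine ⟨h7, fun j => le_of_sq_le_sq ?_ hA0⟩
  have h8 : ‖toL2 volume (partialDeriv j f)‖ ^ 2 ≤ ∑ j, ‖toL2 volume (partialDeriv j f)‖ ^ 2 :=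
    Finset.single_le_sum (f := fun j => ‖toL2 volume (partialDeriv j f)‖ ^ 2)
      (fun i _ => sq_nonneg _) (Finset.mem_univ j)
  have h9 : ‖toL2 volume f‖ * A ≤ A * A := mul_le_mul_of_nonneg_right h7 hA0
  have h10 := sq_nonneg ‖toL2 volume f‖
  linarith

/-- Solve with `P` truncated at height `n`. The supremum bound on the solution does not depend on
`n`, so the discarded part of the potential times the solution is small in `L²` of the ball as soon
as the discarded part is. Norm and gradient are bounded by the energy estimate. -/
theorem dense_range_lineGraph_of_nonneg (hP : LocL2 P) (hP0 : ∀ᵐ x, 0 ≤ P x) :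
    Dense {w | ∃ p ∈ lineGraph P, p.2 + (1 : ℂ) • p.1 = w} := by
  refine dense_range_of_local_solutions hP 1 fun h hh => ?_
  obtain ⟨K, hK0, hK⟩ := hh.exists_norm_le
  set A : ℝ := ‖toL2 volume h‖ + 1 with hA
  have hA0 : 0 < A := by positivity
  refine ⟨A, hA0.le, fun R hR ε hε => ?_⟩
  set B : Set (EuclideanSpace ℝ (Fin d)) := Metric.closedBall 0 (2 * R)
  obtain ⟨n, hn, hnε⟩ := hP.exists_truncation hP0 (isCompact_closedBall 0 (2 * R))
    (show 0 < ε / (2 * (K + 1)) by positivity)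
  have hW : LocL2 fun x => min (P x) n := hP.min_const n
  have hW0 : ∀ᵐ x, 0 ≤ min (P x) (n : ℝ) := by
    filter_upwards [hP0] with x hx
    exact le_min hx (Nat.cast_nonneg n)
  obtain ⟨f, hf, hfK, hfε⟩ := exists_testFun_bounded_potential hW (Nat.cast_nonneg n) hW0
    (ae_of_all _ fun x => min_le_right _ _) hh hK0 hK (show 0 < min 1 (ε / 2) by positivity)
  have hr : MemLp (fun x => lineOp (fun x => min (P x) n) f x + f x - h x) 2 volume :=
    ((hf.memLp_lineOp hW).add hf.memLp).sub hh.memLp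
  have h1 : ‖toL2 volume (lineOp (fun x => min (P x) n) f) + toL2 volume f‖ ≤ A := by
    have e1 : toL2 volume (lineOp (fun x => min (P x) n) f) + toL2 volume f =
        toL2 volume (fun x => lineOp (fun x => min (P x) n) f x + f x - h x) + toL2 volume h := by
      rw [← toL2_add (hf.memLp_lineOp hW) hf.memLp, ← toL2_add hr hh.memLp]
      simp only [sub_add_cancel]
    rw [e1]
    refine (norm_add_le _ _).trans ?_
    have := hfε.trans (min_le_left _ _)
    linarith
  obtain ⟨h2, h3⟩ := norm_le_of_norm_lineOp_add_le hW hW0 hf h1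
  refine ⟨f, hf, h2, fun j => (h3 j).trans (le_mul_of_one_le_right hA0.le hR), ?_⟩
  · have hT : MemLp (fun x => B.indicator (fun x => ((P x - min (P x) n : ℝ) : ℂ)) x * f x) 2
        volume := by
      refine MemLp.of_le_mul (c := K + 1) hn (hn.1.mul hf.continuous.aestronglyMeasurable)
        (ae_of_all _ fun x => ?_)
      rw [norm_mul, mul_comm]
      gcongr
      exact hfK x
    have e2 : (Set.indicator (Metric.ball 0 (2 * R)) fun x => lineOp P f x + 1 * f x - h x) =
        Set.indicator (Metric.ball 0 (2 * R)) fun x =>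
          (lineOp (fun x => min (P x) n) f x + f x - h x) +
            B.indicator (fun x => ((P x - min (P x) n : ℝ) : ℂ)) x * f x := by
      funext x
      by_cases hx : x ∈ Metric.ball (0 : EuclideanSpace ℝ (Fin d)) (2 * R)
      · rw [Set.indicator_of_mem hx, Set.indicator_of_mem hx,
          Set.indicator_of_mem (Metric.ball_subset_closedBall hx), lineOp, lineOp]
        push_cast
        ring
      · rw [Set.indicator_of_notMem hx, Set.indicator_of_notMem hx]
    rw [e2]
    refine (norm_toL2_le_of_le ((hr.add hT).1.indicator measurableSet_ball) (hr.add hT)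
      (ae_of_all _ fun x => norm_indicator_le_norm_self _ _)).trans ?_
    refine (congrArg norm (toL2_add hr hT)).le.trans ((norm_add_le _ _).trans ?_)
    have h8 : ‖toL2 volume fun x => B.indicator (fun x => ((P x - min (P x) n : ℝ) : ℂ)) x * f x‖ ≤
        (K + 1) * ‖toL2 volume (B.indicator fun x => ((P x - min (P x) n : ℝ) : ℂ))‖ := by
      refine norm_toL2_le hT.1 hn _ (ae_of_all _ fun x => ?_)
      rw [norm_mul, mul_comm]
      gcongr
      exact hfK x
    have h9 : (K + 1) * ‖toL2 volume (B.indicator fun x => ((P x - min (P x) n : ℝ) : ℂ))‖ ≤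
        ε / 2 := by
      rw [lt_div_iff₀ (by positivity)] at hnε
      linarith
    have h10 := hfε.trans (min_le_right _ _)
    linarith

/-- Add the constant `c` to the potential and subtract it from `z`; the imaginary part of `z` is
unaffected. -/
theorem dense_range_lineGraph_of_bddBelow (hP : LocL2 P) {c : ℝ} (hc : ∀ᵐ x, -c ≤ P x) {z : ℂ}
    (hz : z.im ≠ 0) : Dense {w | ∃ p ∈ lineGraph P, p.2 + z • p.1 = w} := by
  have hQ : LocL2 fun x => P x + c := hP.add (Continuous.locL2 continuous_const)
  have hQ0 : ∀ᵐ x, 0 ≤ P x + c := by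
    filter_upwards [hc] with x hx
    linarith
  have h := (isSymmetricGraph_lineGraph hQ).dense_range_of_nonneg (z := z - c) (fun p hp => by
    obtain ⟨f, hf, h1, h2⟩ := exists_eq_of_mem_lineGraph hp
    have h3 := sum_norm_sq_le_inner_lineOp hQ hf (c := 0) (by simpa using hQ0)
    have h4 : 0 ≤ ∑ j, ‖toL2 volume (partialDeriv j f)‖ ^ 2 := by positivity
    rw [← inner_conj_symm, Complex.conj_re, h1, h2]
    linarith) (dense_range_lineGraph_of_nonneg hQ hQ0) (by simpa using hz)
  rw [setOf_range_lineGraph hQ] at h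
  rw [setOf_range_lineGraph hP]
  refine h.mono ?_
  rintro _ ⟨f, hf, rfl⟩
  refine ⟨f, hf, congrArg _ (funext fun x => ?_)⟩
  rw [lineOp, lineOp]
  push_cast
  ring

/-- On the ball of radius `2R` one has `P ≥ -c` with `c = 4aR² + b`, so replacing `P` by `max P
(-c)` changes nothing there and makes the potential bounded below. The energy estimate then bounds
the squared gradient by a multiple of `c`, hence of `R²`: the linear growth allowed by the local
criterion. -/
theorem dense_range_lineGraph (hP : AdmissiblePotential P) {z : ℂ} (hz : z.im ≠ 0) :
    Dense {w | ∃ p ∈ lineGraph P, p.2 + z • p.1 = w} := by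
  obtain ⟨hL, a, b, ha, hb, hab⟩ := hP
  have hPL : LocL2 P := hL
  refine dense_range_of_local_solutions hPL z fun h hh => ?_
  have hz0 : 0 < |z.im| := abs_pos.2 hz
  set A : ℝ := ‖toL2 volume h‖ + 1 with hA
  have hA0 : 0 < A := by positivity
  -- Bound on the solution, from the imaginary part of the equation tested against it; `B` below
  -- bounds its squared gradient divided by `R²`, from the real part.
  set N : ℝ := A / |z.im| with hN
  have hN0 : 0 < N := by positivity
  set B : ℝ := N * A + (‖z‖ + (4 * a + b)) * N ^ 2 with hB
  have hB0 : 0 ≤ B := by positivity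
  refine ⟨N + Real.sqrt B, by positivity, fun R hR ε hε => ?_⟩
  set c : ℝ := 4 * a * R ^ 2 + b with hc
  have hR2 : 1 ≤ R ^ 2 := one_le_pow₀ hR
  have hc0 : 0 ≤ c := by positivity
  have hcR : c ≤ (4 * a + b) * R ^ 2 := by
    rw [hc]
    nlinarith
  have hQ : LocL2 fun x => max (P x) (-c) := hPL.max_const (-c)
  have hQc : ∀ᵐ x, -c ≤ max (P x) (-c) := ae_of_all _ fun x => le_max_right _ _
  have hd := dense_range_lineGraph_of_bddBelow hQ hQc hz
  rw [setOf_range_lineGraph hQ] at hd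
  obtain ⟨_, ⟨f, hf, rfl⟩, hfd⟩ := Metric.mem_closure_iff.1 (hd (toL2 volume h)) (min 1 ε)
    (by positivity)
  have hg : MemLp (fun x => lineOp (fun x => max (P x) (-c)) f x + z * f x) 2 volume :=
    (hf.memLp_lineOp hQ).add (hf.const_mul z).memLp
  rw [dist_comm, dist_eq_norm, ← toL2_sub hg hh.memLp] at hfd
  have e1 : toL2 volume (fun x => lineOp (fun x => max (P x) (-c)) f x + z * f x) =
      toL2 volume (lineOp (fun x => max (P x) (-c)) f) + z • toL2 volume f := by
    rw [← toL2_smul z hf.memLp]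
    exact toL2_add (hf.memLp_lineOp hQ) (hf.const_mul z).memLp
  have h1 : ‖toL2 volume (lineOp (fun x => max (P x) (-c)) f) + z • toL2 volume f‖ ≤ A := by
    rw [← e1]
    have h2 := norm_sub_norm_le
      (toL2 volume fun x => lineOp (fun x => max (P x) (-c)) f x + z * f x) (toL2 volume h)
    rw [← toL2_sub hg hh.memLp] at h2
    have := hfd.le.trans (min_le_left _ _)
    linarith
  have h2 : ‖inner ℂ (toL2 volume f)
      (toL2 volume (lineOp (fun x => max (P x) (-c)) f) + z • toL2 volume f)‖ ≤
        ‖toL2 volume f‖ * A := (norm_inner_le_norm _ _).trans (by gcongr)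
  have h3 : inner ℂ (toL2 volume f) (toL2 volume f) = ((‖toL2 volume f‖ ^ 2 : ℝ) : ℂ) := by
    rw [inner_self_eq_norm_sq_to_K]
    push_cast
    rfl
  rw [inner_add_right, inner_smul_right, h3] at h2
  have h4 : (inner ℂ (toL2 volume f) (toL2 volume (lineOp (fun x => max (P x) (-c)) f))).im = 0 := by
    have := (isSymmetricGraph_lineGraph hQ).im_inner_eq_zero (mk_mem_lineGraph hQ hf)
    rw [← inner_conj_symm, Complex.conj_im, this, neg_zero]
  have h5 : ‖toL2 volume f‖ ≤ N := by
    have h6 := (Complex.abs_im_le_norm _).trans h2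
    rw [Complex.add_im, h4, zero_add, Complex.im_mul_ofReal, abs_mul,
      abs_of_nonneg (sq_nonneg ‖toL2 volume f‖)] at h6
    rw [hN, le_div_iff₀ hz0]
    rcases eq_or_lt_of_le (norm_nonneg (toL2 volume f)) with h0 | h0
    · rw [← h0, zero_mul]
      exact hA0.le
    · refine le_of_mul_le_mul_left ?_ h0
      linarith
  have h6 := sum_norm_sq_le_inner_lineOp hQ hf hQc
  have h7 := (Complex.re_le_norm _).trans h2
  rw [Complex.add_re, Complex.re_mul_ofReal] at h7
  have h8 : -z.re * ‖toL2 volume f‖ ^ 2 ≤ ‖z‖ * N ^ 2 := by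
    have : -z.re ≤ ‖z‖ := (neg_le_abs _).trans (Complex.abs_re_le_norm z)
    gcongr
  have h9 : c * ‖toL2 volume f‖ ^ 2 ≤ (4 * a + b) * R ^ 2 * N ^ 2 := by gcongr
  have h10 : ‖toL2 volume f‖ * A ≤ N * A := by gcongr
  have h11 : N * A + ‖z‖ * N ^ 2 ≤ (N * A + ‖z‖ * N ^ 2) * R ^ 2 :=
    le_mul_of_one_le_right (by positivity) hR2
  have h12 : ∑ j, ‖toL2 volume (partialDeriv j f)‖ ^ 2 ≤ B * R ^ 2 := by
    rw [hB]
    linarith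
  refine ⟨f, hf, h5.trans (le_add_of_nonneg_right (Real.sqrt_nonneg _)), fun j => ?_, ?_⟩
  · have h13 := (Finset.single_le_sum (f := fun j => ‖toL2 volume (partialDeriv j f)‖ ^ 2)
      (fun i _ => by positivity) (Finset.mem_univ j)).trans h12
    have h14 : ‖toL2 volume (partialDeriv j f)‖ ≤ Real.sqrt B * R := by
      refine le_of_sq_le_sq ?_ (by positivity)
      rw [mul_pow, Real.sq_sqrt hB0]
      exact h13
    refine h14.trans ?_
    gcongr
    linarith
  · refine (norm_toL2_le_of_le ?_ (hg.sub hh.memLp) ?_).trans (hfd.le.trans (min_le_right _ _))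
    · exact (((hf.memLp_lineOp hPL).add (hf.const_mul z).memLp).sub
        hh.memLp).1.indicator measurableSet_ball
    · filter_upwards [hab] with x hx
      by_cases hxB : x ∈ Metric.ball (0 : EuclideanSpace ℝ (Fin d)) (2 * R)
      · rw [Set.indicator_of_mem hxB]
        have hxn : ‖x‖ ^ 2 ≤ (2 * R) ^ 2 := by
          have := mem_ball_zero_iff.1 hxB
          gcongr
        have hmax : max (P x) (-c) = P x := by
          refine max_eq_left ?_
          rw [hc]
          nlinarith
        simp only [lineOp, hmax, Pi.sub_apply]
        exact le_rfl
      · rw [Set.indicator_of_notMem hxB, norm_zero]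
        exact norm_nonneg _

theorem exists_isPropagator_lineGraph (hP : AdmissiblePotential P) :
    ∃ U, IsPropagator (lineGraph P : Set (Lp ℂ 2 (volume : Measure (EuclideanSpace ℝ (Fin d))) ×
      Lp ℂ 2 (volume : Measure (EuclideanSpace ℝ (Fin d))))) U := by
  refine exists_isPropagator (isSymmetricGraph_lineGraph hP.1) (dense_domain_lineGraph hP.1) 1
    fun l hl => dense_range_lineGraph hP ?_
  have : 0 < |l| := by linarith
  simpa using abs_pos.1 this

/-- The class of potentials is stable under the controls: the gaussian is bounded, and `‖x‖ ≤ ‖x‖² +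
1` absorbs the linear terms in the quadratic lower bound. -/
theorem AdmissiblePotential.linePotential {V : EuclideanSpace ℝ (Fin d) → ℝ}
    (hV : AdmissiblePotential V) (u : Fin (d + 1) → ℝ) :
    AdmissiblePotential (linePotential V u) := by
  obtain ⟨hL, a, b, ha, hb, hab⟩ := hV
  have hVL : LocL2 V := hL
  have hc1 : Continuous fun x : EuclideanSpace ℝ (Fin d) => ∑ j : Fin d, u j.castSucc * x j := by
    fun_prop
  have hc2 : Continuous fun x : EuclideanSpace ℝ (Fin d) =>
      u (Fin.last d) * Real.exp (-‖x‖ ^ 2 / 2) := by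
    fun_prop
  refine ⟨(hVL.add (Continuous.locL2 hc1)).add (Continuous.locL2 hc2),
    a + ∑ j : Fin d, |u j.castSucc|, b + ∑ j : Fin d, |u j.castSucc| + |u (Fin.last d)|,
    by positivity, by positivity, ?_⟩
  filter_upwards [hab] with x hx
  have h1 : |∑ j : Fin d, u j.castSucc * x j| ≤ (∑ j : Fin d, |u j.castSucc|) * ‖x‖ := by
    rw [Finset.sum_mul]
    refine (Finset.abs_sum_le_sum_abs _ _).trans (Finset.sum_le_sum fun j _ => ?_)
    rw [abs_mul]
    gcongr
    exact PiLp.norm_apply_le x j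
  have h2 : |u (Fin.last d) * Real.exp (-‖x‖ ^ 2 / 2)| ≤ |u (Fin.last d)| := by
    rw [abs_mul, abs_of_pos (Real.exp_pos _)]
    refine mul_le_of_le_one_right (abs_nonneg _) (Real.exp_le_one_iff.2 ?_)
    have := sq_nonneg ‖x‖
    linarith
  have h3 : ‖x‖ ≤ ‖x‖ ^ 2 + 1 := by nlinarith [sq_nonneg (‖x‖ - 1)]
  have h4 : 0 ≤ ∑ j : Fin d, |u j.castSucc| := by positivity
  have h5 := mul_le_mul_of_nonneg_left h3 h4
  have h6 := neg_le_of_abs_le h1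
  have h7 := neg_le_of_abs_le h2
  rw [SchrodingerControl.linePotential]
  linarith

theorem exists_isPropagator_lineSystem {V : EuclideanSpace ℝ (Fin d) → ℝ}
    (hV : AdmissiblePotential V) (u : Fin (d + 1) → ℝ) :
    ∃ U, IsPropagator (lineSystem V u) U :=
  exists_isPropagator_lineGraph (hV.linePotential u)

end SelfAdjoint

/-! ### Reachable operators on the Euclidean space -/

section LineReach

variable {d : ℕ} {V : EuclideanSpace ℝ (Fin d) → ℝ}

theorem PhaseReach.of_testFun {ι : Type*}
    {G : (ι → ℝ) → Set (Lp ℂ 2 (volume : Measure (EuclideanSpace ℝ (Fin d))) ×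
      Lp ℂ 2 (volume : Measure (EuclideanSpace ℝ (Fin d))))}
    {φ : EuclideanSpace ℝ (Fin d) → ℝ} (hφ : AEStronglyMeasurable φ volume)
    (h : ∀ f, IsTestFun f → ApproxReach G 0 (toL2 volume f)
      (toL2 volume fun p => expI φ p * f p)) : PhaseReach G φ := by
  refine ApproxReach.of_dense dense_testFun (phaseIsometry hφ) ?_
  rintro _ ⟨f, hf, rfl⟩
  rw [phaseIsometry_toL2 hφ hf.memLp]
  exact h f hf

theorem contDiff_expI {φ : EuclideanSpace ℝ (Fin d) → ℝ} (hφ : ContDiff ℝ ∞ φ) :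
    ContDiff ℝ ∞ (expI φ) :=
  (contDiff_const.mul (Complex.ofRealCLM.contDiff.comp hφ)).cexp

/-- The conjugation of `-Δ + P` by a phase. -/
theorem lineOp_expI_mul {P φ : EuclideanSpace ℝ (Fin d) → ℝ}
    {f : EuclideanSpace ℝ (Fin d) → ℂ} (hφ : ContDiff ℝ ∞ φ) (hf : ContDiff ℝ ∞ f)
    (x : EuclideanSpace ℝ (Fin d)) :
    lineOp P (fun x => expI φ x * f x) x = expI φ x * (lineOp P f x -
      2 * Complex.I * lineGrad (fun x => (φ x : ℂ)) f x -
        Complex.I * lineLaplacian (fun x => (φ x : ℂ)) x * f x +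
          lineGrad (fun x => (φ x : ℂ)) (fun x => (φ x : ℂ)) x * f x) := by
  rw [lineOp, lineOp]
  have h := lineLaplacian_exp_mul (φ := fun x => (φ x : ℂ)) (Complex.ofRealCLM.contDiff.comp hφ) hf x
  rw [show (fun x => expI φ x * f x) = fun x => Complex.exp (Complex.I * (φ x : ℂ)) * f x from rfl,
    h, expI]
  ring

/-- The phases of controlled potentials are reachable. -/
theorem phaseReach_of_linePotential (hV : AdmissiblePotential V)
    {w : EuclideanSpace ℝ (Fin d) → ℝ} (hw : ContDiff ℝ ∞ w)
    (hu : ∀ r : ℝ, ∃ u, ∀ x, linePotential V u x = V x + r * w x) :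
    PhaseReach (lineSystem V) fun x => -w x := by
  have hVL : LocL2 V := hV.1
  have hwm : AEStronglyMeasurable w volume := hw.continuous.aestronglyMeasurable
  refine PhaseReach.of_testFun hwm.neg fun f hf => ApproxReach.of_forall fun ε hε => ?_
  set W : EuclideanSpace ℝ (Fin d) → ℂ := fun x => (w x : ℂ) with hW
  have hWs : ContDiff ℝ ∞ W := Complex.ofRealCLM.contDiff.comp hw
  have h0 := hf.memLp_lineOp hVL
  have h1 : IsTestFun fun x => 2 * Complex.I * lineGrad W f x +
      Complex.I * lineLaplacian W x * f x :=
    ((IsTestFun.lineGrad hWs hf).const_mul (2 * Complex.I)).add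
      (IsTestFun.mul_left (contDiff_const.mul (contDiff_lineLaplacian hWs)) hf)
  have h2 : IsTestFun fun x => lineGrad W W x * f x :=
    IsTestFun.mul_left (contDiff_lineGrad hWs hWs) hf
  set Q : ℝ := ‖toL2 volume (lineOp V f)‖ + ‖toL2 volume fun x =>
    2 * Complex.I * lineGrad W f x + Complex.I * lineLaplacian W x * f x‖ +
      ‖toL2 volume fun x => lineGrad W W x * f x‖ with hQ
  have hQ0 : 0 ≤ Q := by positivity
  -- The conjugate of `-Δ + V` by `e^{-isw}`, applied to `f`. It does not involve `τ`, so the error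
  -- is `τQ`.
  let q : ℝ → EuclideanSpace ℝ (Fin d) → ℂ := fun s x => lineOp V f x +
    (s : ℂ) * (2 * Complex.I * lineGrad W f x + Complex.I * lineLaplacian W x * f x) +
      (s : ℂ) ^ 2 * (lineGrad W W x * f x)
  have hq : ∀ s, MemLp (q s) 2 volume := fun s =>
    (h0.add (h1.const_mul s).memLp).add (h2.const_mul ((s : ℂ) ^ 2)).memLp
  have hqQ : ∀ s ∈ Set.Icc (0 : ℝ) 1, ‖toL2 volume (q s)‖ ≤ Q := by
    intro s hs
    have e : toL2 volume (q s) = toL2 volume (lineOp V f) + (s : ℂ) • toL2 volume (fun x =>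
        2 * Complex.I * lineGrad W f x + Complex.I * lineLaplacian W x * f x) +
          (s : ℂ) ^ 2 • toL2 volume (fun x => lineGrad W W x * f x) := by
      rw [← toL2_smul _ h1.memLp, ← toL2_smul _ h2.memLp, ← toL2_add h0 (h1.const_mul s).memLp]
      exact toL2_add (h0.add (h1.const_mul s).memLp) (h2.const_mul ((s : ℂ) ^ 2)).memLp
    rw [e]
    refine (norm_add_le _ _).trans (add_le_add ((norm_add_le _ _).trans
      (add_le_add le_rfl ?_)) ?_)
    · rw [norm_smul, Complex.norm_real, Real.norm_eq_abs, abs_of_nonneg hs.1]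
      exact mul_le_of_le_one_left (norm_nonneg _) hs.2
    · rw [norm_smul, norm_pow, Complex.norm_real, Real.norm_eq_abs, abs_of_nonneg hs.1]
      exact mul_le_of_le_one_left (norm_nonneg _) (pow_le_one₀ hs.1 hs.2)
  obtain ⟨C, hC⟩ := hf.hasCompactSupport.exists_bound_of_continuousOn hw.continuous.continuousOn
  set τ : ℝ := min ε (ε / (2 * (Q + 1))) with hτdef
  have hτ : 0 < τ := lt_min hε (by positivity)
  obtain ⟨u, hu⟩ := hu τ⁻¹
  obtain ⟨U, hU⟩ := exists_isPropagator_lineSystem hV u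
  have h := norm_phase_sub_propagator_le hU hτ (χ := fun _ => 0) aestronglyMeasurable_const hwm
    hf.memLp (C := C) (fun x hx => hC x (subset_tsupport f hx)) hq (fun s hs => subset_closure ?_)
    hqQ
  · have hτQ : τ * Q < ε := by
      have h1 : τ ≤ ε / (2 * (Q + 1)) := min_le_right _ _
      rw [le_div_iff₀ (by positivity)] at h1
      nlinarith
    refine ⟨τ, by rw [zero_add]; exact min_le_left _ _, U τ (toL2 volume f),
      hU.approxReach hτ _, ?_⟩
    rw [norm_sub_rev]
    have e1 : (fun x => expI (fun _ : EuclideanSpace ℝ (Fin d) => (0 : ℝ)) x * f x) = f := by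
      funext x
      simp [expI]
    rw [e1] at h
    simp only [zero_sub] at h
    exact h.trans_lt hτQ
  · have hs : ContDiff ℝ ∞ fun y => 0 - s * w y := contDiff_const.sub (contDiff_const.mul hw)
    have hsf : IsTestFun fun x => expI (fun y => 0 - s * w y) x * f x :=
      IsTestFun.mul_left (contDiff_expI hs) hf
    have hmem := mk_mem_lineGraph (hV.linePotential u).1 hsf
    rw [← coe_lineGraph, SetLike.mem_coe]
    convert hmem using 3
    funext x
    have eφ : (fun y => ((0 - s * w y : ℝ) : ℂ)) = fun y => (-s : ℂ) * W y := by
      funext y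
      rw [hW]
      push_cast
      ring
    have hD : ∀ j x, partialDeriv j (fun y => (-s : ℂ) * W y) x = (-s : ℂ) * partialDeriv j W x :=
      fun j x => partialDeriv_const_mul _ hWs j x
    have g1 : lineGrad (fun y => (-s : ℂ) * W y) f x = (-s : ℂ) * lineGrad W f x := by
      simp only [lineGrad, hD, Finset.mul_sum, mul_assoc]
    have g2 : lineGrad (fun y => (-s : ℂ) * W y) (fun y => (-s : ℂ) * W y) x =
        (s : ℂ) ^ 2 * lineGrad W W x := by
      simp only [lineGrad, hD, Finset.mul_sum]
      exact Finset.sum_congr rfl fun j _ => by ring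
    rw [lineOp_expI_mul hs hf.contDiff, eφ, g1, g2, lineLaplacian_const_mul _ hWs]
    simp only [q, lineOp, hu x, hW]
    push_cast
    ring

theorem phaseReach_coordinate (hV : AdmissiblePotential V) (j : Fin d) (c : ℝ) :
    PhaseReach (lineSystem V) fun x => c * x j := by
  have hw : ContDiff ℝ ∞ fun x : EuclideanSpace ℝ (Fin d) => -c * x j :=
    contDiff_const.mul (EuclideanSpace.proj (𝕜 := ℝ) j).contDiff
  have h := phaseReach_of_linePotential hV hw fun r => by
    refine ⟨Fin.snoc (Pi.single j (r * -c)) 0, fun x => ?_⟩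
    simp only [linePotential, Fin.snoc_castSucc, Fin.snoc_last, zero_mul, add_zero]
    rw [Finset.sum_eq_single j]
    · rw [Pi.single_eq_same, mul_assoc]
    · intro i _ hi
      rw [Pi.single_eq_of_ne hi, zero_mul]
    · simp
  simpa using h

theorem phaseReach_gaussian (hV : AdmissiblePotential V) (c : ℝ) :
    PhaseReach (lineSystem V) fun x => c * Real.exp (-‖x‖ ^ 2 / 2) := by
  have hw : ContDiff ℝ ∞ fun x : EuclideanSpace ℝ (Fin d) => -c * Real.exp (-‖x‖ ^ 2 / 2) :=
    contDiff_const.mul ((contDiff_norm_sq ℝ).neg.div_const 2).exp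
  have h := phaseReach_of_linePotential hV hw fun r => by
    refine ⟨Fin.snoc (fun _ => 0) (r * -c), fun x => ?_⟩
    simp only [linePotential, Fin.snoc_castSucc, Fin.snoc_last, zero_mul, Finset.sum_const_zero,
      add_zero]
    ring
  simpa using h

theorem hasDerivAt_of_norm_sub_le_sq {E : Type*} [NormedAddCommGroup E] [NormedSpace ℝ E]
    {F : ℝ → E} {F' : E} {K s : ℝ} (h : ∀ t, |t - s| ≤ 1 → ‖F t - F s - (t - s) • F'‖ ≤
      K * (t - s) ^ 2) : HasDerivAt F F' s := by
  rw [hasDerivAt_iff_isLittleO]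
  have h1 : (fun t => F t - F s - (t - s) • F') =O[𝓝 s] fun t => (t - s) ^ 2 := by
    refine Asymptotics.IsBigO.of_bound K ?_
    filter_upwards [Metric.closedBall_mem_nhds s one_pos] with t ht
    rw [Metric.mem_closedBall, Real.dist_eq] at ht
    rw [norm_pow, Real.norm_eq_abs, sq_abs]
    exact h t ht
  refine h1.trans_isLittleO ?_
  have h2 : (fun x : ℝ => x ^ 2) =o[𝓝 0] fun x => x := by
    simpa using Asymptotics.isLittleO_pow_id (𝕜 := ℝ) (n := 2) (by norm_num)
  have h3 : Tendsto (fun t => t - s) (𝓝 s) (𝓝 0) := by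
    have : Continuous fun t : ℝ => t - s := by fun_prop
    simpa using this.tendsto s
  exact h2.comp_tendsto h3

/-- Translations of a test function along a coordinate are differentiable in `L²`. -/
theorem hasDerivAt_toL2_translate {f : EuclideanSpace ℝ (Fin d) → ℂ} (hf : IsTestFun f)
    (j : Fin d) (s : ℝ) :
    HasDerivAt (fun t : ℝ => toL2 volume fun x => f (x + t • EuclideanSpace.single j (1 : ℝ)))
      (toL2 volume fun x => partialDeriv j f (x + s • EuclideanSpace.single j (1 : ℝ))) s := by
  obtain ⟨L, hL⟩ := (hf.partialDeriv j).contDiff.lipschitzWith_of_hasCompactSupport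
    (hf.partialDeriv j).hasCompactSupport (by simp)
  set e : EuclideanSpace ℝ (Fin d) := EuclideanSpace.single j (1 : ℝ) with he
  have he1 : ‖e‖ = 1 := by simp [he]
  obtain ⟨R₁, hR₁⟩ := hf.exists_radius
  obtain ⟨R₂, hR₂⟩ := (hf.partialDeriv j).exists_radius
  -- For `|t - s| ≤ 1` all the translates involved vanish outside the ball of radius `R`; there the
  -- pointwise quadratic error, from the Lipschitz bound on the derivative, is integrated over a
  -- fixed set of finite measure.
  set R : ℝ := max R₁ R₂ + |s| + 1 with hR
  set B : Set (EuclideanSpace ℝ (Fin d)) := Metric.closedBall 0 R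
  have hB : MemLp (B.indicator fun _ => (1 : ℂ)) 2
      (volume : Measure (EuclideanSpace ℝ (Fin d))) :=
    memLp_indicator_const 2 measurableSet_closedBall 1
      (Or.inr (isCompact_closedBall 0 R).measure_lt_top.ne)
  refine hasDerivAt_of_norm_sub_le_sq
    (K := L * ‖toL2 volume (B.indicator fun _ => (1 : ℂ))‖) fun t ht => ?_
  have hft := fun t : ℝ => (hf.comp_add (t • e)).memLp
  have hDs := ((hf.partialDeriv j).comp_add (s • e)).memLp
  have eq : toL2 volume (fun x => f (x + t • e) - f (x + s • e) -
      ((t - s : ℝ) : ℂ) * partialDeriv j f (x + s • e)) =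
        toL2 volume (fun x => f (x + t • e)) - toL2 volume (fun x => f (x + s • e)) -
          (t - s) • toL2 volume (fun x => partialDeriv j f (x + s • e)) := by
    have hs : ∀ v : Lp ℂ 2 (volume : Measure (EuclideanSpace ℝ (Fin d))),
        (t - s) • v = ((t - s : ℝ) : ℂ) • v := fun v => (Complex.coe_smul (t - s) v).symm
    rw [hs, ← toL2_smul _ hDs, ← toL2_sub (hft t) (hft s)]
    exact toL2_sub ((hft t).sub (hft s)) (hDs.const_mul _)
  rw [← eq, mul_right_comm]
  refine norm_toL2_le (((hft t).sub (hft s)).sub (hDs.const_mul _)).1 hB _ (ae_of_all _ fun x => ?_)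
  change ‖f (x + t • e) - f (x + s • e) -
    ((t - s : ℝ) : ℂ) * partialDeriv j f (x + s • e)‖ ≤ _
  by_cases hx : x ∈ B
  · rw [Set.indicator_of_mem hx, norm_one, mul_one]
    have hder : ∀ r ∈ Set.uIcc s t, HasDerivWithinAt
        (fun r : ℝ => f (x + r • e) - (r : ℂ) * partialDeriv j f (x + s • e))
        (partialDeriv j f (x + r • e) - 1 * partialDeriv j f (x + s • e)) (Set.uIcc s t) r :=
      fun r _ => ((hasDerivAt_line hf.contDiff j x r).sub
        ((hasDerivAt_id r).ofReal_comp.mul_const _)).hasDerivWithinAt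
    have hbd : ∀ r ∈ Set.uIcc s t,
        ‖partialDeriv j f (x + r • e) - 1 * partialDeriv j f (x + s • e)‖ ≤ L * |t - s| := by
      intro r hr
      rw [one_mul, ← dist_eq_norm]
      refine (hL.dist_le_mul _ _).trans ?_
      rw [dist_add_left, dist_eq_norm, ← sub_smul, norm_smul, he1, mul_one, Real.norm_eq_abs]
      exact mul_le_mul_of_nonneg_left (Set.abs_sub_left_of_mem_uIcc hr) L.coe_nonneg
    have h := (convex_uIcc s t).norm_image_sub_le_of_norm_hasDerivWithin_le hder hbd
      Set.left_mem_uIcc Set.right_mem_uIcc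
    refine le_trans (le_of_eq ?_) (h.trans (le_of_eq ?_))
    · congr 1
      push_cast
      ring
    · rw [Real.norm_eq_abs, mul_assoc, ← sq, sq_abs]
  · have hx' : R < ‖x‖ := by
      rw [← not_le]
      simpa [B] using hx
    have hfar : ∀ r : ℝ, |r| ≤ |s| + 1 → max R₁ R₂ ≤ ‖x + r • e‖ := by
      intro r hr
      have h1 := norm_sub_le (x + r • e) (r • e)
      rw [add_sub_cancel_right, norm_smul, he1, mul_one, Real.norm_eq_abs] at h1
      linarith
    have hs' := hfar s (by linarith)
    have ht' := hfar t (by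
      have := abs_sub_abs_le_abs_sub t s
      linarith)
    rw [hR₁ _ ((le_max_left _ _).trans hs'), hR₁ _ ((le_max_left _ _).trans ht'),
      hR₂ _ ((le_max_right _ _).trans hs'), Set.indicator_of_notMem hx]
    simp

theorem translation_toL2 {f : EuclideanSpace ℝ (Fin d) → ℂ} (hf : MemLp f 2 volume)
    (v : EuclideanSpace ℝ (Fin d)) :
    translation v (toL2 volume f) = toL2 volume fun x => f (x + v) := by
  refine (toL2_eq ?_).symm
  refine (Lp.coeFn_compMeasurePreserving _ (measurePreserving_add_right volume v)).trans ?_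
  exact (measurePreserving_add_right volume v).quasiMeasurePreserving.ae_eq_comp (coeFn_toL2 hf)

theorem translation_add (v w : EuclideanSpace ℝ (Fin d))
    (x : Lp ℂ 2 (volume : Measure (EuclideanSpace ℝ (Fin d)))) :
    translation (v + w) x = translation v (translation w x) := by
  have hm : ∀ w : EuclideanSpace ℝ (Fin d), MemLp (fun y => x (y + w)) 2 volume := fun w =>
    (Lp.memLp x).comp_measurePreserving (measurePreserving_add_right volume w)
  rw [← toL2_coeFn x, translation_toL2 (Lp.memLp x), translation_toL2 (Lp.memLp x),
    translation_toL2 (hm w)]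
  congr 1
  funext y
  rw [add_assoc]

/-- `V` is not invariant under translations, but for `‖v‖ ≤ r` only its values on one fixed ball
matter, and there it is square-integrable. -/
theorem exists_norm_lineOp_translate_le (hV : LocL2 V) {f : EuclideanSpace ℝ (Fin d) → ℂ}
    (hf : IsTestFun f) (r : ℝ) : ∃ C, 0 ≤ C ∧ ∀ v : EuclideanSpace ℝ (Fin d), ‖v‖ ≤ r →
      ‖toL2 volume (lineOp V fun x => f (x + v))‖ ≤ C := by
  obtain ⟨A, hA0, hA⟩ := hf.exists_norm_le
  obtain ⟨R, hR⟩ := hf.exists_radius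
  set B : Set (EuclideanSpace ℝ (Fin d)) := Metric.closedBall 0 (R + r)
  have hVB : MemLp (B.indicator fun x => ((V x : ℝ) : ℂ)) 2
      (volume : Measure (EuclideanSpace ℝ (Fin d))) :=
    (memLp_indicator_iff_restrict measurableSet_closedBall).2
      (hV B (isCompact_closedBall 0 (R + r))).ofReal
  refine ⟨‖toL2 volume (lineLaplacian f)‖ + A * ‖toL2 volume (B.indicator fun x => ((V x : ℝ) : ℂ))‖,
    by positivity, fun v hv => ?_⟩
  rw [(hf.comp_add v).toL2_lineOp hV]
  refine (norm_add_le _ _).trans (add_le_add (le_of_eq ?_) ?_)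
  · rw [norm_neg, show lineLaplacian (fun x => f (x + v)) = fun x => lineLaplacian f (x + v) from
      funext (lineLaplacian_comp_add hf.contDiff v), ← translation_toL2 hf.lineLaplacian.memLp,
      LinearIsometryEquiv.norm_map]
  · refine norm_toL2_le ((hf.comp_add v).memLp_mul hV).1 hVB A (ae_of_all _ fun x => ?_)
    by_cases hx : x ∈ B
    · rw [Set.indicator_of_mem hx, norm_mul, mul_comm]
      gcongr
      exact hA _
    · have hx' : R + r < ‖x‖ := by
        rw [← not_le]
        simpa [B] using hx
      have h1 := norm_sub_le (x + v) v
      rw [add_sub_cancel_right] at h1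
      rw [hR (x + v) (by linarith), mul_zero, norm_zero]
      positivity

theorem partialDeriv_coordinate (c : ℝ) (i j : Fin d) (x : EuclideanSpace ℝ (Fin d)) :
    partialDeriv i (fun x : EuclideanSpace ℝ (Fin d) => ((c * x j : ℝ) : ℂ)) x =
      if i = j then (c : ℂ) else 0 := by
  have h : HasFDerivAt (fun x : EuclideanSpace ℝ (Fin d) => ((c * x j : ℝ) : ℂ))
      (Complex.ofRealCLM.comp (c • EuclideanSpace.proj (𝕜 := ℝ) j)) x :=
    Complex.ofRealCLM.hasFDerivAt.comp x
      ((EuclideanSpace.proj (𝕜 := ℝ) j).hasFDerivAt.const_smul c)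
  rw [partialDeriv_eq h]
  by_cases hij : i = j
  · subst hij
    simp
  · simp [hij, Ne.symm hij]

/-- The conjugation of `-Δ + V` by a plane wave. -/
theorem lineOp_expI_coordinate_mul {f : EuclideanSpace ℝ (Fin d) → ℂ} (hf : ContDiff ℝ ∞ f)
    (c : ℝ) (j : Fin d) (x : EuclideanSpace ℝ (Fin d)) :
    lineOp V (fun x => expI (fun y => c * y j) x * f x) x = expI (fun y => c * y j) x *
      (lineOp V f x - 2 * Complex.I * c * partialDeriv j f x + (c : ℂ) ^ 2 * f x) := by
  have hφ : ContDiff ℝ ∞ fun x : EuclideanSpace ℝ (Fin d) => c * x j :=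
    contDiff_const.mul (EuclideanSpace.proj (𝕜 := ℝ) j).contDiff
  have hφ' : ContDiff ℝ ∞ fun x : EuclideanSpace ℝ (Fin d) => ((c * x j : ℝ) : ℂ) :=
    Complex.ofRealCLM.contDiff.comp hφ
  have h1 : lineLaplacian (fun x : EuclideanSpace ℝ (Fin d) => ((c * x j : ℝ) : ℂ)) x = 0 := by
    rw [lineLaplacian_eq hφ']
    refine Finset.sum_eq_zero fun i _ => ?_
    rw [funext (partialDeriv_coordinate c i j), partialDeriv_const]
  rw [lineOp_expI_mul hφ hf, h1]
  simp only [lineGrad, partialDeriv_coordinate, ite_mul, zero_mul, Finset.sum_ite_eq',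
    Finset.mem_univ, if_true]
  ring

end LineReach

/-! ### Translations as small-time limits. -/

section LineTranslation

variable {d : ℕ} {V : EuclideanSpace ℝ (Fin d) → ℝ}

theorem aestronglyMeasurable_coordinate (c : ℝ) (j : Fin d) :
    AEStronglyMeasurable (fun x : EuclideanSpace ℝ (Fin d) => c * x j) volume := by
  have : Continuous fun x : EuclideanSpace ℝ (Fin d) => c * x j := by fun_prop
  exact this.aestronglyMeasurable

/-- Conjugated by a plane wave of large frequency, the free evolution over a small time is close
to a translation. -/
theorem norm_translation_sub_propagator_le (hV : AdmissiblePotential V)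
    {f : EuclideanSpace ℝ (Fin d) → ℂ} (hf : IsTestFun f) (j : Fin d) (r : ℝ) :
    ∃ C, 0 ≤ C ∧ ∀ (τ : ℝ) U, 0 < τ → IsPropagator (lineSystem V 0) U →
      ‖Complex.exp (Complex.I * ((-(τ * (r / (2 * τ)) ^ 2) : ℝ) : ℂ)) •
          phaseIsometry (aestronglyMeasurable_coordinate (-(r / (2 * τ))) j)
            (translation (EuclideanSpace.single j r) (toL2 volume f)) -
        U τ (phaseIsometry (aestronglyMeasurable_coordinate (-(r / (2 * τ))) j)
          (toL2 volume f))‖ ≤ τ * C := by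
  have hVL : LocL2 V := hV.1
  obtain ⟨C, hC0, hC⟩ := exists_norm_lineOp_translate_le hVL hf |r|
  refine ⟨C, hC0, fun τ U hτ hU => ?_⟩
  have hτ' : (τ : ℂ) ≠ 0 := by exact_mod_cast hτ.ne'
  -- Conjugation by `e^{ic x_j}` adds `-2ic∂_j + c²` to `-Δ + V`. Over the time `τ` the first term
  -- translates by `-2τc = r`; the second one gives the global phase `e^{iα}` with `α = -τc²`. What
  -- remains is `τ` times `-Δ + V` on translates of `f`, which is bounded.
  set c : ℝ := -(r / (2 * τ)) with hc
  have hcr : (2 : ℂ) * τ * c = -r := by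
    rw [hc]
    push_cast
    field_simp
  set e : EuclideanSpace ℝ (Fin d) := EuclideanSpace.single j (1 : ℝ) with he
  have he1 : ‖e‖ = 1 := by simp [he]
  set Φ := phaseIsometry (aestronglyMeasurable_coordinate c j) with hΦ
  set α : ℝ := -(τ * c ^ 2) with hα
  let F : ℝ → EuclideanSpace ℝ (Fin d) → ℂ := fun s x => f (x + (s * r) • e)
  have hF : ∀ s, IsTestFun (F s) := fun s => hf.comp_add _
  have hDF : ∀ s, IsTestFun (partialDeriv j (F s)) := fun s => (hF s).partialDeriv j
  have hLF : ∀ s, MemLp (lineOp V (F s)) 2 volume := fun s => (hF s).memLp_lineOp hVL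
  let G : ℝ → Lp ℂ 2 (volume : Measure (EuclideanSpace ℝ (Fin d))) := fun s =>
    Complex.exp (Complex.I * ((s * α : ℝ) : ℂ)) • Φ (toL2 volume (F s))
  let Y : ℝ → Lp ℂ 2 (volume : Measure (EuclideanSpace ℝ (Fin d))) := fun s =>
    Complex.exp (Complex.I * ((s * α : ℝ) : ℂ)) • Φ (toL2 volume (lineOp V (F s)) -
      (2 * Complex.I * c) • toL2 volume (partialDeriv j (F s)) + ((c : ℂ) ^ 2) • toL2 volume (F s))
  let G' : ℝ → Lp ℂ 2 (volume : Measure (EuclideanSpace ℝ (Fin d))) := fun s =>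
    Complex.exp (Complex.I * ((s * α : ℝ) : ℂ)) • Φ ((r : ℂ) • toL2 volume (partialDeriv j (F s)) +
      (Complex.I * α) • toL2 volume (F s))
  have hG : ∀ s, HasDerivAt G (G' s) s := by
    intro s
    have h1 : HasDerivAt (fun s : ℝ => toL2 volume (F s))
        ((r : ℂ) • toL2 volume (partialDeriv j (F s))) s := by
      have h2 := (hasDerivAt_toL2_translate hf j (s * r)).scomp s (hasDerivAt_mul_const r)
      have e1 : partialDeriv j (F s) = fun x => partialDeriv j f (x + (s * r) • e) :=
        funext fun x => partialDeriv_comp_add j _ x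
      rw [e1]
      have e2 : ∀ v : Lp ℂ 2 (volume : Measure (EuclideanSpace ℝ (Fin d))),
          (r : ℂ) • v = r • v := fun v => Complex.coe_smul r v
      rw [e2]
      exact h2
    have h3 : HasDerivAt (fun s : ℝ => Φ (toL2 volume (F s)))
        (Φ ((r : ℂ) • toL2 volume (partialDeriv j (F s)))) s :=
      (Φ.toContinuousLinearMap.restrictScalars ℝ).hasFDerivAt.comp_hasDerivAt s h1
    have h4 : HasDerivAt (fun s : ℝ => Complex.exp (Complex.I * ((s * α : ℝ) : ℂ)))
        (Complex.exp (Complex.I * ((s * α : ℝ) : ℂ)) * (Complex.I * α)) s := by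
      have := ((hasDerivAt_mul_const (x := s) α).ofReal_comp.const_mul Complex.I).cexp
      exact this
    refine (h4.smul h3).congr_deriv ?_
    simp only [G', map_add, map_smul, smul_add, smul_smul]
  have hY : ∀ s, (G s, Y s) ∈ closure (lineSystem V 0) := by
    intro s
    refine subset_closure ?_
    rw [← coe_lineGraph, SetLike.mem_coe]
    have hV0 : linePotential V 0 = V := by
      funext x
      simp [linePotential]
    rw [hV0]
    have hw : ContDiff ℝ ∞ fun x : EuclideanSpace ℝ (Fin d) => c * x j :=
      contDiff_const.mul (EuclideanSpace.proj (𝕜 := ℝ) j).contDiff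
    have hm := mk_mem_lineGraph hVL (IsTestFun.mul_left (contDiff_expI hw) (hF s))
    have h1 : toL2 volume (lineOp V (F s)) - (2 * Complex.I * c) •
        toL2 volume (partialDeriv j (F s)) + ((c : ℂ) ^ 2) • toL2 volume (F s) =
          toL2 volume (fun x => lineOp V (F s) x - 2 * Complex.I * c * partialDeriv j (F s) x +
            (c : ℂ) ^ 2 * F s x) := by
      rw [← toL2_smul _ (hDF s).memLp, ← toL2_smul _ (hF s).memLp,
        ← toL2_sub (hLF s) ((hDF s).const_mul _).memLp]
      exact (toL2_add ((hLF s).sub ((hDF s).const_mul _).memLp) ((hF s).const_mul _).memLp).symm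
    have h2 : MemLp (fun x => lineOp V (F s) x - 2 * Complex.I * c * partialDeriv j (F s) x +
            (c : ℂ) ^ 2 * F s x) 2 volume :=
      ((hLF s).sub ((hDF s).const_mul _).memLp).add ((hF s).const_mul _).memLp
    have h3 := (lineGraph V).smul_mem (Complex.exp (Complex.I * ((s * α : ℝ) : ℂ))) hm
    convert h3 using 1
    refine Prod.ext ?_ ?_
    · simp only [G, Prod.smul_fst]
      rw [hΦ, phaseIsometry_toL2 _ (hF s).memLp]
    · simp only [Y, Prod.smul_snd]
      rw [h1, hΦ, phaseIsometry_toL2 _ h2]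
      congr 2
      funext x
      rw [lineOp_expI_coordinate_mul (hF s).contDiff]
  have h := hU.norm_sub_le (τ := τ) (C := τ * C) (fun s _ => hG s) (fun s _ => hY s)
    fun s hs => by
      have e1 : G' s + (τ : ℂ) • Complex.I • Y s = Complex.exp (Complex.I * ((s * α : ℝ) : ℂ)) •
          Φ ((τ * Complex.I) • toL2 volume (lineOp V (F s))) := by
        simp only [G', Y]
        rw [smul_comm Complex.I (Complex.exp _), smul_comm (τ : ℂ) (Complex.exp _), ← smul_add,
          ← map_smul, ← map_smul, ← map_add]
        congr 2
        simp only [smul_add, smul_sub, smul_smul]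
        have e2 : (τ : ℂ) * (Complex.I * (2 * Complex.I * c)) = r := by
          linear_combination (2 * τ * c : ℂ) * Complex.I_mul_I - hcr
        have e3 : (τ : ℂ) * (Complex.I * (c : ℂ) ^ 2) = -(Complex.I * α) := by
          rw [hα]
          push_cast
          ring
        rw [e2, e3, neg_smul]
        abel
      rw [e1, norm_exp_I_smul, LinearIsometry.norm_map, norm_smul, norm_mul, Complex.norm_real,
        Complex.norm_I, mul_one, Real.norm_eq_abs, abs_of_pos hτ]
      refine mul_le_mul_of_nonneg_left (hC _ ?_) hτ.le
      rw [norm_smul, he1, mul_one, Real.norm_eq_abs, abs_mul, abs_of_nonneg hs.1]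
      exact mul_le_of_le_one_left (abs_nonneg _) hs.2
  have hG0 : G 0 = Φ (toL2 volume f) := by
    simp [G, F]
  have hG1 : G 1 = Complex.exp (Complex.I * (α : ℂ)) •
      Φ (translation (EuclideanSpace.single j r) (toL2 volume f)) := by
    simp only [G, F, one_mul]
    rw [translation_toL2 hf.memLp]
    have : r • e = EuclideanSpace.single j r := by
      ext i
      by_cases hi : i = j
      · subst hi
        simp [he]
      · simp [he, hi]
    rw [this]
  rw [hG0, hG1] at h
  have hα' : α = -(τ * (r / (2 * τ)) ^ 2) := by
    rw [hα, hc]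
    ring
  rw [← hα']
  exact h

/-- Translations along the coordinates are reachable. -/
theorem approxReach_translation_single (hV : AdmissiblePotential V) (j : Fin d) (r : ℝ)
    (x : Lp ℂ 2 (volume : Measure (EuclideanSpace ℝ (Fin d)))) :
    ApproxReach (lineSystem V) 0 x (translation (EuclideanSpace.single j r) x) := by
  refine ApproxReach.of_dense dense_testFun
    (translation (EuclideanSpace.single j r)).toLinearIsometry ?_ x
  rintro _ ⟨f, hf, rfl⟩
  rw [LinearIsometryEquiv.coe_toLinearIsometry]
  refine ApproxReach.of_forall fun ε hε => ?_
  obtain ⟨C, hC0, hC⟩ := norm_translation_sub_propagator_le hV hf j r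
  set τ : ℝ := min ε (ε / (2 * (C + 1))) with hτdef
  have hτ : 0 < τ := lt_min hε (by positivity)
  have hτC : τ * C < ε := by
    have h1 : τ ≤ ε / (2 * (C + 1)) := min_le_right _ _
    rw [le_div_iff₀ (by positivity)] at h1
    nlinarith
  obtain ⟨U, hU⟩ := exists_isPropagator_lineSystem hV 0
  have h := hC τ U hτ hU
  set c : ℝ := -(r / (2 * τ)) with hc
  set α : ℝ := -(τ * (r / (2 * τ)) ^ 2) with hα
  set y := toL2 volume f with hy
  set z := translation (EuclideanSpace.single j r) y with hz
  have s1 : ApproxReach (lineSystem V) 0 y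
      (phaseIsometry (aestronglyMeasurable_coordinate c j) y) := phaseReach_coordinate hV j c y
  have s2 := s1.trans (hU.approxReach hτ _)
  have s3 := s2.trans (phaseReach_coordinate hV j (-c) _)
  -- The phase `α = -r²/(4τ)` is unbounded as `τ → 0`, so reachability only up to a global phase is
  -- essential here.
  have s4 := s3.exp_smul (-α)
  refine ⟨_, ?_, _, s4, ?_⟩
  · simp only [add_zero, zero_add]
    exact min_le_left _ _
  · rw [← phaseIsometry_apply (aestronglyMeasurable_coordinate (-c) j)]
    have e1 : phaseIsometry (aestronglyMeasurable_coordinate (-c) j)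
        (phaseIsometry (aestronglyMeasurable_coordinate c j) z) = z := by
      rw [phaseIsometry_phaseIsometry, phaseIsometry_apply]
      refine toL2_eq (ae_of_all _ fun p => ?_)
      simp [expI]
    have e2 : z = Complex.exp (Complex.I * ((-α : ℝ) : ℂ)) •
        phaseIsometry (aestronglyMeasurable_coordinate (-c) j)
          (Complex.exp (Complex.I * (α : ℂ)) •
            phaseIsometry (aestronglyMeasurable_coordinate c j) z) := by
      rw [map_smul, e1, smul_smul, ← Complex.exp_add]
      simp
    conv_lhs => rw [e2]
    rw [← smul_sub, norm_exp_I_smul, ← map_sub, LinearIsometry.norm_map, norm_sub_rev]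
    exact h.trans_lt hτC

theorem isSTAR_line_translation (hV : AdmissiblePotential V) (j : Fin d) (r : ℝ) :
    IsSTAR (lineSystem V) (translation (EuclideanSpace.single j r)) :=
  isSTAR_of_approxReach (approxReach_translation_single hV j r)

theorem translation_zero (x : Lp ℂ 2 (volume : Measure (EuclideanSpace ℝ (Fin d)))) :
    translation 0 x = x := by
  rw [← toL2_coeFn x, translation_toL2 (Lp.memLp x)]
  simp

theorem approxReach_translation (hV : AdmissiblePotential V) (v : EuclideanSpace ℝ (Fin d))
    (x : Lp ℂ 2 (volume : Measure (EuclideanSpace ℝ (Fin d)))) :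
    ApproxReach (lineSystem V) 0 x (translation v x) := by
  have key : ∀ s : Finset (Fin d), ApproxReach (lineSystem V) 0 x
      (translation (∑ j ∈ s, EuclideanSpace.single j (v j)) x) := by
    intro s
    induction s using Finset.induction_on with
    | empty =>
      rw [Finset.sum_empty, translation_zero]
      exact ApproxReach.refl x
    | insert j s hj ih =>
      rw [Finset.sum_insert hj, translation_add]
      have := ih.trans (approxReach_translation_single hV j (v j) _)
      rwa [add_zero] at this
  have h := key Finset.univ
  have e : ∑ j, EuclideanSpace.single j (v j) = v := by
    ext i
    simp
  rwa [e] at h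

/-- The reachable phases are stable under translations. -/
theorem PhaseReach.comp_add (hV : AdmissiblePotential V) {φ : EuclideanSpace ℝ (Fin d) → ℝ}
    (hφ : Continuous φ) (h : PhaseReach (lineSystem V) φ) (v : EuclideanSpace ℝ (Fin d)) :
    PhaseReach (lineSystem V) fun x => φ (x + v) := by
  intro x
  have h1 := ((approxReach_translation hV (-v) x).trans (h _)).trans
    (approxReach_translation hV v _)
  simp only [add_zero] at h1
  have e : translation v (toL2 volume fun p => expI φ p * translation (-v) x p) =
      toL2 volume fun p => expI (fun x => φ (x + v)) p * x p := by
    have h2 : translation (-v) x = toL2 volume fun p => x (p + -v) := by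
      conv_lhs => rw [← toL2_coeFn x]
      exact translation_toL2 (Lp.memLp x) _
    have hm : MemLp (fun p => x (p + -v)) 2 volume :=
      (Lp.memLp x).comp_measurePreserving (measurePreserving_add_right volume (-v))
    have hφm : AEStronglyMeasurable φ (volume : Measure (EuclideanSpace ℝ (Fin d))) :=
      hφ.aestronglyMeasurable
    rw [h2, ← phaseIsometry_apply hφm, phaseIsometry_toL2 hφm hm,
      translation_toL2 (memLp_expI_mul hφm hm)]
    congr 1
    funext p
    simp [expI]
  rwa [e] at h1

end LineTranslation

/-! ### All phases, from the translates of the gaussian. -/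

section LinePhase

variable {d : ℕ} {V : EuclideanSpace ℝ (Fin d) → ℝ}

/-- `c e^{-|x|²/2} e^{⟨v, x⟩}` is a multiple of a translated gaussian. -/
theorem phaseReach_gaussian_mul_exp (hV : AdmissiblePotential V) (c : ℝ)
    (v : EuclideanSpace ℝ (Fin d)) : PhaseReach (lineSystem V)
      fun x => c * (Real.exp (-‖x‖ ^ 2 / 2) * Real.exp (inner ℝ v x)) := by
  have hc : Continuous fun x : EuclideanSpace ℝ (Fin d) =>
      c * Real.exp (‖v‖ ^ 2 / 2) * Real.exp (-‖x‖ ^ 2 / 2) := by fun_prop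
  -- Completing the square in `-‖x - v‖²/2` leaves a factor `e^{-‖v‖²/2}`, which the amplitude
  -- compensates.
  have h := (phaseReach_gaussian hV (c * Real.exp (‖v‖ ^ 2 / 2))).comp_add hV hc (-v)
  refine (congrArg (PhaseReach (lineSystem V)) (funext fun x => ?_)).mp h
  rw [mul_assoc, ← Real.exp_add, ← Real.exp_add, ← sub_eq_add_neg, norm_sub_sq_real,
    real_inner_comm]
  congr 2
  ring

/-- The exponentials `e^{⟨v, x⟩}` on a subset, as continuous functions. -/
def expInner (B : Set (EuclideanSpace ℝ (Fin d))) (v : EuclideanSpace ℝ (Fin d)) : C(B, ℝ) :=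
  ⟨fun x => Real.exp (inner ℝ v (x : EuclideanSpace ℝ (Fin d))), by fun_prop⟩

/-- The product of the exponentials of `v` and `w` is that of `v + w`, and `v = 0` gives the unit.
-/
theorem adjoin_expInner (B : Set (EuclideanSpace ℝ (Fin d))) :
    Subalgebra.toSubmodule (Algebra.adjoin ℝ (Set.range (expInner B))) =
      Submodule.span ℝ (Set.range (expInner B)) := by
  apply Algebra.adjoin_eq_span_of_subset
  refine Set.Subset.trans ?_ Submodule.subset_span
  intro x hx
  refine Submonoid.closure_induction (fun _ => id) ⟨0, ?_⟩ ?_ hx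
  · ext p
    simp [expInner]
  · rintro _ _ _ _ ⟨v, rfl⟩ ⟨w, rfl⟩
    refine ⟨v + w, ?_⟩
    ext p
    simp [expInner, inner_add_left, Real.exp_add]

theorem separatesPoints_expInner (B : Set (EuclideanSpace ℝ (Fin d))) :
    (Algebra.adjoin ℝ (Set.range (expInner B))).SeparatesPoints := by
  intro x y hxy
  -- With `v = x - y`, equal values at `x` and `y` would give `‖x - y‖² = 0`.
  refine ⟨_, ⟨expInner B (x - y), Algebra.subset_adjoin ⟨_, rfl⟩, rfl⟩, fun h => hxy ?_⟩
  have h1 := Real.exp_injective h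
  rw [← sub_eq_zero, ← inner_sub_right, inner_self_eq_zero, sub_eq_zero] at h1
  exact Subtype.ext h1

/-- Stone–Weierstrass lives on a compact `B`, whereas a phase acts on the whole space: the
combination of exponentials is extended to `ℝ^d` with the same coefficients. -/
theorem exists_phaseReach_of_mem_span (hV : AdmissiblePotential V)
    {B : Set (EuclideanSpace ℝ (Fin d))} {g : C(B, ℝ)}
    (hg : g ∈ Submodule.span ℝ (Set.range (expInner B))) :
    ∃ h : EuclideanSpace ℝ (Fin d) → ℝ, Continuous h ∧ (∀ x : B, h x = g x) ∧
      ∀ c : ℝ, PhaseReach (lineSystem V) fun x => c * (Real.exp (-‖x‖ ^ 2 / 2) * h x) := by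
  induction hg using Submodule.span_induction with
  | mem g hg =>
    obtain ⟨v, rfl⟩ := hg
    exact ⟨fun x => Real.exp (inner ℝ v x), by fun_prop, fun x => rfl,
      fun c => phaseReach_gaussian_mul_exp hV c v⟩
  | zero =>
    refine ⟨fun _ => 0, continuous_const, fun x => rfl, fun c => ?_⟩
    simpa using PhaseReach.const 0
  | add g g' _ _ h1 h2 =>
    obtain ⟨h, hc, hg, hr⟩ := h1
    obtain ⟨h', hc', hg', hr'⟩ := h2
    have hm : ∀ {h : EuclideanSpace ℝ (Fin d) → ℝ} (c : ℝ), Continuous h → AEStronglyMeasurable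
        (fun x => c * (Real.exp (-‖x‖ ^ 2 / 2) * h x)) volume := fun c hh => by
      refine Continuous.aestronglyMeasurable ?_
      fun_prop
    refine ⟨fun x => h x + h' x, hc.add hc', fun x => by simp [hg, hg'], fun c => ?_⟩
    have := (hr c).add (hr' c) (hm c hc) (hm c hc')
    refine (congrArg (PhaseReach (lineSystem V)) (funext fun x => ?_)).mp this
    ring
  | smul a g _ h1 =>
    obtain ⟨h, hc, hg, hr⟩ := h1
    refine ⟨fun x => a * h x, continuous_const.mul hc, fun x => by simp [hg], fun c => ?_⟩
    refine (congrArg (PhaseReach (lineSystem V)) (funext fun x => ?_)).mp (hr (c * a))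
    ring

/-- On the ball of radius `n`, approximate `e^{‖x‖²/2}φ` by combinations of exponentials;
multiplying back by the gaussian, which is at most `1`, does not increase the error. Pointwise
convergence of the phases is enough, so their behaviour outside the balls is irrelevant. -/
theorem phaseReach_of_continuous (hV : AdmissiblePotential V)
    {φ : EuclideanSpace ℝ (Fin d) → ℝ} (hφ : Continuous φ) : PhaseReach (lineSystem V) φ := by
  have key : ∀ n : ℕ, ∃ h : EuclideanSpace ℝ (Fin d) → ℝ, Continuous h ∧
      PhaseReach (lineSystem V) (fun x => Real.exp (-‖x‖ ^ 2 / 2) * h x) ∧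
      ∀ x, ‖x‖ ≤ n → |Real.exp (-‖x‖ ^ 2 / 2) * h x - φ x| ≤ 1 / ((n : ℝ) + 1) := by
    intro n
    set B : Set (EuclideanSpace ℝ (Fin d)) := Metric.closedBall 0 n with hB
    have hBc : CompactSpace B := isCompact_iff_compactSpace.1 (isCompact_closedBall 0 _)
    let φ' : C(B, ℝ) := ⟨fun x => Real.exp (‖(x : EuclideanSpace ℝ (Fin d))‖ ^ 2 / 2) * φ x, by
      have := hφ.comp (continuous_subtype_val (p := fun x => x ∈ B))
      simp only [Function.comp_def] at this
      fun_prop⟩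
    have hn : (0 : ℝ) < 1 / ((n : ℝ) + 1) := by positivity
    have hcl := ContinuousMap.continuousMap_mem_subalgebra_closure_of_separatesPoints
      (Algebra.adjoin ℝ (Set.range (expInner B))) (separatesPoints_expInner B) φ'
    obtain ⟨g, hg, hgφ⟩ := Metric.mem_closure_iff.1 hcl _ hn
    have hg' : g ∈ Submodule.span ℝ (Set.range (expInner B)) := by
      rw [← adjoin_expInner]
      exact hg
    obtain ⟨h, hc, hgh, hr⟩ := exists_phaseReach_of_mem_span hV hg'
    refine ⟨h, hc, by simpa using hr 1, fun x hx => ?_⟩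
    have hxB : x ∈ B := mem_closedBall_zero_iff.2 hx
    have h1 : |φ' ⟨x, hxB⟩ - g ⟨x, hxB⟩| ≤ 1 / ((n : ℝ) + 1) := by
      rw [← Real.dist_eq]
      exact (ContinuousMap.dist_apply_le_dist _).trans hgφ.le
    have h2 : Real.exp (-‖x‖ ^ 2 / 2) * h x - φ x =
        -(Real.exp (-‖x‖ ^ 2 / 2) * (φ' ⟨x, hxB⟩ - g ⟨x, hxB⟩)) := by
      have e1 : Real.exp (-‖x‖ ^ 2 / 2) * Real.exp (‖x‖ ^ 2 / 2) = 1 := by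
        rw [← Real.exp_add, neg_div, neg_add_cancel, Real.exp_zero]
      rw [← hgh ⟨x, hxB⟩]
      simp only [φ', ContinuousMap.coe_mk]
      linear_combination (φ x) * e1
    rw [h2, abs_neg, abs_mul, abs_of_pos (Real.exp_pos _)]
    refine le_trans (mul_le_of_le_one_left (abs_nonneg _) (Real.exp_le_one_iff.2 ?_)) h1
    have := sq_nonneg ‖x‖
    linarith
  choose h hc hr hφh using key
  refine PhaseReach.of_tendsto hr (fun n => ?_) hφ.aestronglyMeasurable (ae_of_all _ fun x => ?_)
  · refine Continuous.aestronglyMeasurable ?_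
    have := hc n
    fun_prop
  · rw [tendsto_iff_norm_sub_tendsto_zero]
    refine squeeze_zero' (Eventually.of_forall fun n => norm_nonneg _) ?_
      tendsto_one_div_add_atTop_nhds_zero_nat
    filter_upwards [eventually_ge_atTop ⌈‖x‖⌉₊] with n hn
    exact hφh n x ((Nat.le_ceil _).trans (by exact_mod_cast hn))

/-- Test functions converge to `φ` in `L²`, hence almost everywhere along a subsequence, and their
real parts are continuous phases. -/
theorem isSTAR_line_phase (hV : AdmissiblePotential V)
    (φ : Lp ℝ 2 (volume : Measure (EuclideanSpace ℝ (Fin d)))) :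
    IsSTAR (lineSystem V) (phase φ) := by
  have hφ : MemLp (fun p => (φ p : ℂ)) 2 volume := (Lp.memLp φ).ofReal
  obtain ⟨z, hz, hlim⟩ := mem_closure_iff_seq_limit.1
    (dense_testFun (d := d) (toL2 volume fun p => (φ p : ℂ)))
  choose f hf hfz using hz
  obtain ⟨n, -, hn⟩ := (tendstoInMeasure_of_tendsto_Lp hlim).exists_seq_tendsto_ae
  have hc : ∀ m, Continuous fun p => (f (n m) p).re := fun m =>
    Complex.continuous_re.comp (hf (n m)).continuous
  refine PhaseReach.isSTAR (PhaseReach.of_tendsto (φ := fun m p => (f (n m) p).re)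
    (fun m => phaseReach_of_continuous hV (hc m)) (fun m => (hc m).aestronglyMeasurable)
    (Lp.aestronglyMeasurable φ) ?_)
  have hfz' : ∀ᵐ p, ∀ m, z (n m) p = f (n m) p := by
    refine ae_all_iff.2 fun m => ?_
    rw [← hfz (n m)]
    exact coeFn_toL2 (hf (n m)).memLp
  filter_upwards [hn, coeFn_toL2 hφ, hfz'] with p hp hp' hpf
  rw [hp'] at hp
  simp only [hpf] at hp
  have := (Complex.continuous_re.tendsto _).comp hp
  simpa [Function.comp_def] using this

end LinePhase

end SchrodingerControl

theorem theorem5 (d : ℕ) (hd : 1 ≤ d) :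
    (∀ V : SchrodingerControl.Torus d → ℝ, MemLp V ∞ volume →
      ∀ φ : Lp ℝ 2 (volume : Measure (SchrodingerControl.Torus d)),
        SchrodingerControl.IsSTAR (SchrodingerControl.torusSystem V)
          (SchrodingerControl.phase φ)) ∧
    (∀ V : EuclideanSpace ℝ (Fin d) → ℝ, SchrodingerControl.AdmissiblePotential V →
      (∀ (j : Fin d) (u : ℝ),
        SchrodingerControl.IsSTAR (SchrodingerControl.lineSystem V)
          (SchrodingerControl.translation (EuclideanSpace.single j u))) ∧
      (∀ φ : Lp ℝ 2 (volume : Measure (EuclideanSpace ℝ (Fin d))),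
        SchrodingerControl.IsSTAR (SchrodingerControl.lineSystem V)
          (SchrodingerControl.phase φ))) :=
  ⟨fun _ hV φ => SchrodingerControl.isSTAR_torus_phase hd hV φ, fun _ hV =>
    ⟨fun j u => SchrodingerControl.isSTAR_line_translation hV j u,
      fun φ => SchrodingerControl.isSTAR_line_phase hV φ⟩⟩

end
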